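/- Let $d\ge 2$ and let $\Omega\subset\mathbb R^d$ be a bounded open set with Lipschitz boundary $\Gamma$. Let $g_0(s)=\sum_{i=0}^N a_is^{\alpha_i}$, where $N\ge 1$, $0=\alpha_0<\alpha_1<\dots<\alpha_N$ are real, $a_i\ge 0$, and $a_0,a_N>0$. For $\xi\ge 0$ put $K(\xi)=1/g_0(s(\xi))$, where $s(\xi)$ is the unique $s\ge 0$ with $s\,g_0(s)=\xi$. Put $$a=\frac{\alpha_N}{\alpha_N+1},\qquad \beta=2-a,\qquad \lambda=\frac{\beta}{\beta-1},$$ and assume the degree condition $a\le \frac4{d+2}$ (that is, $\alpha_N\le\frac 4{d-2}$ if $d\ge 3$, and no condition if $d=2$). Write $(\cdot,\cdot)$ and $\|\cdot\|$ for the inner product and norm of $L^2(\Omega)$ (scalar or vector valued), and $\|u\|_1=(\|u\|^2+\|\nabla u\|^2)^{1/2}$ for the norm of $H^1(\Omega)$. Let $r\ge 0$ be an integer and $\sigma>0$. Let $\mathcal T_h$ be a finite conforming simplicial triangulation of $\overline\Omega$ with maximal element diameter $h$, quasi-uniform with constant $\sigma$: every element contains a ball of radius $\sigma h$. Let $W_h$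 be the space of continuous functions on $\overline\Omega$ that are polynomials of degree at most $r$ on each element, let $W_h^0=\{v\in W_h: v=0\text{ on }\Gamma\}$, and let $\pi$ be the $L^2(\Omega)$-orthogonal projection onto $W_h$. Let $\tilde\rho^0\in L^2(\Omega)$ and, for each $t\ge 0$, let $\tilde f(t)\in L^2(\Omega)$ and $\phi(t)\in H^1(\Omega)$. Let $\tilde\rho_h=\rho_h-\pi\phi:[0,\infty)\to W_h^0$ be a solution of the semidiscrete problem $$(\tilde\rho_{h,t},w_h)+(K(|\nabla\rho_h|)\nabla\rho_h,\nabla w_h)=(\tilde f,w_h)\qquad\text{for all } w_h\in W_h^0,\ t>0,$$ continuous at $t=0$ and differentiable for $t>0$, whose initial value $\tilde\rho_h(0)$ is the $L^2(\Omega)$-orthogonal projection of $\tilde\rho^0$ onto $W_h^0$. Put $$g(t)=\|\tilde f(t)\|^\lambda+\|\phi(t)\|_1^2 .$$ Then there is a constant $C>0$, depending only on $d$, $\Omega$, $g_0$, $r$ and $\sigma$ (and not on the triangulation, its mesh size, $\tilde\rho^0$, $\tilde f$, $\phi$ or the solution), such that the following hold. 1. For every continuous nondecreasing function $\mathrm{Env}\,g$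 on $[0,\infty)$ with $\mathrm{Env}\,g\ge g$ and all $t>0$, $$\|\tilde\rho_h(t)\|\le C\Big(1+\|\tilde\rho^0\|+\big(\mathrm{Env}\,g(t)\big)^{1/\beta}\Big).$$ 2. In $[0,\infty]$, $$\limsup_{t\to\infty}\|\tilde\rho_h(t)\|^2\le C\Big(1+\limsup_{t\to\infty}g(t)\Big)^{2/\beta}.$$ 3. If $\limsup_{t\to\infty}\|\tilde f(t)\|=\limsup_{t\to\infty}\|\phi(t)\|_1=0$, then $\limsup_{t\to\infty}\|\tilde\rho_h(t)\|^2=0$. -/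

import Mathlib

open MeasureTheory Filter Topology Set
open scoped ContDiff

noncomputable section

namespace Forchheimer

/-- A generalized polynomial `g(s) = a₀ s^α₀ + a₁ s^α₁ + ⋯ + a_N s^α_N` with `N ≥ 1`, real exponents
`0 = α₀ < α₁ < ⋯ < α_N` and nonnegative coefficients such that `a₀ > 0` and `a_N > 0`. -/
structure GenPoly where
  N : ℕ
  one_le_N : 1 ≤ N
  exponent : Fin (N + 1) → ℝ
  coeff : Fin (N + 1) → ℝ
  exponent_zero : exponent 0 = 0
  exponent_strictMono : StrictMono exponent
  coeff_nonneg : ∀ i, 0 ≤ coeff i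
  coeff_zero_pos : 0 < coeff 0
  coeff_last_pos : 0 < coeff (Fin.last N)

namespace GenPoly

variable (P : GenPoly)

/-- The value `g(s)`, for `s ≥ 0`. -/
def g (s : ℝ) : ℝ := ∑ i, P.coeff i * s ^ P.exponent i

/-- The degree `α_N` of `g`. -/
def deg : ℝ := P.exponent (Fin.last P.N)

/-- The exponent `a = α_N / (α_N + 1)`. -/
def a : ℝ := P.deg / (P.deg + 1)

/-- The exponent `β = 2 - a`. -/
def β : ℝ := 2 - P.a

/-- The exponent `λ = β / (β - 1) = (2 - a) / (1 - a)`. -/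
def lam : ℝ := P.β / (P.β - 1)

/-- The unique `s ≥ 0` with `s g(s) = ξ`, for `ξ ≥ 0`. -/
def root (ξ : ℝ) : ℝ := Classical.epsilon fun s : ℝ => 0 ≤ s ∧ s * P.g s = ξ

/-- The function `K(ξ) = 1 / g(s(ξ))`, for `ξ ≥ 0`. -/
def K (ξ : ℝ) : ℝ := 1 / P.g (P.root ξ)

/-- The Degree Condition `a ≤ 4 / (d + 2)`; it says `deg g ≤ 4 / (d - 2)` for `d ≥ 3` and
nothing for `d = 2`. -/
def DegreeCondition (d : ℕ) : Prop := P.a ≤ 4 / ((d : ℝ) + 2)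

lemma exponent_nonneg (i : Fin (P.N + 1)) : 0 ≤ P.exponent i := by
  rw [← P.exponent_zero]
  exact P.exponent_strictMono.monotone (Fin.zero_le i)

lemma coeff_zero_le_g {s : ℝ} (hs : 0 ≤ s) : P.coeff 0 ≤ P.g s := by
  have h := Finset.single_le_sum (f := fun i => P.coeff i * s ^ P.exponent i)
    (fun i _ => mul_nonneg (P.coeff_nonneg i) (Real.rpow_nonneg hs _)) (Finset.mem_univ 0)
  simpa [g, P.exponent_zero] using h

/-- The equation that defines `s(ξ)` has exactly one nonnegative solution. -/
lemma existsUnique_root {ξ : ℝ} (hξ : 0 ≤ ξ) : ∃! s : ℝ, 0 ≤ s ∧ s * P.g s = ξ := by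
  have hcont : Continuous fun s : ℝ => s * P.g s :=
    continuous_id.mul (continuous_finsetSum _ fun i _ =>
      continuous_const.mul (Real.continuous_rpow_const (P.exponent_nonneg i)))
  have hmono : ∀ s t : ℝ, 0 ≤ s → s < t → s * P.g s < t * P.g t := by
    intro s t hs hst
    have hg : P.g s ≤ P.g t := Finset.sum_le_sum fun i _ =>
      mul_le_mul_of_nonneg_left (Real.rpow_le_rpow hs hst.le (P.exponent_nonneg i))
        (P.coeff_nonneg i)
    have hpos : 0 < P.g t := P.coeff_zero_pos.trans_le (P.coeff_zero_le_g (hs.trans hst.le))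
    calc s * P.g s ≤ s * P.g t := mul_le_mul_of_nonneg_left hg hs
      _ < t * P.g t := mul_lt_mul_of_pos_right hst hpos
  have h0 := P.coeff_zero_pos
  have hb : 0 ≤ ξ / P.coeff 0 := div_nonneg hξ h0.le
  have htop : ξ ≤ ξ / P.coeff 0 * P.g (ξ / P.coeff 0) := by
    calc ξ = ξ / P.coeff 0 * P.coeff 0 := by field_simp
      _ ≤ _ := mul_le_mul_of_nonneg_left (P.coeff_zero_le_g hb) hb
  obtain ⟨s, hs, hsξ⟩ := intermediate_value_Icc hb hcont.continuousOn
    (show ξ ∈ Icc ((0 : ℝ) * P.g 0) _ from ⟨by simpa using hξ, htop⟩)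
  refine ⟨s, ⟨hs.1, hsξ⟩, ?_⟩
  rintro t ⟨ht, htξ⟩
  rcases lt_trichotomy t s with h | h | h
  · exact absurd (hmono t s ht h) (by simp only [htξ] at *; simp [hsξ])
  · exact h
  · exact absurd (hmono s t hs.1 h) (by simp only [htξ] at *; simp [hsξ])

lemma root_spec {ξ : ℝ} (hξ : 0 ≤ ξ) : 0 ≤ P.root ξ ∧ P.root ξ * P.g (P.root ξ) = ξ :=
  Classical.epsilon_spec (P.existsUnique_root hξ).exists

end GenPoly

/-! ### Domains and function spaces -/

/-- `ℝ^d` with the Euclidean norm. -/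
abbrev Space (d : ℕ) : Type := EuclideanSpace ℝ (Fin d)

variable {d : ℕ}

/-- The boundary of `Ω` is locally the graph of a Lipschitz function, with `Ω` on one side of it:
`ν` is the vertical direction and `ψ` a Lipschitz function of the horizontal component. -/
def HasLipschitzBoundary (Ω : Set (Space d)) : Prop :=
  ∀ x ∈ frontier Ω, ∃ U ∈ 𝓝 x, ∃ ν : Space d, ‖ν‖ = 1 ∧
    ∃ (L : NNReal) (ψ : Space d → ℝ), LipschitzWith L ψ ∧
      ∀ y ∈ U, (y ∈ Ω ↔ inner ℝ ν y < ψ (y - (inner ℝ ν y : ℝ) • ν))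

/-- The norm of `L²(Ω)`, for scalar and for vector functions. -/
def l2Norm {F : Type*} [NormedAddCommGroup F] (Ω : Set (Space d)) (u : Space d → F) : ℝ :=
  (eLpNorm u 2 (volume.restrict Ω)).toReal

/-- `G` is a square integrable weak gradient of `u` on `Ω`. -/
def IsWeakGradient (Ω : Set (Space d)) (u : Space d → ℝ) (G : Space d → Space d) : Prop :=
  MemLp G 2 (volume.restrict Ω) ∧
    ∀ η : Space d → ℝ, ContDiff ℝ ∞ η → HasCompactSupport η → tsupport η ⊆ Ω →
      ∫ x in Ω, u x • gradient η x = - ∫ x in Ω, η x • G x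

/-- Membership in `H¹(Ω)`. -/
def MemH1 (Ω : Set (Space d)) (u : Space d → ℝ) : Prop :=
  MemLp u 2 (volume.restrict Ω) ∧ ∃ G, IsWeakGradient Ω u G

/-- The weak gradient of `u ∈ H¹(Ω)`; it is determined up to a null set. -/
def weakGradient (Ω : Set (Space d)) (u : Space d → ℝ) : Space d → Space d :=
  Classical.epsilon fun G => IsWeakGradient Ω u G

/-- The norm `‖u‖₁ = (‖u‖² + ‖∇u‖²)^{1/2}` of `H¹(Ω)`. -/
def h1Norm (Ω : Set (Space d)) (u : Space d → ℝ) : ℝ :=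
  Real.sqrt (l2Norm Ω u ^ 2 + l2Norm Ω (weakGradient Ω u) ^ 2)

/-! ### Triangulations and finite element spaces -/

/-- A triangulation of `Ω`: a finite simplicial complex (so any two simplices meet in a common
face or not at all), all of whose simplices are faces of `d`-dimensional ones, and whose union is
the closure of `Ω`. -/
structure Triangulation (Ω : Set (Space d)) where
  complex : Geometry.SimplicialComplex ℝ (Space d)
  finite : complex.faces.Finite
  pure : ∀ s ∈ complex.faces, ∃ t ∈ complex.faces, s ⊆ t ∧ t.card = d + 1
  space_eq : complex.space = closure Ω

namespace Triangulation

variable {Ω : Set (Space d)} (T : Triangulation Ω)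

/-- The elements of the triangulation, i.e. its `d`-dimensional simplices, as vertex sets. -/
def cells : Set (Finset (Space d)) := {s | s ∈ T.complex.faces ∧ s.card = d + 1}

/-- The mesh size `h`: the maximum diameter of an element. -/
def meshSize : ℝ :=
  sSup ((fun s : Finset (Space d) => Metric.diam (convexHull ℝ (s : Set (Space d)))) '' T.cells)

/-- Global quasi-uniformity with constant `σ`: each element contains a ball of radius `σ h`. -/
def QuasiUniform (σ : ℝ) : Prop :=
  ∀ s ∈ T.cells, ∃ x,
    Metric.closedBall x (σ * T.meshSize) ⊆ convexHull ℝ (s : Set (Space d))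

/-- The finite element space `W_h` of the continuous functions on the closure of `Ω` that are
polynomials of degree at most `r` on each element. -/
def W (r : ℕ) : Set (Space d → ℝ) :=
  {v | ContinuousOn v (closure Ω) ∧ ∀ s ∈ T.cells, ∃ p : MvPolynomial (Fin d) ℝ,
    p.totalDegree ≤ r ∧
      ∀ x ∈ convexHull ℝ (s : Set (Space d)), v x = MvPolynomial.eval (fun i => x i) p}

/-- The subspace of the functions in `W_h` that vanish on the boundary of `Ω`, that is,
`W_h ∩ H₀¹(Ω)`. -/
def W₀ (r : ℕ) : Set (Space d → ℝ) := {v | v ∈ T.W r ∧ ∀ x ∈ frontier Ω, v x = 0}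

end Triangulation

/-- `v` is the `L²(Ω)`-projection of `w` to the linear space `V`. -/
def IsL2Projection (Ω : Set (Space d)) (V : Set (Space d → ℝ)) (w v : Space d → ℝ) : Prop :=
  v ∈ V ∧ ∀ z ∈ V, ∫ x in Ω, v x * z x = ∫ x in Ω, w x * z x

/-! ### The semidiscrete problem -/

/-- `ρt = ρ - πφ`, a function of time with values in `W_h ∩ H₀¹(Ω)`, is a solution of
`(∂ₜρt, w) + (K(|∇ρ|) ∇ρ, ∇w) = (f, w)` for all `w ∈ W_h ∩ H₀¹(Ω)` and all `t > 0`, the initial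
value being the projection of `ρt0`. Gradients of piecewise polynomials are taken pointwise, which
makes sense in the interior of each element, hence almost everywhere. -/
structure IsSemidiscreteSolution (P : GenPoly) {Ω : Set (Space d)} (T : Triangulation Ω) (r : ℕ)
    (ρt0 : Space d → ℝ) (f φ ρ ρt : ℝ → Space d → ℝ) : Prop where
  mem : ∀ t, 0 ≤ t → ρt t ∈ T.W₀ r
  proj : ∀ t, 0 ≤ t → IsL2Projection Ω (T.W r) (φ t) (fun x => ρ t x - ρt t x)
  init : IsL2Projection Ω (T.W₀ r) ρt0 (ρt 0)
  cont_zero : ∀ x ∈ closure Ω, ContinuousWithinAt (fun s => ρt s x) (Ici 0) 0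
  diff : ∀ t, 0 < t → ∀ x ∈ closure Ω, DifferentiableAt ℝ (fun s => ρt s x) t
  eqn : ∀ t, 0 < t → ∀ w ∈ T.W₀ r,
    (∫ x in Ω, deriv (fun s => ρt s x) t * w x) +
      (∫ x in Ω, inner ℝ (P.K ‖gradient (ρ t) x‖ • gradient (ρ t) x) (gradient w x)) =
        ∫ x in Ω, f t x * w x

/-- `F` is a continuous, increasing envelope of `u` on `I`. -/
def IsEnvelope (I : Set ℝ) (u F : ℝ → ℝ) : Prop :=
  ContinuousOn F I ∧ MonotoneOn F I ∧ ∀ t ∈ I, u t ≤ F t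

/-- The function `g(t) = ‖f(t)‖^λ + ‖φ(t)‖₁²` of the data. -/
def dataSize (P : GenPoly) (Ω : Set (Space d)) (f φ : ℝ → Space d → ℝ) (t : ℝ) : ℝ :=
  l2Norm Ω (f t) ^ P.lam + h1Norm Ω (φ t) ^ 2

/-- The upper limit as `t → ∞`, with values in `[0, ∞]`, of a nonnegative real function. -/
def limsupTop (u : ℝ → ℝ) : ENNReal := limsup (fun t => ENNReal.ofReal (u t)) atTop

end Forchheimer

end

open Forchheimer

/-!
Testing the equation with `ρt` gives the energy identity for `y = ‖ρt‖²`. The function `K` decays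
like `ξ ^ (-a)`, so that, for every `δ ∈ (0, 1]`, the energy density `K(|U|) |U|²` dominates a
multiple of `δ ^ a |U| ^ β` minus a multiple of `δ²`. On a quasi-uniform mesh the projection onto
`W_h` is stable in `H¹`, whence `‖∇πφ‖` is controlled by `‖φ‖₁`: by the inverse inequality it
suffices to compare `φ` with the continuous piecewise affine function whose nodal values are
averages of `φ` over balls of radius comparable to the mesh size, pushed inside `Ω` by the cone
condition. The degree condition is the one under which the Sobolev inequality bounds `‖ρt‖` by the
`L^β` norm of `∇ρt`. Altogether
`y' ≤ - c δ ^ a y ^ (β / 2) + C (δ² + ‖φ‖₁²) + 2 ‖f‖ √y`,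
and a barrier argument for this scalar inequality yields the bounds: `δ = 1` gives the first two,
and `δ → 0` gives the third.
-/

noncomputable section

namespace Forchheimer

/-! ### The nonlinearity -/

lemma one_add_rpow_le {s p : ℝ} (hs : 0 ≤ s) (hp : 0 ≤ p) :
    (1 + s) ^ p ≤ 2 ^ p * (1 + s ^ p) := by
  have hsp : 0 ≤ s ^ p := Real.rpow_nonneg hs p
  rcases le_total s 1 with h | h
  · calc (1 + s) ^ p ≤ 2 ^ p := Real.rpow_le_rpow (by linarith) (by linarith) hp
      _ ≤ _ := le_mul_of_one_le_right (by positivity) (by linarith)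
  · calc (1 + s) ^ p ≤ (2 * s) ^ p := Real.rpow_le_rpow (by linarith) (by linarith) hp
      _ = 2 ^ p * s ^ p := Real.mul_rpow zero_le_two hs
      _ ≤ _ := mul_le_mul_of_nonneg_left (by linarith) (by positivity)

namespace GenPoly

variable (P : GenPoly)

lemma deg_pos : 0 < P.deg := by
  have h : (0 : Fin (P.N + 1)) < Fin.last P.N := by
    rw [Fin.lt_def]
    exact P.one_le_N
  simpa only [P.exponent_zero, deg] using P.exponent_strictMono h

lemma a_pos : 0 < P.a := div_pos P.deg_pos (by linarith [P.deg_pos])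

lemma a_lt_one : P.a < 1 := (div_lt_one (by linarith [P.deg_pos])).2 (lt_add_one _)

lemma one_lt_β : 1 < P.β := by unfold β; linarith [P.a_lt_one]

lemma β_lt_two : P.β < 2 := by unfold β; linarith [P.a_pos]

lemma β_pos : 0 < P.β := one_pos.trans P.one_lt_β

lemma two_sub_β : 2 - P.β = P.a := sub_sub_cancel 2 P.a

lemma holderConjugate : P.β.HolderConjugate P.lam :=
  Real.HolderConjugate.conjExponent P.one_lt_β

lemma g_pos {s : ℝ} (hs : 0 ≤ s) : 0 < P.g s := P.coeff_zero_pos.trans_le (P.coeff_zero_le_g hs)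

lemma monotoneOn_g : MonotoneOn P.g (Ici 0) := fun _ hs _ _ hst =>
  Finset.sum_le_sum fun i _ => mul_le_mul_of_nonneg_left
    (Real.rpow_le_rpow hs hst (P.exponent_nonneg i)) (P.coeff_nonneg i)

lemma root_nonneg {ξ : ℝ} (hξ : 0 ≤ ξ) : 0 ≤ P.root ξ := (P.root_spec hξ).1

lemma root_mul_g {ξ : ℝ} (hξ : 0 ≤ ξ) : P.root ξ * P.g (P.root ξ) = ξ := (P.root_spec hξ).2

lemma K_nonneg {ξ : ℝ} (hξ : 0 ≤ ξ) : 0 ≤ P.K ξ :=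
  one_div_nonneg.2 (P.g_pos (P.root_nonneg hξ)).le

lemma K_le {ξ : ℝ} (hξ : 0 ≤ ξ) : P.K ξ ≤ 1 / P.coeff 0 :=
  one_div_le_one_div_of_le P.coeff_zero_pos (P.coeff_zero_le_g (P.root_nonneg hξ))

lemma monotoneOn_root : MonotoneOn P.root (Ici 0) := by
  intro ξ hξ η hη h
  by_contra! hlt
  have h₁ : P.root η * P.g (P.root η) ≤ P.root η * P.g (P.root ξ) :=
    mul_le_mul_of_nonneg_left (P.monotoneOn_g (P.root_nonneg hη) (P.root_nonneg hξ) hlt.le)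
      (P.root_nonneg hη)
  have h₂ : P.root η * P.g (P.root ξ) < P.root ξ * P.g (P.root ξ) :=
    mul_lt_mul_of_pos_right hlt (P.g_pos (P.root_nonneg hξ))
  linarith [P.root_mul_g hξ, P.root_mul_g hη]

lemma antitoneOn_K : AntitoneOn P.K (Ici 0) := fun _ hξ _ hη h =>
  one_div_le_one_div_of_le (P.g_pos (P.root_nonneg hξ))
    (P.monotoneOn_g (P.root_nonneg hξ) (P.root_nonneg hη) (P.monotoneOn_root hξ hη h))

lemma measurable_K_norm {X F : Type*} [MeasurableSpace X] [NormedAddCommGroup F]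
    [MeasurableSpace F] [OpensMeasurableSpace F] {u : X → F} (hu : Measurable u) :
    Measurable fun x => P.K ‖u x‖ := by
  have hanti : Antitone fun ξ => P.K (max 0 ξ) := fun ξ η h =>
    P.antitoneOn_K (mem_Ici.2 (le_max_left _ _)) (mem_Ici.2 (le_max_left _ _))
      (max_le_max le_rfl h)
  simpa only [Function.comp_def, max_eq_right (norm_nonneg _)] using hanti.measurable.comp hu.norm

lemma g_le {s : ℝ} (hs : 0 ≤ s) : P.g s ≤ (∑ i, P.coeff i) * (1 + s) ^ P.deg := by
  rw [g, Finset.sum_mul]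
  refine Finset.sum_le_sum fun i _ => mul_le_mul_of_nonneg_left ?_ (P.coeff_nonneg i)
  calc s ^ P.exponent i ≤ (1 + s) ^ P.exponent i :=
        Real.rpow_le_rpow hs (by linarith) (P.exponent_nonneg i)
    _ ≤ (1 + s) ^ P.deg := Real.rpow_le_rpow_of_exponent_le (by linarith)
        (P.exponent_strictMono.monotone (Fin.le_last i))

lemma coeff_last_mul_rpow_le_g {s : ℝ} (hs : 0 ≤ s) :
    P.coeff (Fin.last P.N) * s ^ P.deg ≤ P.g s :=
  Finset.single_le_sum (f := fun i => P.coeff i * s ^ P.exponent i)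
    (fun i _ => mul_nonneg (P.coeff_nonneg i) (Real.rpow_nonneg hs _)) (Finset.mem_univ _)

lemma root_rpow_le {ξ : ℝ} (hξ : 0 ≤ ξ) :
    P.root ξ ^ (P.deg + 1) ≤ ξ / P.coeff (Fin.last P.N) := by
  have hs := P.root_nonneg hξ
  have hdeg := P.deg_pos
  rw [le_div_iff₀ P.coeff_last_pos, Real.rpow_add_one' hs (by positivity)]
  calc P.root ξ ^ P.deg * P.root ξ * P.coeff (Fin.last P.N)
      = P.root ξ * (P.coeff (Fin.last P.N) * P.root ξ ^ P.deg) := by ring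
    _ ≤ P.root ξ * P.g (P.root ξ) :=
        mul_le_mul_of_nonneg_left (P.coeff_last_mul_rpow_le_g hs) hs
    _ = ξ := P.root_mul_g hξ

lemma exists_g_root_le : ∃ C : ℝ, 0 < C ∧ ∀ ξ, 0 ≤ ξ → P.g (P.root ξ) ≤ C * (1 + ξ) ^ P.a := by
  have hdeg := P.deg_pos
  have hlast := P.coeff_last_pos
  set A : ℝ := ∑ i, P.coeff i
  have hA : 0 < A := Finset.sum_pos' (fun i _ => P.coeff_nonneg i)
    ⟨0, Finset.mem_univ _, P.coeff_zero_pos⟩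
  set c := P.coeff (Fin.last P.N)
  set B : ℝ := 2 ^ (P.deg + 1) * (1 + 1 / c) with hB
  refine ⟨A * B ^ P.a, by positivity, fun ξ hξ => ?_⟩
  have hs := P.root_nonneg hξ
  have hroot : (1 + P.root ξ) ^ (P.deg + 1) ≤ B * (1 + ξ) := by
    refine (one_add_rpow_le hs (by positivity)).trans ?_
    rw [hB, mul_assoc]
    refine mul_le_mul_of_nonneg_left ?_ (by positivity)
    have hsplit : (1 + 1 / c) * (1 + ξ) = 1 + ξ / c + (ξ + 1 / c) := by ring
    have hnonneg : 0 ≤ ξ + 1 / c := by positivity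
    linarith [P.root_rpow_le hξ]
  calc P.g (P.root ξ) ≤ A * (1 + P.root ξ) ^ P.deg := P.g_le hs
    _ = A * ((1 + P.root ξ) ^ (P.deg + 1)) ^ P.a := by
        rw [← Real.rpow_mul (by linarith), a, mul_div_cancel₀ _ (by positivity)]
    _ ≤ A * (B * (1 + ξ)) ^ P.a := by
        gcongr
        exact P.a_pos.le
    _ = A * B ^ P.a * (1 + ξ) ^ P.a := by
        rw [Real.mul_rpow (by positivity) (by linarith)]; ring

lemma rpow_β_le_of_le {δ ξ : ℝ} (hξ : 0 ≤ ξ) (h : ξ ≤ δ) {x : ℝ} (hx : 0 ≤ x) :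
    ξ ^ P.β ≤ δ ^ P.β + x :=
  (Real.rpow_le_rpow hξ h P.β_pos.le).trans (le_add_of_nonneg_right hx)

lemma exists_rpow_β_le_K_mul_sq : ∃ C : ℝ, 0 < C ∧ ∀ δ, 0 < δ → δ ≤ 1 → ∀ ξ, 0 ≤ ξ →
    ξ ^ P.β ≤ δ ^ P.β + C * δ ^ (-P.a) * (P.K ξ * ξ ^ 2) := by
  obtain ⟨C, hC, hg⟩ := P.exists_g_root_le
  refine ⟨C * 2 ^ P.a, by positivity, fun δ hδ hδ1 ξ hξ => ?_⟩
  have hK := P.K_nonneg hξ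
  rcases le_total ξ δ with h | h
  · exact P.rpow_β_le_of_le hξ h (by positivity)
  have hξ0 : 0 < ξ := hδ.trans_le h
  have hscale : (1 + ξ) ^ P.a ≤ 2 ^ P.a * ξ ^ P.a * δ ^ (-P.a) := by
    calc (1 + ξ) ^ P.a ≤ (2 * ξ / δ) ^ P.a :=
          Real.rpow_le_rpow (by linarith) (by rw [le_div_iff₀ hδ]; nlinarith) P.a_pos.le
      _ = _ := by
          rw [Real.div_rpow (by positivity) hδ.le, Real.mul_rpow zero_le_two hξ,
            Real.rpow_neg hδ.le, div_eq_mul_inv]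
  have hone : 1 ≤ C * (2 ^ P.a * ξ ^ P.a * δ ^ (-P.a)) * P.K ξ := by
    rw [K, mul_one_div, le_div_iff₀ (P.g_pos (P.root_nonneg hξ)), one_mul]
    exact (hg ξ hξ).trans (mul_le_mul_of_nonneg_left hscale hC.le)
  have hsq : ξ ^ P.β * ξ ^ P.a = ξ ^ 2 := by
    rw [← Real.rpow_add hξ0, β, sub_add_cancel, Real.rpow_two]
  calc ξ ^ P.β ≤ ξ ^ P.β * (C * (2 ^ P.a * ξ ^ P.a * δ ^ (-P.a)) * P.K ξ) :=
        le_mul_of_one_le_right (by positivity) hone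
    _ = C * 2 ^ P.a * δ ^ (-P.a) * (P.K ξ * (ξ ^ P.β * ξ ^ P.a)) := by ring
    _ = C * 2 ^ P.a * δ ^ (-P.a) * (P.K ξ * ξ ^ 2) := by rw [hsq]
    _ ≤ _ := le_add_of_nonneg_left (by positivity)

lemma rpow_β_le {δ : ℝ} (hδ : 0 < δ) {ξ : ℝ} (hξ : 0 ≤ ξ) :
    ξ ^ P.β ≤ δ ^ P.β + δ ^ (-P.a) * ξ ^ 2 := by
  rcases le_total ξ δ with h | h
  · exact P.rpow_β_le_of_le hξ h (by positivity)
  calc ξ ^ P.β = ξ ^ (-P.a) * ξ ^ 2 := by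
        rw [← Real.rpow_two, ← Real.rpow_add (hδ.trans_le h), β, neg_add_eq_sub]
    _ ≤ δ ^ (-P.a) * ξ ^ 2 := mul_le_mul_of_nonneg_right
        (Real.rpow_le_rpow_of_nonpos hδ h (by linarith [P.a_pos])) (sq_nonneg ξ)
    _ ≤ _ := le_add_of_nonneg_left (by positivity)

end GenPoly

/-! ### Differential inequalities -/

lemma le_of_deriv_nonpos_above {y : ℝ → ℝ} {a b m : ℝ} (hab : a ≤ b)
    (hc : ContinuousOn y (Icc a b)) (hd : ∀ t ∈ Ioo a b, DifferentiableAt ℝ y t)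
    (ha : y a ≤ m) (h : ∀ t ∈ Ioo a b, m < y t → deriv y t ≤ 0) : y b ≤ m := by
  by_contra! hb
  have hcpt : IsCompact (Icc a b ∩ y ⁻¹' Iic m) :=
    isCompact_Icc.of_isClosed_subset (hc.preimage_isClosed_of_isClosed isClosed_Icc isClosed_Iic)
      inter_subset_left
  -- After the last time `t` at which `y ≤ m`, the function `y` cannot increase.
  obtain ⟨t, ⟨ht, hyt⟩, hmax⟩ := hcpt.exists_isGreatest ⟨a, ⟨le_rfl, hab⟩, ha⟩
  have hsub : Icc t b ⊆ Icc a b := Icc_subset_Icc_left ht.1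
  have hsub' : interior (Icc t b) ⊆ Ioo a b := by
    rw [interior_Icc]
    exact Ioo_subset_Ioo_left ht.1
  have hanti : AntitoneOn y (Icc t b) := by
    refine antitoneOn_of_deriv_nonpos (convex_Icc t b) (hc.mono hsub)
      (fun s hs => (hd s (hsub' hs)).differentiableWithinAt) fun s hs => h s (hsub' hs) ?_
    by_contra! hle
    rw [interior_Icc] at hs
    exact absurd (hmax ⟨hsub ⟨hs.1.le, hs.2.le⟩, hle⟩) (not_le.2 hs.1)
  exact absurd ((hanti ⟨le_rfl, ht.2⟩ ⟨ht.2, le_rfl⟩ ht.2).trans hyt) (not_le.2 hb)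

lemma exists_le_of_deriv_le_neg {y : ℝ → ℝ} {T m k : ℝ} (hk : 0 < k)
    (hd : ∀ t, T ≤ t → DifferentiableAt ℝ y t) (h0 : ∀ t, T ≤ t → 0 ≤ y t)
    (h : ∀ t, T ≤ t → m < y t → deriv y t ≤ -k) : ∃ t, T ≤ t ∧ y t ≤ m := by
  by_contra! habove
  obtain ⟨b, hTb, hb⟩ : ∃ b, T ≤ b ∧ k * (b - T) = y T + 1 := by
    have hyT := h0 T le_rfl
    exact ⟨T + (y T + 1) / k, le_add_of_nonneg_right (by positivity), by field_simp; ring⟩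
  have hdecay : y b - y T ≤ -k * (b - T) := by
    refine (convex_Icc T b).image_sub_le_mul_sub_of_deriv_le
      (fun s hs => (hd s hs.1).continuousAt.continuousWithinAt) ?_ ?_
      T ⟨le_rfl, hTb⟩ b ⟨hTb, le_rfl⟩ hTb <;> rw [interior_Icc]
    · exact fun s hs => (hd s hs.1.le).differentiableWithinAt
    · exact fun s hs => h s hs.1.le (habove s hs.1.le)
  linarith [h0 b hTb]

lemma eventually_le_of_deriv_le_neg {y : ℝ → ℝ} {m k : ℝ} (hk : 0 < k)
    (hd : ∀ᶠ t in atTop, DifferentiableAt ℝ y t) (h0 : ∀ᶠ t in atTop, 0 ≤ y t)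
    (h : ∀ᶠ t in atTop, m < y t → deriv y t ≤ -k) : ∀ᶠ t in atTop, y t ≤ m := by
  obtain ⟨T, hT⟩ := eventually_atTop.1 (hd.and (h0.and h))
  obtain ⟨t, hTt, hyt⟩ := exists_le_of_deriv_le_neg hk (fun t ht => (hT t ht).1)
    (fun t ht => (hT t ht).2.1) fun t ht => (hT t ht).2.2
  filter_upwards [eventually_ge_atTop t] with s hs
  refine le_of_deriv_nonpos_above hs
    (fun x hx => (hT x (hTt.trans hx.1)).1.continuousAt.continuousWithinAt)
    (fun x hx => (hT x (hTt.trans hx.1.le)).1) hyt fun x hx hmx => ?_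
  linarith [(hT x (hTt.trans hx.1.le)).2.2 hmx]

/-- The constant of `F ^ l` when Young's inequality splits `2 * F * z` with the constant `k` of
`z ^ p`. -/
def youngConst (p l k : ℝ) : ℝ := (2 / k ^ p⁻¹) ^ l

lemma youngConst_pos (p l : ℝ) {k : ℝ} (hk : 0 < k) : 0 < youngConst p l k :=
  Real.rpow_pos_of_pos (by positivity) _

lemma two_mul_mul_le_young {p l k F z : ℝ} (hpl : p.HolderConjugate l) (hk : 0 < k) (hF : 0 ≤ F)
    (hz : 0 ≤ z) : 2 * F * z ≤ k * z ^ p + youngConst p l k * F ^ l := by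
  set e : ℝ := k ^ p⁻¹ with he
  have hep : 0 < e := by positivity
  have hez : (e * z) ^ p = k * z ^ p := by
    rw [Real.mul_rpow hep.le hz, he, Real.rpow_inv_rpow hk.le hpl.ne_zero]
  calc 2 * F * z = e * z * (2 / e * F) := by field_simp
    _ ≤ (e * z) ^ p / p + (2 / e * F) ^ l / l :=
        Real.young_inequality_of_nonneg (by positivity) (by positivity) hpl
    _ ≤ (e * z) ^ p + (2 / e * F) ^ l := add_le_add (div_le_self (by positivity) hpl.lt.le)
        (div_le_self (by positivity) hpl.symm.lt.le)
    _ = k * z ^ p + youngConst p l k * F ^ l := by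
        rw [hez, Real.mul_rpow (by positivity) hF, youngConst]

/-- The energy inequality satisfied by `y = ‖u‖²` when `u` solves a degenerate parabolic equation
whose diffusion is coercive of order `β < 2`, with `F` the norm of the source and `Φ` that of the
boundary data. The parameter `δ` is the gradient size below which the coercivity is given up; small
values are needed for the decay of `y` when `F` and `Φ` decay. -/
structure EnergyInequality (β c C : ℝ) (y F Φ : ℝ → ℝ) : Prop where
  nonneg : ∀ t, 0 ≤ t → 0 ≤ y t
  source_nonneg : ∀ t, 0 ≤ F t
  continuousWithinAt_zero : ContinuousWithinAt y (Ici 0) 0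
  differentiableAt : ∀ t, 0 < t → DifferentiableAt ℝ y t
  deriv_le : ∀ t, 0 < t → ∀ δ, 0 < δ → δ ≤ 1 → deriv y t ≤
    -(c * δ ^ (2 - β) * y t ^ (β / 2)) + C * δ ^ 2 + C * Φ t ^ 2 + 2 * F t * √(y t)

namespace EnergyInequality

variable {β l c C : ℝ} {y F Φ : ℝ → ℝ}

lemma deriv_le_of_young (hβ : β.HolderConjugate l) (hc : 0 < c)
    (h : EnergyInequality β c C y F Φ) {δ : ℝ} (hδ : 0 < δ) (hδ1 : δ ≤ 1) {t : ℝ} (ht : 0 < t) :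
    deriv y t ≤ -(c / 2 * δ ^ (2 - β) * y t ^ (β / 2)) + C * δ ^ 2 + C * Φ t ^ 2 +
      youngConst β l (c / 2 * δ ^ (2 - β)) * F t ^ l := by
  have hsqrt : √(y t) ^ β = y t ^ (β / 2) := by
    rw [Real.sqrt_eq_rpow, ← Real.rpow_mul (h.nonneg t ht.le), one_div_mul_eq_div]
  have hyoung := two_mul_mul_le_young hβ (k := c / 2 * δ ^ (2 - β)) (by positivity)
    (h.source_nonneg t) (Real.sqrt_nonneg (y t))
  rw [hsqrt] at hyoung
  linarith [h.deriv_le t ht δ hδ hδ1]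

/-- The forcing rate of the energy when the data have size one. -/
def rate (β l c C : ℝ) : ℝ := C + youngConst β l (c / 2)

/-- With data of size `G`, the energy decreases above `(threshold * (1 + G)) ^ (2 / β)`. -/
def threshold (β l c C : ℝ) : ℝ := 4 * rate β l c C / c

lemma rate_pos (hc : 0 < c) (hC : 0 < C) : 0 < rate β l c C :=
  add_pos hC (youngConst_pos β l (by positivity))

lemma threshold_pos (hc : 0 < c) (hC : 0 < C) : 0 < threshold β l c C :=
  div_pos (mul_pos four_pos (rate_pos hc hC)) hc

lemma deriv_le_neg_rate (hβ : β.HolderConjugate l) (hc : 0 < c) (hC : 0 < C)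
    (h : EnergyInequality β c C y F Φ) {t G : ℝ} (ht : 0 < t) (hG : 0 ≤ G)
    (hdata : F t ^ l + Φ t ^ 2 ≤ G) (hlt : (threshold β l c C * (1 + G)) ^ (2 / β) < y t) :
    deriv y t ≤ -rate β l c C := by
  have hβ0 := hβ.pos
  have hA := threshold_pos (β := β) (l := l) hc hC
  have hD := youngConst_pos β l (half_pos hc)
  have hderiv := h.deriv_le_of_young hβ hc one_pos le_rfl ht
  simp only [Real.one_rpow, one_pow, mul_one] at hderiv
  rw [← inv_div, Real.rpow_inv_lt_iff_of_pos (by positivity) (h.nonneg t ht.le)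
    (by positivity)] at hlt
  have hthreshold : c / 2 * (threshold β l c C * (1 + G)) = 2 * rate β l c C * (1 + G) := by
    rw [threshold]; field_simp; ring
  have habsorbed : 2 * rate β l c C * (1 + G) < c / 2 * y t ^ (β / 2) :=
    hthreshold ▸ mul_lt_mul_of_pos_left hlt (by positivity)
  have hF : 0 ≤ F t ^ l := Real.rpow_nonneg (h.source_nonneg t) _
  unfold rate at habsorbed ⊢
  nlinarith [sq_nonneg (Φ t)]

lemma le_max (hβ : β.HolderConjugate l) (hc : 0 < c) (hC : 0 < C)
    (h : EnergyInequality β c C y F Φ) {t G : ℝ} (ht : 0 < t) (hG : 0 ≤ G)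
    (hdata : ∀ s ∈ Icc 0 t, F s ^ l + Φ s ^ 2 ≤ G) :
    y t ≤ max (y 0) ((threshold β l c C * (1 + G)) ^ (2 / β)) := by
  have hcont : ContinuousOn y (Icc 0 t) := fun s hs => by
    rcases hs.1.eq_or_lt with rfl | hs0
    · exact h.continuousWithinAt_zero.mono Icc_subset_Ici_self
    · exact (h.differentiableAt s hs0).continuousAt.continuousWithinAt
  refine le_of_deriv_nonpos_above ht.le hcont (fun s hs => h.differentiableAt s hs.1)
    (le_max_left _ _) fun s hs hlt => ?_
  have hderiv := h.deriv_le_neg_rate hβ hc hC hs.1 hG (hdata s ⟨hs.1.le, hs.2.le⟩)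
    ((le_max_right _ _).trans_lt hlt)
  linarith [rate_pos (β := β) (l := l) hc hC]

lemma sqrt_le (hβ : β.HolderConjugate l) (hc : 0 < c) (hC : 0 < C)
    (h : EnergyInequality β c C y F Φ) {t G : ℝ} (ht : 0 < t)
    (hdata : ∀ s ∈ Icc 0 t, F s ^ l + Φ s ^ 2 ≤ G) :
    √(y t) ≤ √(y 0) + threshold β l c C ^ (1 / β) * (1 + G ^ (1 / β)) := by
  have hG : 0 ≤ G := (add_nonneg (Real.rpow_nonneg (h.source_nonneg 0) _) (sq_nonneg _)).trans
    (hdata 0 ⟨le_rfl, ht.le⟩)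
  have hβ0 := hβ.pos
  set A := threshold β l c C
  have hA : 0 < A := threshold_pos hc hC
  have hsqrt : √((A * (1 + G)) ^ (2 / β)) ≤ A ^ (1 / β) * (1 + G ^ (1 / β)) := by
    rw [Real.sqrt_eq_rpow, ← Real.rpow_mul (by positivity),
      show 2 / β * (1 / 2) = 1 / β by ring, Real.mul_rpow hA.le (by positivity)]
    refine mul_le_mul_of_nonneg_left ?_ (by positivity)
    simpa only [Real.one_rpow] using Real.rpow_add_le_add_rpow zero_le_one hG (by positivity)
      ((div_le_one hβ0).2 hβ.lt.le)
  calc √(y t) ≤ √(max (y 0) ((A * (1 + G)) ^ (2 / β))) :=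
        Real.sqrt_le_sqrt (h.le_max hβ hc hC ht hG hdata)
    _ = max √(y 0) √((A * (1 + G)) ^ (2 / β)) := Real.sqrt_monotone.map_max
    _ ≤ √(y 0) + √((A * (1 + G)) ^ (2 / β)) :=
        max_le_add_of_nonneg (Real.sqrt_nonneg _) (Real.sqrt_nonneg _)
    _ ≤ _ := by gcongr

lemma eventually_le (hβ : β.HolderConjugate l) (hc : 0 < c) (hC : 0 < C)
    (h : EnergyInequality β c C y F Φ) {G : ℝ} (hG : 0 ≤ G)
    (hdata : ∀ᶠ t in atTop, F t ^ l + Φ t ^ 2 ≤ G) :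
    ∀ᶠ t in atTop, y t ≤ threshold β l c C ^ (2 / β) * (1 + G) ^ (2 / β) := by
  rw [← Real.mul_rpow (threshold_pos hc hC).le (by positivity)]
  refine eventually_le_of_deriv_le_neg (rate_pos (β := β) (l := l) hc hC)
    ((eventually_gt_atTop 0).mono h.differentiableAt) ((eventually_ge_atTop 0).mono h.nonneg) ?_
  filter_upwards [hdata, eventually_gt_atTop 0] with t htG ht hlt
  exact h.deriv_le_neg_rate hβ hc hC ht hG htG hlt

-- The damping `δ ^ (2 - β) * y ^ (β / 2)` balances `δ ^ 2` exactly when `y` has order `δ ^ 2`.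
lemma eventually_le_mul_sq (hβ : β.HolderConjugate l) (hc : 0 < c) (hC : 0 < C)
    (h : EnergyInequality β c C y F Φ) (hF : Tendsto F atTop (𝓝 0)) (hΦ : Tendsto Φ atTop (𝓝 0))
    {δ : ℝ} (hδ : 0 < δ) (hδ1 : δ ≤ 1) :
    ∀ᶠ t in atTop, y t ≤ (8 * C / c) ^ (2 / β) * δ ^ 2 := by
  have hβ0 := hβ.pos
  set D := youngConst β l (c / 2 * δ ^ (2 - β))
  have hlim : Tendsto (fun t => C * Φ t ^ 2 + D * F t ^ l) atTop (𝓝 0) := by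
    have hFl := (hF.rpow_const (p := l) (Or.inr hβ.symm.nonneg)).const_mul D
    simpa [Real.zero_rpow hβ.symm.ne_zero] using ((hΦ.pow 2).const_mul C).add hFl
  have hlevel : (8 * C / c) ^ (2 / β) * δ ^ 2 = (8 * C / c * δ ^ β) ^ (β / 2)⁻¹ := by
    rw [inv_div, Real.mul_rpow (by positivity) (by positivity), ← Real.rpow_mul hδ.le,
      mul_div_cancel₀ _ hβ0.ne', Real.rpow_two]
  have hδδ : δ ^ (2 - β) * δ ^ β = δ ^ 2 := by
    rw [← Real.rpow_add hδ, sub_add_cancel, Real.rpow_two]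
  refine eventually_le_of_deriv_le_neg (k := 2 * C * δ ^ 2) (by positivity)
    ((eventually_gt_atTop 0).mono h.differentiableAt) ((eventually_ge_atTop 0).mono h.nonneg) ?_
  filter_upwards [eventually_gt_atTop 0,
    hlim.eventually_le_const (show 0 < C * δ ^ 2 by positivity)] with t ht hdata hlt
  rw [hlevel, Real.rpow_inv_lt_iff_of_pos (by positivity) (h.nonneg t ht.le)
    (by positivity)] at hlt
  have hcoercive : 4 * C * δ ^ 2 < c / 2 * δ ^ (2 - β) * y t ^ (β / 2) :=
    calc 4 * C * δ ^ 2 = c / 2 * δ ^ (2 - β) * (8 * C / c * δ ^ β) := by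
          rw [← hδδ]; field_simp; ring
      _ < _ := mul_lt_mul_of_pos_left hlt (by positivity)
  linarith [h.deriv_le_of_young hβ hc hδ hδ1 ht]

lemma tendsto_zero (hβ : β.HolderConjugate l) (hc : 0 < c) (hC : 0 < C)
    (h : EnergyInequality β c C y F Φ) (hF : Tendsto F atTop (𝓝 0))
    (hΦ : Tendsto Φ atTop (𝓝 0)) : Tendsto y atTop (𝓝 0) := by
  rw [Metric.tendsto_nhds]
  intro ε hε
  have hsmall : ∀ᶠ δ in 𝓝[>] (0 : ℝ), (8 * C / c) ^ (2 / β) * δ ^ 2 < ε := by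
    have hcont : Continuous fun δ : ℝ => (8 * C / c) ^ (2 / β) * δ ^ 2 := by fun_prop
    exact (hcont.tendsto' 0 0 (by simp)).mono_left nhdsWithin_le_nhds |>.eventually_lt_const hε
  obtain ⟨δ, hδε, hδ⟩ := (hsmall.and (Ioc_mem_nhdsGT one_pos)).exists
  filter_upwards [h.eventually_le_mul_sq hβ hc hC hF hΦ hδ.1 hδ.2, eventually_ge_atTop 0]
    with t ht ht0
  rw [dist_zero_right, Real.norm_of_nonneg (h.nonneg t ht0)]
  exact ht.trans_lt hδε

end EnergyInequality

/-! ### The Poincaré inequality on convex sets -/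

section CauchySchwarz

variable {X : Type*} [MeasurableSpace X] {μ : Measure X}

lemma sq_lintegral_mul_le {w f : X → ENNReal} (hw : AEMeasurable w μ) (hf : AEMeasurable f μ) :
    (∫⁻ x, w x * f x ∂μ) ^ 2 ≤ (∫⁻ x, w x ∂μ) * ∫⁻ x, w x * f x ^ 2 ∂μ := by
  have sq_sqrt : ∀ a : ENNReal, (a ^ (1 / 2 : ℝ)) ^ (2 : ℝ) = a := fun a => by
    rw [← ENNReal.rpow_mul]; norm_num
  have sqrt_mul_sqrt : ∀ a : ENNReal, a ^ (1 / 2 : ℝ) * a ^ (1 / 2 : ℝ) = a := fun a => by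
    rw [← ENNReal.rpow_add_of_nonneg _ _ (by norm_num) (by norm_num)]; norm_num
  have hölder := ENNReal.lintegral_mul_le_Lp_mul_Lq μ Real.HolderConjugate.two_two
    (f := fun x => w x ^ (1 / 2 : ℝ)) (g := fun x => w x ^ (1 / 2 : ℝ) * f x)
    (hw.pow_const _) ((hw.pow_const _).mul hf)
  simp only [Pi.mul_apply, ← mul_assoc, sq_sqrt, sqrt_mul_sqrt,
    ENNReal.mul_rpow_of_nonneg _ _ (show (0 : ℝ) ≤ 2 by norm_num)] at hölder
  calc (∫⁻ x, w x * f x ∂μ) ^ 2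
      ≤ ((∫⁻ x, w x ∂μ) ^ (1 / 2 : ℝ) * (∫⁻ x, w x * f x ^ (2 : ℝ) ∂μ) ^ (1 / 2 : ℝ)) ^ 2 := by
        gcongr
    _ = _ := by
        rw [mul_pow, ← ENNReal.rpow_two, ← ENNReal.rpow_two, sq_sqrt, sq_sqrt]
        simp only [ENNReal.rpow_two]

lemma sq_lintegral_le {f : X → ENNReal} (hf : AEMeasurable f μ) :
    (∫⁻ x, f x ∂μ) ^ 2 ≤ μ univ * ∫⁻ x, f x ^ 2 ∂μ := by
  simpa using sq_lintegral_mul_le (w := fun _ => 1) aemeasurable_const hf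

lemma lintegral_lintegral_le_of_tendsto [SFinite μ] {F : ℕ → X → X → ENNReal}
    (hF : ∀ n, Measurable (Function.uncurry (F n))) {f : X → X → ENNReal} {B : ENNReal}
    (hB : ∀ n, ∫⁻ x, ∫⁻ y, F n x y ∂μ ∂μ ≤ B)
    (hlim : ∀ᵐ x ∂μ, ∀ᵐ y ∂μ, Tendsto (fun n => F n x y) atTop (𝓝 (f x y))) :
    ∫⁻ x, ∫⁻ y, f x y ∂μ ∂μ ≤ B := by
  calc ∫⁻ x, ∫⁻ y, f x y ∂μ ∂μ
      ≤ ∫⁻ x, ∫⁻ y, liminf (fun n => F n x y) atTop ∂μ ∂μ := by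
        refine lintegral_mono_ae (hlim.mono fun x hx => lintegral_mono_ae ?_)
        exact hx.mono fun y hy => hy.liminf_eq.ge
    _ ≤ ∫⁻ x, liminf (fun n => ∫⁻ y, F n x y ∂μ) atTop ∂μ :=
        lintegral_mono fun x => lintegral_liminf_le fun n =>
          (hF n).comp (measurable_const.prodMk measurable_id)
    _ ≤ liminf (fun n => ∫⁻ x, ∫⁻ y, F n x y ∂μ ∂μ) atTop :=
        lintegral_liminf_le fun n => (hF n).lintegral_prod_right'
    _ ≤ B := liminf_le_of_le (by isBoundedDefault) fun b hb => by
        obtain ⟨n, hn⟩ := hb.exists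
        exact hn.trans (hB n)

lemma enorm_sub_average_sq_le [IsFiniteMeasure μ] [NeZero μ] {u : X → ℝ} (hu : Integrable u μ)
    (c : ℝ) : ‖c - ⨍ y, u y ∂μ‖ₑ ^ 2 ≤ (μ univ)⁻¹ * ∫⁻ y, ‖c - u y‖ₑ ^ 2 ∂μ := by
  have hμ : μ univ ≠ 0 := NeZero.ne _
  have hsub : c - ⨍ y, u y ∂μ = ⨍ y, (c - u y) ∂μ := by
    rw [average_eq, average_eq, integral_sub (integrable_const _) hu, smul_sub, integral_const,
      inv_smul_smul₀ (by simp [measureReal_def, ENNReal.toReal_eq_zero_iff, hμ])]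
  calc ‖c - ⨍ y, u y ∂μ‖ₑ ^ 2 ≤ (∫⁻ y, ‖c - u y‖ₑ ∂((μ univ)⁻¹ • μ)) ^ 2 := by
        rw [hsub]
        gcongr
        exact enorm_integral_le_lintegral_enorm _
    _ = (μ univ)⁻¹ ^ 2 * (∫⁻ y, ‖c - u y‖ₑ ∂μ) ^ 2 := by
        rw [lintegral_smul_measure, smul_eq_mul, mul_pow]
    _ ≤ (μ univ)⁻¹ ^ 2 * (μ univ * ∫⁻ y, ‖c - u y‖ₑ ^ 2 ∂μ) := by
        gcongr
        exact sq_lintegral_le (aestronglyMeasurable_const.sub hu.1).enorm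
    _ = _ := by
        rw [sq, ← mul_assoc, mul_assoc _ _ (μ univ), ENNReal.inv_mul_cancel hμ
          (measure_ne_top _ _), mul_one]

end CauchySchwarz

section Segments

variable {E F : Type*} [NormedAddCommGroup E] [NormedSpace ℝ E] [NormedAddCommGroup F]
  [NormedSpace ℝ F] [CompleteSpace F]

lemma enorm_sub_sq_le_lintegral_segment {u : E → F} (hu : ContDiff ℝ 1 u) (x y : E) :
    ‖u x - u y‖ₑ ^ 2 ≤
      ‖y - x‖ₑ ^ 2 * ∫⁻ t in Icc (0 : ℝ) 1, ‖fderiv ℝ u (x + t • (y - x))‖ₑ ^ 2 := by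
  have hfderiv : Continuous fun t : ℝ => fderiv ℝ u (x + t • (y - x)) :=
    (hu.continuous_fderiv one_ne_zero).comp (by fun_prop)
  have hcont : Continuous fun t : ℝ => fderiv ℝ u (x + t • (y - x)) (y - x) :=
    hfderiv.clm_apply continuous_const
  have hderiv : ∀ t : ℝ, HasDerivAt (fun t : ℝ => u (x + t • (y - x)))
      (fderiv ℝ u (x + t • (y - x)) (y - x)) t := by
    intro t
    have hline : HasDerivAt (fun t : ℝ => x + t • (y - x)) (y - x) t := by
      simpa using ((hasDerivAt_id t).smul_const (y - x)).const_add x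
    exact (hu.differentiable one_ne_zero _).hasFDerivAt.comp_hasDerivAt t hline
  have hftc : ∫ t in Icc (0 : ℝ) 1, fderiv ℝ u (x + t • (y - x)) (y - x) = u y - u x := by
    rw [integral_Icc_eq_integral_Ioc, ← intervalIntegral.integral_of_le zero_le_one,
      intervalIntegral.integral_eq_sub_of_hasDerivAt (fun t _ => hderiv t)
        (hcont.intervalIntegrable _ _)]
    simp only [one_smul, add_sub_cancel, zero_smul, add_zero]
  calc ‖u x - u y‖ₑ ^ 2
      ≤ (∫⁻ t in Icc (0 : ℝ) 1, ‖fderiv ℝ u (x + t • (y - x)) (y - x)‖ₑ) ^ 2 := by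
        rw [← enorm_neg, neg_sub, ← hftc]
        gcongr
        exact enorm_integral_le_lintegral_enorm _
    _ ≤ ∫⁻ t in Icc (0 : ℝ) 1, ‖fderiv ℝ u (x + t • (y - x)) (y - x)‖ₑ ^ 2 := by
        simpa using sq_lintegral_le (μ := volume.restrict (Icc (0 : ℝ) 1))
          hcont.enorm.aemeasurable
    _ ≤ ∫⁻ t in Icc (0 : ℝ) 1, ‖y - x‖ₑ ^ 2 * ‖fderiv ℝ u (x + t • (y - x))‖ₑ ^ 2 := by
        refine lintegral_mono fun t => ?_
        rw [mul_comm, ← mul_pow]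
        gcongr
        exact ContinuousLinearMap.le_opENorm _ _
    _ = _ := lintegral_const_mul _ (hfderiv.enorm.measurable.pow_const 2)

variable [FiniteDimensional ℝ E] [MeasurableSpace E] [BorelSpace E] (μ : Measure E)
  [μ.IsAddHaarMeasure]

lemma lintegral_comp_add_smul {H : E → ENNReal} (hH : Measurable H) {t : ℝ} (ht : 0 < t) (v : E) :
    ∫⁻ y, H (v + t • y) ∂μ = ENNReal.ofReal ((t ^ Module.finrank ℝ E)⁻¹) * ∫⁻ y, H y ∂μ := by
  have hmap : ∫⁻ y, H (v + t • y) ∂μ = ∫⁻ z, H (v + z) ∂(μ.map fun y => t • y) :=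
    (lintegral_map (f := fun z => H (v + z)) (hH.comp (measurable_const_add v))
      (measurable_const_smul t)).symm
  rw [hmap, Measure.map_addHaar_smul _ ht.ne', lintegral_smul_measure, abs_of_pos (by positivity),
    smul_eq_mul, lintegral_add_left_eq_self]

lemma setLIntegral_segment_le {D : Set E} (hD : MeasurableSet D) (hconv : Convex ℝ D)
    {H : E → ENNReal} (hH : Measurable H) {t : ℝ} (ht : t ∈ Icc (1 / 2) 1) {x : E} (hx : x ∈ D) :
    ∫⁻ y in D, H (x + t • (y - x)) ∂μ ≤ 2 ^ Module.finrank ℝ E * ∫⁻ y in D, H y ∂μ := by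
  have ht0 : 0 < t := by linarith [ht.1]
  have hline : ∀ y, x + t • (y - x) = (1 - t) • x + t • y := fun y => by module
  have hmem : ∀ y ∈ D, (1 - t) • x + t • y ∈ D := fun y hy =>
    hconv hx hy (by linarith [ht.2]) ht0.le (by ring)
  calc ∫⁻ y in D, H (x + t • (y - x)) ∂μ
      ≤ ∫⁻ y, D.indicator H ((1 - t) • x + t • y) ∂μ := by
        rw [← lintegral_indicator hD]
        refine lintegral_mono (indicator_le fun y hy => ?_)
        rw [hline, indicator_of_mem (hmem y hy)]
    _ = ENNReal.ofReal ((t ^ Module.finrank ℝ E)⁻¹) * ∫⁻ y in D, H y ∂μ := by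
        rw [lintegral_comp_add_smul _ (hH.indicator hD) ht0, lintegral_indicator hD]
    _ ≤ _ := by
        gcongr
        have hinv : t⁻¹ ≤ 2 := by rw [inv_le_comm₀ ht0 two_pos]; linarith [ht.1]
        calc ENNReal.ofReal ((t ^ Module.finrank ℝ E)⁻¹)
            ≤ ENNReal.ofReal (2 ^ Module.finrank ℝ E) := by rw [← inv_pow]; gcongr
          _ = 2 ^ Module.finrank ℝ E := by rw [ENNReal.ofReal_pow zero_le_two]; simp

-- For `t < 1 / 2` the dilation about `x` degenerates, but the one about `y`, with factor `1 - t`,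
-- does not.
lemma lintegral_lintegral_segment_le {D : Set E} (hD : MeasurableSet D) (hconv : Convex ℝ D)
    {H : E → ENNReal} (hH : Measurable H) {t : ℝ} (ht : t ∈ Icc (0 : ℝ) 1) :
    ∫⁻ x in D, ∫⁻ y in D, H (x + t • (y - x)) ∂μ ∂μ ≤
      2 ^ Module.finrank ℝ E * μ D * ∫⁻ z in D, H z ∂μ := by
  have upper_half : ∀ t : ℝ, t ∈ Icc (1 / 2) 1 →
      ∫⁻ x in D, ∫⁻ y in D, H (x + t • (y - x)) ∂μ ∂μ ≤
        2 ^ Module.finrank ℝ E * μ D * ∫⁻ z in D, H z ∂μ := by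
    intro t ht
    calc ∫⁻ x in D, ∫⁻ y in D, H (x + t • (y - x)) ∂μ ∂μ
        ≤ ∫⁻ x in D, 2 ^ Module.finrank ℝ E * ∫⁻ y in D, H y ∂μ ∂μ :=
          setLIntegral_mono' hD fun x hx => setLIntegral_segment_le μ hD hconv hH ht hx
      _ = _ := by rw [setLIntegral_const]; ring
  rcases le_total (1 / 2) t with h | h
  · exact upper_half t ⟨h, ht.2⟩
  · have hreverse : ∀ x y : E, x + t • (y - x) = y + (1 - t) • (x - y) := fun x y => by module
    rw [lintegral_lintegral_swap]
    · simp only [hreverse]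
      exact upper_half (1 - t) ⟨by linarith, by linarith [ht.1]⟩
    · exact (hH.comp (by fun_prop : Measurable fun p : E × E =>
        p.1 + t • (p.2 - p.1))).aemeasurable

theorem poincare_convex_contDiff {D : Set E} (hD : MeasurableSet D) (hconv : Convex ℝ D)
    {u : E → F} (hu : ContDiff ℝ 1 u) :
    ∫⁻ x in D, ∫⁻ y in D, ‖u x - u y‖ₑ ^ 2 ∂μ ∂μ ≤
      Metric.ediam D ^ 2 *
        (2 ^ Module.finrank ℝ E * μ D * ∫⁻ z in D, ‖fderiv ℝ u z‖ₑ ^ 2 ∂μ) := by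
  set H : E → ENNReal := fun z => ‖fderiv ℝ u z‖ₑ ^ 2
  have hHc : Continuous H :=
    (ENNReal.continuous_pow 2).comp (hu.continuous_fderiv one_ne_zero).enorm
  have hH : Measurable fun p : E × E × ℝ => H (p.1 + p.2.2 • (p.2.1 - p.1)) :=
    (hHc.comp (by fun_prop)).measurable
  have hle : ∀ x ∈ D, ∀ y ∈ D, ‖u x - u y‖ₑ ^ 2 ≤
      Metric.ediam D ^ 2 * ∫⁻ t in Icc (0 : ℝ) 1, H (x + t • (y - x)) := by
    intro x hx y hy
    refine (enorm_sub_sq_le_lintegral_segment hu x y).trans ?_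
    rw [← edist_eq_enorm_sub]
    gcongr
    exact Metric.edist_le_ediam_of_mem hy hx
  have hint : ∀ x, Measurable fun y => ∫⁻ t in Icc (0 : ℝ) 1, H (x + t • (y - x)) := fun x =>
    (hH.comp (by fun_prop : Measurable fun q : E × ℝ => (x, q.1, q.2))).lintegral_prod_right'
  calc ∫⁻ x in D, ∫⁻ y in D, ‖u x - u y‖ₑ ^ 2 ∂μ ∂μ
      ≤ ∫⁻ x in D, ∫⁻ y in D,
          Metric.ediam D ^ 2 * (∫⁻ t in Icc (0 : ℝ) 1, H (x + t • (y - x))) ∂μ ∂μ :=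
        setLIntegral_mono' hD fun x hx => setLIntegral_mono' hD fun y hy => hle x hx y hy
    _ = Metric.ediam D ^ 2 *
          ∫⁻ x in D, ∫⁻ y in D, (∫⁻ t in Icc (0 : ℝ) 1, H (x + t • (y - x))) ∂μ ∂μ := by
        rw [← lintegral_const_mul _ (Measurable.lintegral_prod_right'
          (f := fun p : E × E => ∫⁻ t in Icc (0 : ℝ) 1, H (p.1 + t • (p.2 - p.1)))
          (Measurable.lintegral_prod_right' (hH.comp (by fun_prop :
            Measurable fun q : (E × E) × ℝ => (q.1.1, q.1.2, q.2)))))]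
        exact lintegral_congr fun x => lintegral_const_mul _ (hint x)
    _ = Metric.ediam D ^ 2 *
          ∫⁻ t in Icc (0 : ℝ) 1, ∫⁻ x in D, ∫⁻ y in D, H (x + t • (y - x)) ∂μ ∂μ := by
        have hswap : ∀ x, ∫⁻ y in D, (∫⁻ t in Icc (0 : ℝ) 1, H (x + t • (y - x))) ∂μ =
            ∫⁻ t in Icc (0 : ℝ) 1, ∫⁻ y in D, H (x + t • (y - x)) ∂μ := fun x =>
          lintegral_lintegral_swap (hH.comp (by fun_prop :
            Measurable fun q : E × ℝ => (x, q.1, q.2))).aemeasurable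
        simp_rw [hswap]
        rw [lintegral_lintegral_swap]
        exact (Measurable.lintegral_prod_right' (hH.comp (by fun_prop :
          Measurable fun q : (E × ℝ) × E => (q.1.1, q.2, q.1.2)))).aemeasurable
    _ ≤ Metric.ediam D ^ 2 * ∫⁻ _ in Icc (0 : ℝ) 1,
          2 ^ Module.finrank ℝ E * μ D * ∫⁻ z in D, H z ∂μ := by
        gcongr Metric.ediam D ^ 2 * ?_
        exact setLIntegral_mono' measurableSet_Icc fun t ht =>
          lintegral_lintegral_segment_le μ hD hconv hHc.measurable ht
    _ = _ := by rw [setLIntegral_const]; simp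

end Segments

section Mollification

variable {d : ℕ}

/-- A smooth bump of radius `1 / (n + 1)`; its normalization is the `n`-th mollifier. -/
def mollifier (d n : ℕ) : ContDiffBump (0 : Space d) where
  rIn := 1 / (2 * ((n : ℝ) + 1))
  rOut := 1 / ((n : ℝ) + 1)
  rIn_pos := by positivity
  rIn_lt_rOut := by
    apply one_div_lt_one_div_of_lt <;> nlinarith [n.cast_nonneg (α := ℝ)]

lemma tendsto_mollifier_rOut : Tendsto (fun n => (mollifier d n).rOut) atTop (𝓝 0) :=
  tendsto_one_div_add_atTop_nhds_zero_nat

lemma mollifier_rOut_le (n : ℕ) : (mollifier d n).rOut ≤ 2 * (mollifier d n).rIn := by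
  change 1 / ((n : ℝ) + 1) ≤ 2 * (1 / (2 * ((n : ℝ) + 1)))
  apply le_of_eq
  field_simp

lemma lintegral_mollifier (n : ℕ) :
    ∫⁻ y, ENNReal.ofReal ((mollifier d n).normed volume y) = 1 := by
  rw [← ofReal_integral_eq_lintegral_ofReal (ContDiffBump.integrable_normed _)
    (Eventually.of_forall (ContDiffBump.nonneg_normed _)), ContDiffBump.integral_normed,
    ENNReal.ofReal_one]

lemma measurable_mollifier_sub (n : ℕ) : Measurable fun p : Space d × Space d =>
    ENNReal.ofReal ((mollifier d n).normed volume (p.1 - p.2)) :=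
  ENNReal.measurable_ofReal.comp ((ContDiffBump.continuous_normed _).measurable.comp
    (measurable_fst.sub measurable_snd))

lemma support_mollifier_sub_subset (n : ℕ) (x : Space d) :
    Function.support (fun y => (mollifier d n).normed volume (x - y)) ⊆
      Metric.closedBall x (mollifier d n).rOut := by
  intro y hy
  have hxy : x - y ∈ Function.support ((mollifier d n).normed volume) := hy
  rw [ContDiffBump.support_normed_eq, mem_ball_zero_iff] at hxy
  exact mem_closedBall_iff_norm'.2 hxy.le

open scoped Convolution in
/-- The convolution of a function with the `n`-th mollifier. -/
def mollify (n : ℕ) (u : Space d → ℝ) : Space d → ℝ :=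
  (mollifier d n).normed volume ⋆[ContinuousLinearMap.lsmul ℝ ℝ, volume] u

lemma mollify_apply (n : ℕ) (u : Space d → ℝ) (x : Space d) :
    mollify n u x = ∫ y, (mollifier d n).normed volume y * u (x - y) := by
  simp [mollify, convolution_def]

lemma contDiff_mollify (n : ℕ) {u : Space d → ℝ} (hu : LocallyIntegrable u) :
    ContDiff ℝ 1 (mollify n u) :=
  mod_cast HasCompactSupport.contDiff_convolution_left (n := 1) (ContinuousLinearMap.lsmul ℝ ℝ)
    ((mollifier d n).hasCompactSupport_normed (μ := volume)) (μ := volume)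
    (ContDiffBump.contDiff_normed (mollifier d n)) hu

lemma ae_tendsto_mollify {u : Space d → ℝ} (hu : LocallyIntegrable u) :
    ∀ᵐ x, Tendsto (fun n => mollify n u x) atTop (𝓝 (u x)) :=
  ContDiffBump.ae_convolution_tendsto_right_of_locallyIntegrable tendsto_mollifier_rOut
    (Eventually.of_forall mollifier_rOut_le) hu

lemma fderiv_mollify_apply {u : Space d → ℝ} (hu : LocallyIntegrable u) (n : ℕ) (x v : Space d) :
    fderiv ℝ (mollify n u) x v =
      ∫ y, u y * fderiv ℝ ((mollifier d n).normed volume) (x - y) v := by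
  set ψ := (mollifier d n).normed (volume : Measure (Space d))
  have hψ : ContDiff ℝ 1 ψ := ContDiffBump.contDiff_normed _
  have hψc : HasCompactSupport ψ := ContDiffBump.hasCompactSupport_normed _
  have hint : Integrable fun y => u y • fderiv ℝ ψ (x - y) :=
    hu.integrable_smul_right_of_hasCompactSupport
      ((hψ.continuous_fderiv one_ne_zero).comp (by fun_prop))
      ((hψc.fderiv (𝕜 := ℝ)).comp_homeomorph (Homeomorph.subLeft x))
  have hconv := HasCompactSupport.hasFDerivAt_convolution_left (ContinuousLinearMap.lsmul ℝ ℝ)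
    (μ := volume) hψc hψ hu x
  have hsmul : ∀ y, (ContinuousLinearMap.precompL (Space d) (ContinuousLinearMap.lsmul ℝ ℝ))
      (fderiv ℝ ψ (x - y)) (u y) = u y • fderiv ℝ ψ (x - y) := fun y => by
    ext w; simp [mul_comm]
  rw [mollify, hconv.fderiv, convolution_eq_swap]
  simp_rw [hsmul]
  rw [ContinuousLinearMap.integral_apply hint]
  rfl

lemma gradient_comp_sub_left {ψ : Space d → ℝ} (hψ : Differentiable ℝ ψ) (x y : Space d) :
    gradient (fun y => ψ (x - y)) y = -gradient ψ (x - y) := by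
  have hcomp : HasFDerivAt (fun y => ψ (x - y)) (-(fderiv ℝ ψ (x - y))) y := by
    have := (hψ (x - y)).hasFDerivAt.comp y ((hasFDerivAt_id y).const_sub x)
    rwa [ContinuousLinearMap.comp_neg, ContinuousLinearMap.comp_id] at this
  rw [gradient, gradient, hcomp.fderiv, map_neg]

lemma inner_gradient_eq_fderiv (ψ : Space d → ℝ) (x v : Space d) :
    inner ℝ v (gradient ψ x) = fderiv ℝ ψ x v := by
  rw [real_inner_comm, ← InnerProductSpace.toDual_apply_apply (𝕜 := ℝ), gradient,
    LinearIsometryEquiv.apply_symm_apply]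

lemma IsWeakGradient.mono {Ω D : Set (Space d)} (hΩ : MeasurableSet Ω) (hD : D ⊆ Ω)
    {u : Space d → ℝ} {G : Space d → Space d} (hG : IsWeakGradient Ω u G) :
    IsWeakGradient D u G := by
  refine ⟨hG.1.mono_measure (Measure.restrict_mono hD le_rfl), fun η hη hηc hηD => ?_⟩
  have hη0 : ∀ x ∈ Ω \ D, η =ᶠ[𝓝 x] 0 := fun x hx =>
    notMem_tsupport_iff_eventuallyEq.1 fun h => hx.2 (hηD h)
  rw [← setIntegral_eq_of_subset_of_forall_sdiff_eq_zero hΩ hD fun x hx => ?_,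
    ← setIntegral_eq_of_subset_of_forall_sdiff_eq_zero hΩ hD fun x hx => ?_]
  · exact hG.2 η hη hηc (hηD.trans hD)
  · rw [(hη0 x hx).self_of_nhds, Pi.zero_apply, zero_smul]
  · rw [gradient, (hη0 x hx).fderiv_eq]
    simp

variable {D : Set (Space d)} {u : Space d → ℝ} {G : Space d → Space d}

lemma locallyIntegrable_indicator (hD : MeasurableSet D) (hu : MemLp u 2 (volume.restrict D)) :
    LocallyIntegrable (D.indicator u) :=
  ((memLp_indicator_iff_restrict hD).2 hu).locallyIntegrable (by norm_num)

-- The mollifier centred at `x` is an admissible test function for the weak gradient.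
lemma fderiv_mollify_indicator_apply (hD : MeasurableSet D) (hu : MemLp u 2 (volume.restrict D))
    (hG : IsWeakGradient D u G) {n : ℕ} {x : Space d}
    (hx : Metric.closedBall x (mollifier d n).rOut ⊆ D) (v : Space d) :
    fderiv ℝ (mollify n (D.indicator u)) x v =
      inner ℝ v (∫ y in D, (mollifier d n).normed volume (x - y) • G y) := by
  set ψ := (mollifier d n).normed (volume : Measure (Space d))
  have hψ : ContDiff ℝ ∞ ψ := ContDiffBump.contDiff_normed _ (n := ⊤)
  set η : Space d → ℝ := fun y => ψ (x - y)
  have hη : ContDiff ℝ ∞ η := hψ.comp (contDiff_const.sub contDiff_id)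
  have hts : tsupport η ⊆ Metric.closedBall x (mollifier d n).rOut :=
    closure_minimal (support_mollifier_sub_subset n x) Metric.isClosed_closedBall
  have hηc : HasCompactSupport η :=
    (isCompact_closedBall x _).of_isClosed_subset (isClosed_tsupport η) hts
  have hfderiv : ∀ y, inner ℝ v (gradient η y) = -fderiv ℝ ψ (x - y) v := fun y => by
    rw [gradient_comp_sub_left (hψ.differentiable (by simp)), inner_neg_right,
      inner_gradient_eq_fderiv]
  have hint : Integrable (fun y => u y • gradient η y) (volume.restrict D) :=
    (hu.locallyIntegrable (by norm_num)).integrable_smul_right_of_hasCompactSupport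
      ((InnerProductSpace.toDual ℝ (Space d)).symm.continuous.comp
        (hη.continuous_fderiv (by simp)))
      ((hηc.fderiv (𝕜 := ℝ)).comp_left (map_zero _))
  calc fderiv ℝ (mollify n (D.indicator u)) x v
      = ∫ y, D.indicator u y * fderiv ℝ ψ (x - y) v :=
        fderiv_mollify_apply (locallyIntegrable_indicator hD hu) n x v
    _ = -∫ y in D, inner ℝ v (u y • gradient η y) := by
        rw [← integral_neg, ← integral_indicator hD]
        refine integral_congr_ae (Eventually.of_forall fun y => ?_)
        by_cases hy : y ∈ D <;> simp [hy, inner_smul_right, hfderiv]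
    _ = inner ℝ v (∫ y in D, η y • G y) := by
        rw [integral_inner hint, hG.2 η hη hηc (hts.trans hx), inner_neg_right, neg_neg]

lemma enorm_fderiv_mollify_sq_le (hD : MeasurableSet D) (hu : MemLp u 2 (volume.restrict D))
    (hG : IsWeakGradient D u G) {n : ℕ} {x : Space d}
    (hx : Metric.closedBall x (mollifier d n).rOut ⊆ D) :
    ‖fderiv ℝ (mollify n (D.indicator u)) x‖ₑ ^ 2 ≤
      ∫⁻ y in D, ENNReal.ofReal ((mollifier d n).normed volume (x - y)) * ‖G y‖ₑ ^ 2 := by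
  set ψ := (mollifier d n).normed (volume : Measure (Space d))
  have hψm : Measurable fun y => ENNReal.ofReal (ψ (x - y)) :=
    ENNReal.measurable_ofReal.comp ((ContDiffBump.continuous_normed _).measurable.comp
      (measurable_const.sub measurable_id))
  have hle : ‖fderiv ℝ (mollify n (D.indicator u)) x‖ₑ ≤ ‖∫ y in D, ψ (x - y) • G y‖ₑ := by
    rw [← ofReal_norm, ← ofReal_norm]
    refine ENNReal.ofReal_le_ofReal (ContinuousLinearMap.opNorm_le_bound _ (norm_nonneg _) ?_)
    intro v
    rw [fderiv_mollify_indicator_apply hD hu hG hx, mul_comm]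
    exact norm_inner_le_norm _ _
  have htriangle : ‖∫ y in D, ψ (x - y) • G y‖ₑ ≤
      ∫⁻ y in D, ENNReal.ofReal (ψ (x - y)) * ‖G y‖ₑ := by
    refine (enorm_integral_le_lintegral_enorm _).trans_eq (lintegral_congr fun y => ?_)
    rw [enorm_smul, Real.enorm_eq_ofReal (ContDiffBump.nonneg_normed _ _)]
  have hmass : ∫⁻ y in D, ENNReal.ofReal (ψ (x - y)) ≤ 1 :=
    calc ∫⁻ y in D, ENNReal.ofReal (ψ (x - y))
        ≤ ∫⁻ y, ENNReal.ofReal (ψ (x - y)) := setLIntegral_le_lintegral _ _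
      _ = ∫⁻ y, ENNReal.ofReal (ψ y) :=
          lintegral_sub_left_eq_self (fun y => ENNReal.ofReal (ψ y)) x
      _ = 1 := lintegral_mollifier n
  calc ‖fderiv ℝ (mollify n (D.indicator u)) x‖ₑ ^ 2
      ≤ (∫⁻ y in D, ENNReal.ofReal (ψ (x - y)) * ‖G y‖ₑ) ^ 2 := by
        gcongr
        exact hle.trans htriangle
    _ ≤ (∫⁻ y in D, ENNReal.ofReal (ψ (x - y))) *
          ∫⁻ y in D, ENNReal.ofReal (ψ (x - y)) * ‖G y‖ₑ ^ 2 :=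
        sq_lintegral_mul_le hψm.aemeasurable hG.1.1.enorm
    _ ≤ _ := mul_le_of_le_one_left' hmass

lemma lintegral_lintegral_mollifier_mul (n : ℕ) {μ : Measure (Space d)} [SFinite μ]
    {H : Space d → ENNReal} (hH : AEMeasurable H μ) :
    ∫⁻ x, ∫⁻ y, ENNReal.ofReal ((mollifier d n).normed volume (x - y)) * H y ∂μ =
      ∫⁻ y, H y ∂μ := by
  rw [lintegral_lintegral_swap]
  · refine lintegral_congr fun y => ?_
    have hmeas : Measurable fun x => ENNReal.ofReal ((mollifier d n).normed volume (x - y)) :=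
      ENNReal.measurable_ofReal.comp ((ContDiffBump.continuous_normed _).measurable.comp
        (measurable_id.sub_const y))
    rw [lintegral_mul_const _ hmeas, lintegral_sub_right_eq_self
        (fun x => ENNReal.ofReal ((mollifier d n).normed volume x)) y,
      lintegral_mollifier, one_mul]
  · exact (measurable_mollifier_sub n).aemeasurable.mul hH.comp_snd

end Mollification

section Erosion

variable {E : Type*}

/-- The points of `D` whose distance to the complement of `D` exceeds `r`. -/
def erosion [PseudoEMetricSpace E] (D : Set E) (r : ℝ) : Set E := (Metric.cthickening r Dᶜ)ᶜ

lemma measurableSet_erosion [PseudoEMetricSpace E] [MeasurableSpace E] [OpensMeasurableSpace E]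
    (D : Set E) (r : ℝ) : MeasurableSet (erosion D r) :=
  Metric.isClosed_cthickening.isOpen_compl.measurableSet

lemma closedBall_subset_of_mem_erosion [PseudoMetricSpace E] {D : Set E} {r : ℝ} {x : E}
    (hx : x ∈ erosion D r) : Metric.closedBall x r ⊆ D := by
  intro y hy
  by_contra h
  exact hx (Metric.mem_cthickening_of_dist_le x y r Dᶜ h (by rwa [dist_comm]))

lemma erosion_subset [PseudoMetricSpace E] (D : Set E) {r : ℝ} (hr : 0 ≤ r) : erosion D r ⊆ D :=
  fun _ hx => closedBall_subset_of_mem_erosion hx (Metric.mem_closedBall_self hr)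

lemma mem_erosion_iff [PseudoMetricSpace E] [ProperSpace E] {D : Set E} (hD : IsOpen D) {r : ℝ}
    (hr : 0 ≤ r) {x : E} : x ∈ erosion D r ↔ Metric.closedBall x r ⊆ D := by
  refine ⟨closedBall_subset_of_mem_erosion, fun h hx => ?_⟩
  rw [hD.isClosed_compl.cthickening_eq_biUnion_closedBall hr] at hx
  simp only [mem_iUnion, exists_prop] at hx
  obtain ⟨y, hy, hxy⟩ := hx
  exact hy (h (by rwa [Metric.mem_closedBall_comm] at hxy))

lemma convex_erosion [SeminormedAddCommGroup E] [NormedSpace ℝ E] [ProperSpace E] {D : Set E}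
    (hD : IsOpen D) (hconv : Convex ℝ D) {r : ℝ} (hr : 0 ≤ r) : Convex ℝ (erosion D r) := by
  intro x hx y hy a b ha hb hab
  rw [mem_erosion_iff hD hr] at *
  intro w hw
  set v := w - (a • x + b • y) with hv
  have hvr : ‖v‖ ≤ r := mem_closedBall_iff_norm.1 hw
  have hxv : x + v ∈ D := hx (by simpa [mem_closedBall_iff_norm] using hvr)
  have hyv : y + v ∈ D := hy (by simpa [mem_closedBall_iff_norm] using hvr)
  have hcomb : a • (x + v) + b • (y + v) = w := by
    calc a • (x + v) + b • (y + v) = a • x + b • y + (a + b) • v := by module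
      _ = w := by rw [hab, one_smul, hv, add_sub_cancel]
  exact hcomb ▸ hconv hxv hyv ha hb hab

lemma eventually_mem_erosion [PseudoMetricSpace E] [ProperSpace E] {D : Set E} (hD : IsOpen D)
    {r : ℕ → ℝ} (hr : ∀ n, 0 ≤ r n) (hr0 : Tendsto r atTop (𝓝 0)) {x : E} (hx : x ∈ D) :
    ∀ᶠ n in atTop, x ∈ erosion D (r n) := by
  obtain ⟨ε, hε, hball⟩ := Metric.isOpen_iff.1 hD x hx
  filter_upwards [hr0.eventually_lt_const hε] with n hn
  rw [mem_erosion_iff hD (hr n)]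
  exact (Metric.closedBall_subset_ball hn).trans hball

end Erosion

section Poincare

variable {d : ℕ} {D : Set (Space d)} {u : Space d → ℝ} {G : Space d → Space d}

lemma poincare_mollify (hD : IsOpen D) (hconv : Convex ℝ D) (hu : MemLp u 2 (volume.restrict D))
    (hG : IsWeakGradient D u G) (n : ℕ) :
    ∫⁻ x in erosion D (mollifier d n).rOut, ∫⁻ y in erosion D (mollifier d n).rOut,
        ‖mollify n (D.indicator u) x - mollify n (D.indicator u) y‖ₑ ^ 2 ≤
      Metric.ediam D ^ 2 * (2 ^ d * volume D * ∫⁻ z in D, ‖G z‖ₑ ^ 2) := by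
  set E := erosion D (mollifier d n).rOut
  set v := mollify n (D.indicator u)
  have hr : 0 ≤ (mollifier d n).rOut := (mollifier d n).rOut_pos.le
  have hED : E ⊆ D := erosion_subset D hr
  have hE : MeasurableSet E := measurableSet_erosion D _
  have hfderiv : ∫⁻ z in E, ‖fderiv ℝ v z‖ₑ ^ 2 ≤ ∫⁻ z in D, ‖G z‖ₑ ^ 2 :=
    calc ∫⁻ z in E, ‖fderiv ℝ v z‖ₑ ^ 2
        ≤ ∫⁻ z in E, ∫⁻ y in D,
            ENNReal.ofReal ((mollifier d n).normed volume (z - y)) * ‖G y‖ₑ ^ 2 :=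
          setLIntegral_mono' hE fun z hz => enorm_fderiv_mollify_sq_le hD.measurableSet hu hG
            (closedBall_subset_of_mem_erosion hz)
      _ ≤ _ := setLIntegral_le_lintegral _ _
      _ = _ := lintegral_lintegral_mollifier_mul n (hG.1.1.enorm.pow_const 2)
  refine (poincare_convex_contDiff volume hE (convex_erosion hD hconv hr)
    (contDiff_mollify n (locallyIntegrable_indicator hD.measurableSet hu))).trans ?_
  rw [finrank_euclideanSpace, Fintype.card_fin]
  gcongr

lemma setLIntegral_indicator_prod {X : Type*} [MeasurableSpace X] (μ : Measure X) {D E : Set X}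
    (hE : MeasurableSet E) (hED : E ⊆ D) (F : X × X → ENNReal) :
    ∫⁻ x in D, ∫⁻ y in D, (E ×ˢ E).indicator F (x, y) ∂μ ∂μ =
      ∫⁻ x in E, ∫⁻ y in E, F (x, y) ∂μ ∂μ := by
  have restrict (f : X → ENNReal) : ∫⁻ x in D, E.indicator f x ∂μ = ∫⁻ x in E, f x ∂μ := by
    rw [lintegral_indicator hE, Measure.restrict_restrict hE, inter_eq_left.2 hED]
  rw [← restrict]
  refine lintegral_congr fun x => ?_
  by_cases hx : x ∈ E
  · rw [indicator_of_mem hx, ← restrict]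
    exact lintegral_congr fun y => by by_cases hy : y ∈ E <;> simp [hx, hy]
  · simp [hx]

theorem poincare_convex (hD : IsOpen D) (hconv : Convex ℝ D) (hu : MemLp u 2 (volume.restrict D))
    (hG : IsWeakGradient D u G) :
    ∫⁻ x in D, ∫⁻ y in D, ‖u x - u y‖ₑ ^ 2 ≤
      Metric.ediam D ^ 2 * (2 ^ d * volume D * ∫⁻ z in D, ‖G z‖ₑ ^ 2) := by
  have hr : ∀ n, 0 ≤ (mollifier d n).rOut := fun n => (mollifier d n).rOut_pos.le
  have hloc := locallyIntegrable_indicator hD.measurableSet hu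
  set v : ℕ → Space d → ℝ := fun n => mollify n (D.indicator u)
  set E : ℕ → Set (Space d) := fun n => erosion D (mollifier d n).rOut
  have hE : ∀ n, MeasurableSet (E n) := fun n => measurableSet_erosion D _
  set F : ℕ → Space d × Space d → ENNReal := fun n => (E n ×ˢ E n).indicator
    fun p => ‖v n p.1 - v n p.2‖ₑ ^ 2
  have hF : ∀ n, Measurable (F n) := fun n => by
    have hv := (contDiff_mollify n hloc).continuous
    exact (Continuous.measurable ((ENNReal.continuous_pow 2).comp
      ((hv.comp continuous_fst).sub (hv.comp continuous_snd)).enorm)).indicator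
        ((hE n).prod (hE n))
  have hbound : ∀ n, ∫⁻ x in D, ∫⁻ y in D, F n (x, y) ≤
      Metric.ediam D ^ 2 * (2 ^ d * volume D * ∫⁻ z in D, ‖G z‖ₑ ^ 2) := fun n =>
    (setLIntegral_indicator_prod volume (hE n) (erosion_subset D (hr n)) _).trans_le
      (poincare_mollify hD hconv hu hG n)
  have hlim : ∀ᵐ x ∂(volume.restrict D), Tendsto (fun n => v n x) atTop (𝓝 (u x)) ∧ x ∈ D := by
    filter_upwards [ae_restrict_of_ae (ae_tendsto_mollify hloc),
      ae_restrict_mem hD.measurableSet] with x hx hxD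
    exact ⟨by rwa [indicator_of_mem hxD] at hx, hxD⟩
  refine lintegral_lintegral_le_of_tendsto (F := fun n x y => F n (x, y)) hF hbound ?_
  filter_upwards [hlim] with x hx
  filter_upwards [hlim] with y hy
  have htendsto : Tendsto (fun n => ‖v n x - v n y‖ₑ ^ 2) atTop (𝓝 (‖u x - u y‖ₑ ^ 2)) :=
    (((ENNReal.continuous_pow 2).comp continuous_enorm).tendsto _).comp (hx.1.sub hy.1)
  refine htendsto.congr' ?_
  filter_upwards [eventually_mem_erosion hD hr tendsto_mollifier_rOut hx.2,
    eventually_mem_erosion hD hr tendsto_mollifier_rOut hy.2] with n hnx hny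
  exact (indicator_of_mem (mk_mem_prod hnx hny) (fun p => ‖v n p.1 - v n p.2‖ₑ ^ 2)).symm

theorem lintegral_sub_average_le (hD : IsOpen D) (hconv : Convex ℝ D)
    (hu : MemLp u 2 (volume.restrict D)) (hG : IsWeakGradient D u G) {A : Set (Space d)}
    (hAD : A ⊆ D) (hA0 : volume A ≠ 0) (hA1 : volume A ≠ ⊤) :
    ∫⁻ x in D, ‖u x - ⨍ y in A, u y‖ₑ ^ 2 ≤ (volume A)⁻¹ *
      (Metric.ediam D ^ 2 * (2 ^ d * volume D * ∫⁻ z in D, ‖G z‖ₑ ^ 2)) := by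
  have : IsFiniteMeasure (volume.restrict A) := ⟨by simpa using hA1.lt_top⟩
  have : NeZero (volume.restrict A) := ⟨by simpa using hA0⟩
  have huA : Integrable u (volume.restrict A) :=
    (hu.mono_measure (Measure.restrict_mono hAD le_rfl)).integrable (by norm_num)
  calc ∫⁻ x in D, ‖u x - ⨍ y in A, u y‖ₑ ^ 2
      ≤ ∫⁻ x in D, (volume A)⁻¹ * ∫⁻ y in D, ‖u x - u y‖ₑ ^ 2 := by
        refine lintegral_mono fun x => (enorm_sub_average_sq_le huA (u x)).trans ?_
        rw [Measure.restrict_apply_univ]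
        gcongr
    _ = (volume A)⁻¹ * ∫⁻ x in D, ∫⁻ y in D, ‖u x - u y‖ₑ ^ 2 :=
        lintegral_const_mul' _ _ (ENNReal.inv_ne_top.2 hA0)
    _ ≤ _ := by
        gcongr
        exact poincare_convex hD hconv hu hG

end Poincare

variable {d : ℕ}

/-! ### Domains with Lipschitz boundary -/

/-- `Ω` is, in the ball of radius `r` about `z`, the region below the graph of `ψ` in the
direction `ν`. As in `HasLipschitzBoundary`, `ψ` is a function on the whole space that is evaluated
at the projection onto the hyperplane orthogonal to `ν`. -/
structure IsGraphChart (Ω : Set (Space d)) (z : Space d) (r : ℝ) (L : NNReal) (ν : Space d)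
    (ψ : Space d → ℝ) : Prop where
  norm_eq : ‖ν‖ = 1
  lipschitz : LipschitzWith L ψ
  mem_iff : ∀ y ∈ Metric.ball z r, (y ∈ Ω ↔ inner ℝ ν y < ψ (y - (inner ℝ ν y : ℝ) • ν))

lemma norm_sub_inner_smul_le {E : Type*} [NormedAddCommGroup E] [InnerProductSpace ℝ E] {ν : E}
    (hν : ‖ν‖ = 1) (v : E) : ‖v - (inner ℝ ν v : ℝ) • ν‖ ≤ ‖v‖ := by
  have hpythagoras : ‖v - (inner ℝ ν v : ℝ) • ν‖ ^ 2 = ‖v‖ ^ 2 - (inner ℝ ν v : ℝ) ^ 2 := by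
    rw [norm_sub_sq_real, inner_smul_right, norm_smul, hν, real_inner_comm, mul_one,
      Real.norm_eq_abs, sq_abs]
    ring
  exact (sq_le_sq₀ (norm_nonneg _) (norm_nonneg _)).1
    (hpythagoras.trans_le (sub_le_self _ (sq_nonneg _)))

namespace IsGraphChart

variable {Ω : Set (Space d)} {z ν : Space d} {r : ℝ} {L : NNReal} {ψ : Space d → ℝ}

lemma mono (hc : IsGraphChart Ω z r L ν ψ) {z' : Space d} {r' : ℝ} {L' : NNReal}
    (hball : Metric.ball z' r' ⊆ Metric.ball z r) (hL : L ≤ L') : IsGraphChart Ω z' r' L' ν ψ :=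
  ⟨hc.norm_eq, hc.lipschitz.weaken hL, fun y hy => hc.mem_iff y (hball hy)⟩

lemma inner_self (hc : IsGraphChart Ω z r L ν ψ) : inner ℝ ν ν = (1 : ℝ) := by
  rw [real_inner_self_eq_norm_sq, hc.norm_eq, one_pow]

lemma continuous_height (hc : IsGraphChart Ω z r L ν ψ) :
    Continuous fun y : Space d => ψ (y - (inner ℝ ν y : ℝ) • ν) :=
  hc.lipschitz.continuous.comp (by fun_prop)

lemma inner_le_of_mem_closure (hc : IsGraphChart Ω z r L ν ψ) {y : Space d}
    (hy : y ∈ Metric.ball z r) (hyc : y ∈ closure Ω) :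
    inner ℝ ν y ≤ ψ (y - (inner ℝ ν y : ℝ) • ν) := by
  by_contra! hlt
  have hopen : IsOpen (Metric.ball z r ∩
      {y : Space d | ψ (y - (inner ℝ ν y : ℝ) • ν) < inner ℝ ν y}) :=
    Metric.isOpen_ball.inter (isOpen_lt hc.continuous_height (by fun_prop))
  obtain ⟨w, ⟨hwz, hwabove⟩, hw⟩ := mem_closure_iff.1 hyc _ hopen ⟨hy, hlt⟩
  exact ((hc.mem_iff w hwz).1 hw).not_gt hwabove

lemma inner_eq_of_mem_frontier (hc : IsGraphChart Ω z r L ν ψ) (hΩ : IsOpen Ω) {y : Space d}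
    (hy : y ∈ Metric.ball z r) (hyf : y ∈ frontier Ω) :
    inner ℝ ν y = ψ (y - (inner ℝ ν y : ℝ) • ν) := by
  refine le_antisymm (hc.inner_le_of_mem_closure hy (frontier_subset_closure hyf)) ?_
  by_contra! hlt
  rw [hΩ.frontier_eq] at hyf
  exact hyf.2 ((hc.mem_iff y hy).2 hlt)

lemma add_smul_mem (hc : IsGraphChart Ω z r L ν ψ) {x v : Space d} (hx : x ∈ Metric.ball z r)
    (hxc : x ∈ closure Ω) {t : ℝ} (ht : 0 < t) (hxt : x + t • v ∈ Metric.ball z r)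
    (hv : inner ℝ ν v < -(L * ‖v - (inner ℝ ν v : ℝ) • ν‖)) : x + t • v ∈ Ω := by
  have hheight := hc.inner_le_of_mem_closure hx hxc
  have hproj : x + t • v - (inner ℝ ν (x + t • v) : ℝ) • ν =
      (x - (inner ℝ ν x : ℝ) • ν) + t • (v - (inner ℝ ν v : ℝ) • ν) := by
    rw [inner_add_right, inner_smul_right]
    module
  have hlip := hc.lipschitz.dist_le_mul (x - (inner ℝ ν x : ℝ) • ν)
    ((x - (inner ℝ ν x : ℝ) • ν) + t • (v - (inner ℝ ν v : ℝ) • ν))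
  rw [dist_eq_norm, dist_eq_norm, sub_add_cancel_left, norm_neg, norm_smul,
    Real.norm_of_nonneg ht.le, Real.norm_eq_abs] at hlip
  have hdescent : t * inner ℝ ν v < t * -(L * ‖v - (inner ℝ ν v : ℝ) • ν‖) :=
    mul_lt_mul_of_pos_left hv ht
  rw [hc.mem_iff _ hxt, hproj, inner_add_right, inner_smul_right]
  linarith [le_of_abs_le hlip]

end IsGraphChart

lemma exists_uniform_charts {Ω : Set (Space d)} (hb : Bornology.IsBounded Ω)
    (hL : HasLipschitzBoundary Ω) :
    ∃ r : ℝ, 0 < r ∧ ∃ L : NNReal, ∀ z ∈ frontier Ω, ∃ ν ψ, IsGraphChart Ω z r L ν ψ := by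
  have hcompact : IsCompact (frontier Ω) := Metric.isCompact_of_isClosed_isBounded
    isClosed_frontier (hb.closure.subset frontier_subset_closure)
  refine hcompact.induction_on (p := fun S => ∃ r : ℝ, 0 < r ∧ ∃ L : NNReal,
    ∀ z ∈ S, ∃ ν ψ, IsGraphChart Ω z r L ν ψ) ⟨1, one_pos, 0, by simp⟩ ?_ ?_ ?_
  · rintro S S' hS ⟨r, hr, L, hS'⟩
    exact ⟨r, hr, L, fun z hz => hS' z (hS hz)⟩
  · rintro S S' ⟨r, hr, L, hS⟩ ⟨r', hr', L', hS'⟩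
    refine ⟨min r r', lt_min hr hr', max L L', fun z hz => hz.elim (fun hz => ?_) fun hz => ?_⟩
    · obtain ⟨ν, ψ, hc⟩ := hS z hz
      exact ⟨ν, ψ, hc.mono (Metric.ball_subset_ball (min_le_left _ _)) (le_max_left _ _)⟩
    · obtain ⟨ν, ψ, hc⟩ := hS' z hz
      exact ⟨ν, ψ, hc.mono (Metric.ball_subset_ball (min_le_right _ _)) (le_max_right _ _)⟩
  · intro x hx
    obtain ⟨U, hU, ν, hν, L, ψ, hψ, hUΩ⟩ := hL x hx
    obtain ⟨ε, hε, hεU⟩ := Metric.mem_nhds_iff.1 hU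
    have hc : IsGraphChart Ω x ε L ν ψ := ⟨hν, hψ, fun y hy => hUΩ y (hεU hy)⟩
    refine ⟨Metric.ball x (ε / 2), mem_nhdsWithin_of_mem_nhds
      (Metric.ball_mem_nhds _ (half_pos hε)), ε / 2, half_pos hε, L, fun z hz =>
      ⟨ν, ψ, hc.mono (Metric.ball_subset_ball' ?_) le_rfl⟩⟩
    linarith [Metric.mem_ball.1 hz]

lemma volume_graph_inter_ball {ν : Space d} (hν : ‖ν‖ = 1) {ψ : Space d → ℝ} (hψ : Continuous ψ)
    (z : Space d) (r : ℝ) :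
    volume ({y : Space d | inner ℝ ν y = ψ (y - (inner ℝ ν y : ℝ) • ν)} ∩ Metric.ball z r) = 0 := by
  have hνν : inner ℝ ν ν = (1 : ℝ) := by rw [real_inner_self_eq_norm_sq, hν, one_pow]
  refine Measure.addHaar_eq_zero_of_disjoint_translates volume
    (fun n : ℕ => (1 / ((n : ℝ) + 1)) • ν) ?_ ?_
    ((isClosed_eq (by fun_prop) (hψ.comp (by fun_prop))).measurableSet.inter measurableSet_ball)
  · refine (Metric.isBounded_closedBall (x := (0 : Space d)) (r := 1)).subset ?_
    rintro _ ⟨n, rfl⟩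
    rw [mem_closedBall_zero_iff, norm_smul, hν, mul_one, Real.norm_of_nonneg (by positivity)]
    exact Nat.one_div_le_one_div (Nat.zero_le n) |>.trans_eq (by simp)
  · intro m n hmn
    rw [Function.onFun, Set.disjoint_left]
    rintro p hp hq
    simp only [Set.singleton_add, mem_image, mem_inter_iff, mem_ofPred_eq] at hp hq
    obtain ⟨y, ⟨hy, -⟩, rfl⟩ := hp
    obtain ⟨w, ⟨hw, -⟩, hyw⟩ := hq
    set c := (1 / ((m : ℝ) + 1)) - (1 / ((n : ℝ) + 1)) with hc
    have hwy : w = y + c • ν := by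
      rw [sub_smul, ← add_sub_assoc, add_comm y, ← hyw]
      abel
    have hinner : inner ℝ ν w = inner ℝ ν y + c := by
      rw [hwy, inner_add_right, inner_smul_right, hνν, mul_one]
    have hproj : w - (inner ℝ ν w : ℝ) • ν = y - (inner ℝ ν y : ℝ) • ν := by
      rw [hinner, hwy]
      module
    rw [hproj, hinner, ← hy, add_eq_left, hc, sub_eq_zero, one_div, one_div, inv_inj,
      add_left_inj, Nat.cast_inj] at hw
    exact hmn hw

lemma volume_frontier_eq_zero {Ω : Set (Space d)} (hΩ : IsOpen Ω) (hb : Bornology.IsBounded Ω)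
    (hL : HasLipschitzBoundary Ω) : volume (frontier Ω) = 0 := by
  obtain ⟨r, hr, L, hcharts⟩ := exists_uniform_charts hb hL
  refine measure_null_of_locally_null _ fun z hz => ?_
  obtain ⟨ν, ψ, hc⟩ := hcharts z hz
  refine ⟨frontier Ω ∩ Metric.ball z r,
    inter_mem_nhdsWithin _ (Metric.ball_mem_nhds z hr), ?_⟩
  refine measure_mono_null ?_ (volume_graph_inter_ball hc.norm_eq hc.lipschitz.continuous z r)
  exact fun y hy => ⟨hc.inner_eq_of_mem_frontier hΩ hy.2 hy.1, hy.2⟩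

/-! ### The uniform cone property -/

section Cone

variable {E : Type*} [NormedAddCommGroup E] [NormedSpace ℝ E] {Ω : Set E}

/-- The ball of radius `h` about `c` is seen, inside `Ω`, from all points of the closure of `Ω` at
distance at most `h` from `z`. -/
def SeesBall (Ω : Set E) (z c : E) (h : ℝ) : Prop :=
  ∀ x ∈ closure Ω, ‖x - z‖ ≤ h → ∀ y, ‖y - c‖ ≤ h → ∀ t : ℝ, 0 < t → t ≤ 1 → x + t • (y - x) ∈ Ω

lemma norm_add_smul_sub_sub_le {x y z c : E} {k h t : ℝ} (hk : 0 ≤ k) (hh : 0 ≤ h)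
    (hxz : ‖x - z‖ ≤ h) (hyc : ‖y - c‖ ≤ h) (hcz : ‖c - z‖ ≤ k * h) (ht : 0 ≤ t) (ht1 : t ≤ 1) :
    ‖x + t • (y - x) - z‖ ≤ (k + 1) * h := by
  have hx : x ∈ Metric.closedBall z ((k + 1) * h) :=
    mem_closedBall_iff_norm.2 (by linarith [mul_nonneg hk hh])
  have hy : y ∈ Metric.closedBall z ((k + 1) * h) :=
    mem_closedBall_iff_norm.2 (by linarith [norm_sub_le_norm_sub_add_norm_sub y c z])
  exact mem_closedBall_iff_norm.1
    ((convex_closedBall z _).add_smul_sub_mem hx hy ⟨ht, ht1⟩)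

lemma ball_subset_of_forall_frontier (hΩ : IsOpen Ω) {z : E} (hz : z ∈ closure Ω) {r : ℝ}
    (hr : 0 < r) (hfrontier : ∀ w ∈ frontier Ω, r ≤ ‖w - z‖) : Metric.ball z r ⊆ Ω := by
  rw [hΩ.frontier_eq] at hfrontier
  have hmem : ∀ q ∈ Metric.ball z r, q ∈ closure Ω → q ∈ Ω := fun q hq hqΩ => by
    by_contra hqn
    exact (hfrontier q ⟨hqΩ, hqn⟩).not_gt (mem_ball_iff_norm.1 hq)
  have hzball : z ∈ Metric.ball z r := Metric.mem_ball_self hr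
  refine (convex_ball z r).isPreconnected.subset_left_of_subset_union hΩ
    isClosed_closure.isOpen_compl (disjoint_compl_right_iff_subset.2 subset_closure)
    (fun q hq => ?_) ⟨z, hzball, hmem z hzball hz⟩
  exact (em (q ∈ closure Ω)).imp_left (hmem q hq)

end Cone

/-- Moving from `x` towards the ball about `z - k h ν` is a descent in the direction `ν`, of slope
steeper than the Lipschitz constant of the graph as soon as `k > 2 L + 2`. -/
lemma IsGraphChart.seesBall {Ω : Set (Space d)} {w z ν : Space d} {r : ℝ} {L : NNReal}
    {ψ : Space d → ℝ} (hc : IsGraphChart Ω w r L ν ψ) {k h : ℝ} (hk : 2 * L + 2 < k) (hh : 0 < h)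
    (hzw : ‖z - w‖ + (k + 1) * h < r) : SeesBall Ω z (z - (k * h) • ν) h := by
  intro x hx hxz y hy t ht ht1
  have hk0 : 0 < k := by linarith [L.coe_nonneg]
  have hcz : ‖z - (k * h) • ν - z‖ ≤ k * h := by
    rw [sub_sub_cancel_left, norm_neg, norm_smul, hc.norm_eq, mul_one,
      Real.norm_of_nonneg (by positivity)]
  have hball : ∀ p : Space d, ‖p - z‖ ≤ (k + 1) * h → p ∈ Metric.ball w r := fun p hp =>
    mem_ball_iff_norm.2 (by linarith [norm_sub_le_norm_sub_add_norm_sub p z w])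
  refine hc.add_smul_mem (hball x (by linarith [mul_pos hk0 hh])) hx ht
    (hball _ (norm_add_smul_sub_sub_le hk0.le hh.le hxz hy hcz ht.le ht1)) ?_
  set b := (y - (z - (k * h) • ν)) - (x - z) with hb
  have hbnorm : ‖b‖ ≤ 2 * h := by linarith [norm_sub_le (y - (z - (k * h) • ν)) (x - z)]
  have hyx : y - x = b - (k * h) • ν := by
    rw [hb]
    module
  have hinner : inner ℝ ν (y - x) = inner ℝ ν b - k * h := by
    rw [hyx, inner_sub_right, inner_smul_right, hc.inner_self, mul_one]
  have hproj : y - x - (inner ℝ ν (y - x) : ℝ) • ν = b - (inner ℝ ν b : ℝ) • ν := by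
    rw [hinner, hyx]
    module
  have hbinner : inner ℝ ν b ≤ 2 * h := by
    have := real_inner_le_norm ν b
    rw [hc.norm_eq, one_mul] at this
    linarith
  have hbproj : L * ‖b - (inner ℝ ν b : ℝ) • ν‖ ≤ L * (2 * h) :=
    mul_le_mul_of_nonneg_left ((norm_sub_inner_smul_le hc.norm_eq b).trans hbnorm) L.coe_nonneg
  rw [hproj, hinner]
  linarith [mul_lt_mul_of_pos_right hk hh]

lemma exists_seesBall {Ω : Set (Space d)} (hΩ : IsOpen Ω) (hb : Bornology.IsBounded Ω)
    (hL : HasLipschitzBoundary Ω) :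
    ∃ h₀ : ℝ, 0 < h₀ ∧ ∃ k : ℝ, 1 ≤ k ∧ ∀ z ∈ closure Ω, ∀ h, 0 < h → h ≤ h₀ →
      ∃ c, ‖c - z‖ ≤ k * h ∧ SeesBall Ω z c h := by
  obtain ⟨r, hr, L, hcharts⟩ := exists_uniform_charts hb hL
  obtain ⟨k, hk, hk3⟩ : ∃ k : ℝ, 2 * L + 2 < k ∧ 3 ≤ k :=
    ⟨2 * L + 3, by linarith, by linarith [L.coe_nonneg]⟩
  refine ⟨r / (4 * k), by positivity, k, by linarith, fun z hz h hh hh₀ => ?_⟩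
  have hkh : (k + 1) * h < r / 2 := by
    rw [le_div_iff₀ (by positivity)] at hh₀
    nlinarith
  by_cases hnear : ∃ w ∈ frontier Ω, ‖w - z‖ < r / 2
  · obtain ⟨w, hw, hwz⟩ := hnear
    obtain ⟨ν, ψ, hc⟩ := hcharts w hw
    refine ⟨z - (k * h) • ν, ?_, hc.seesBall hk hh ?_⟩
    · rw [sub_sub_cancel_left, norm_neg, norm_smul, hc.norm_eq, mul_one,
        Real.norm_of_nonneg (by positivity)]
    · rw [norm_sub_rev]
      linarith
  · push Not at hnear
    have hcz : ‖z - z‖ ≤ k * h := by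
      rw [sub_self, norm_zero]
      positivity
    refine ⟨z, hcz, fun x _ hxz y hy t ht ht1 =>
      ball_subset_of_forall_frontier hΩ hz (half_pos hr) hnear (mem_ball_iff_norm.2 ?_)⟩
    exact (norm_add_smul_sub_sub_le (by positivity) hh.le hxz hy hcz ht.le ht1).trans_lt hkh

section Patch

variable {E : Type*} [NormedAddCommGroup E] [NormedSpace ℝ E] {s : Set E} {c : E} {h : ℝ}

/-- The union of the half-open segments from the points of `s` (excluded) to the points of the ball.
For a simplex `s` it is an open convex set that contains both the ball and the interior of `s`. -/
def patch (s : Set E) (c : E) (h : ℝ) : Set E :=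
  {p | ∃ x ∈ s, ∃ y ∈ Metric.ball c h, ∃ t : ℝ, 0 < t ∧ t ≤ 1 ∧ p = x + t • (y - x)}

lemma isOpen_patch : IsOpen (patch s c h) := by
  rw [isOpen_iff_mem_nhds]
  rintro p ⟨x, hx, y, hy, t, ht, ht1, rfl⟩
  have hcont : ContinuousAt (fun p : E => x + t⁻¹ • (p - x)) (x + t • (y - x)) := by fun_prop
  have hinv : x + t⁻¹ • (x + t • (y - x) - x) = y := by
    rw [add_sub_cancel_left, inv_smul_smul₀ ht.ne', add_sub_cancel]
  filter_upwards [hcont.preimage_mem_nhds (t := Metric.ball c h)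
    (by rw [hinv]; exact Metric.isOpen_ball.mem_nhds hy)] with q hq
  refine ⟨x, hx, _, hq, t, ht, ht1, ?_⟩
  rw [add_sub_cancel_left, smul_inv_smul₀ ht.ne', add_sub_cancel]

lemma exists_mem_add_smul_eq (hs : Convex ℝ s) {x y : E} (hx : x ∈ s) (hy : y ∈ s) {a b : ℝ}
    (ha : 0 ≤ a) (hb : 0 ≤ b) : ∃ z ∈ s, (a + b) • z = a • x + b • y := by
  open scoped Pointwise in
  have hmem : a • x + b • y ∈ (a + b) • s := by
    rw [hs.add_smul ha hb]
    exact Set.add_mem_add (Set.smul_mem_smul_set hx) (Set.smul_mem_smul_set hy)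
  exact hmem

lemma convex_patch (hs : Convex ℝ s) : Convex ℝ (patch s c h) := by
  rintro _ ⟨x, hx, y, hy, t, ht, ht1, rfl⟩ _ ⟨x', hx', y', hy', t', ht', ht1', rfl⟩ a b ha hb hab
  have hpos : 0 < a * t + b * t' := by
    rcases ha.eq_or_lt with rfl | ha
    · rw [zero_add] at hab
      simpa [hab] using ht'
    · positivity
  have hcompl : 1 - (a * t + b * t') = a * (1 - t) + b * (1 - t') := by linear_combination -hab
  have hwt : 0 ≤ a * (1 - t) := mul_nonneg ha (sub_nonneg.2 ht1)
  have hwt' : 0 ≤ b * (1 - t') := mul_nonneg hb (sub_nonneg.2 ht1')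
  obtain ⟨x'', hx'', hxx⟩ := exists_mem_add_smul_eq hs hx hx' hwt hwt'
  obtain ⟨y'', hy'', hyy⟩ := exists_mem_add_smul_eq (convex_ball c h) hy hy'
    (mul_nonneg ha ht.le) (mul_nonneg hb ht'.le)
  refine ⟨x'', hx'', y'', hy'', a * t + b * t', hpos, by linarith, ?_⟩
  calc a • (x + t • (y - x)) + b • (x' + t' • (y' - x'))
      = ((a * (1 - t)) • x + (b * (1 - t')) • x') + ((a * t) • y + (b * t') • y') := by module
    _ = (1 - (a * t + b * t')) • x'' + (a * t + b * t') • y'' := by rw [hcompl, hxx, hyy]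
    _ = x'' + (a * t + b * t') • (y'' - x'') := by module

lemma ball_subset_patch (hs : s.Nonempty) : Metric.ball c h ⊆ patch s c h := fun y hy => by
  obtain ⟨x, hx⟩ := hs
  exact ⟨x, hx, y, hy, 1, one_pos, le_rfl, by rw [one_smul, add_sub_cancel]⟩

lemma interior_subset_patch (hh : 0 < h) : interior s ⊆ patch s c h := by
  intro x hx
  -- `x` lies strictly between `c` and a point of `s` slightly beyond `x`.
  have hcont : ContinuousAt (fun τ : ℝ => x - τ • (c - x)) 0 := by fun_prop
  have hnhds : (fun τ : ℝ => x - τ • (c - x)) ⁻¹' s ∈ 𝓝 (0 : ℝ) :=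
    hcont.preimage_mem_nhds (by simpa using mem_interior_iff_mem_nhds.1 hx)
  have hevent : ∀ᶠ τ in 𝓝[>] (0 : ℝ), x - τ • (c - x) ∈ s := nhdsWithin_le_nhds hnhds
  obtain ⟨τ, hmem, hτ : 0 < τ⟩ := (hevent.and self_mem_nhdsWithin).exists
  refine ⟨_, hmem, c, Metric.mem_ball_self hh, τ / (1 + τ), by positivity, ?_, ?_⟩
  · rw [div_le_one (by positivity)]
    linarith
  · have hdiff : c - (x - τ • (c - x)) = (1 + τ) • (c - x) := by module
    rw [hdiff, smul_smul, div_mul_cancel₀ _ (by positivity), sub_add_cancel]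

lemma patch_subset {Ω : Set E} {z : E} (hsΩ : s ⊆ closure Ω)
    (hsz : ∀ x ∈ s, ‖x - z‖ ≤ h) (hsees : SeesBall Ω z c h) : patch s c h ⊆ Ω := by
  rintro _ ⟨x, hx, y, hy, t, ht, ht1, rfl⟩
  exact hsees x (hsΩ hx) (hsz x hx) y (mem_ball_iff_norm.1 hy).le t ht ht1

lemma norm_sub_le_of_mem_patch {z : E} {k : ℝ} (hk : 0 ≤ k) (hh : 0 ≤ h)
    (hsz : ∀ x ∈ s, ‖x - z‖ ≤ h) (hcz : ‖c - z‖ ≤ k * h) {p : E} (hp : p ∈ patch s c h) :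
    ‖p - z‖ ≤ (k + 1) * h := by
  obtain ⟨x, hx, y, hy, t, ht, ht1, rfl⟩ := hp
  exact norm_add_smul_sub_sub_le hk hh (hsz x hx) (mem_ball_iff_norm.1 hy).le hcz ht.le ht1

end Patch

/-! ### Polynomials and the inverse inequality -/

/-- The algebra homomorphism from polynomials to polynomial functions on `ℝ^d`. -/
def polyFun : MvPolynomial (Fin d) ℝ →ₐ[ℝ] (Space d → ℝ) :=
  AlgHom.pi fun x => MvPolynomial.aeval fun i => x i

lemma polyFun_apply (p : MvPolynomial (Fin d) ℝ) (x : Space d) :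
    polyFun p x = MvPolynomial.eval (fun i => x i) p := rfl

lemma polyFun_C (c : ℝ) : polyFun (MvPolynomial.C c : MvPolynomial (Fin d) ℝ) = fun _ => c :=
  funext fun x => by rw [polyFun_apply, MvPolynomial.eval_C]

lemma contDiff_polyFun (p : MvPolynomial (Fin d) ℝ) : ContDiff ℝ ∞ (polyFun p) := by
  induction p using MvPolynomial.induction_on with
  | C a =>
    rw [polyFun_C]
    exact contDiff_const
  | add p q hp hq =>
    rw [map_add]
    exact hp.add hq
  | mul_X p i hp =>
    have hX : polyFun (MvPolynomial.X i : MvPolynomial (Fin d) ℝ) = fun x => x i :=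
      funext fun x => by rw [polyFun_apply, MvPolynomial.eval_X]
    rw [map_mul, hX]
    exact hp.mul (by fun_prop)

lemma differentiable_polyFun (p : MvPolynomial (Fin d) ℝ) : Differentiable ℝ (polyFun p) :=
  (contDiff_polyFun p).differentiable (by simp)

lemma eq_zero_of_polyFun_eventuallyEq_zero {p : MvPolynomial (Fin d) ℝ} {x : Space d}
    (hp : polyFun p =ᶠ[𝓝 x] 0) : p = 0 := by
  have hcont : ContinuousAt (fun v : Fin d → ℝ => (WithLp.toLp 2 v : Space d)) x.ofLp :=
    (PiLp.continuous_toLp 2 _).continuousAt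
  obtain ⟨δ, hδ, hsub⟩ := Metric.mem_nhds_iff.1 (hcont.preimage_mem_nhds hp)
  refine MvPolynomial.funext_set (fun i => Metric.ball (x i) δ)
    (fun i => infinite_of_mem_nhds (x i) (Metric.ball_mem_nhds _ hδ)) fun v hv => ?_
  rw [← ball_pi _ hδ] at hv
  rw [map_zero]
  exact hsub hv

lemma totalDegree_aeval_le {ι κ R : Type*} [CommSemiring R] {f : ι → MvPolynomial κ R}
    (hf : ∀ i, (f i).totalDegree ≤ 1) (p : MvPolynomial ι R) :
    (MvPolynomial.aeval f p).totalDegree ≤ p.totalDegree := by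
  rw [MvPolynomial.aeval_def, MvPolynomial.eval₂_eq]
  refine MvPolynomial.totalDegree_finsetSum_le fun m hm => ?_
  refine (MvPolynomial.totalDegree_mul _ _).trans ?_
  rw [MvPolynomial.algebraMap_eq, MvPolynomial.totalDegree_C, zero_add]
  refine (MvPolynomial.totalDegree_finsetProd _ _).trans ?_
  calc ∑ i ∈ m.support, (f i ^ m i).totalDegree
      ≤ ∑ i ∈ m.support, m i := Finset.sum_le_sum fun i _ =>
        (MvPolynomial.totalDegree_pow _ _).trans (mul_le_of_le_one_right' (hf i))
    _ ≤ p.totalDegree := MvPolynomial.le_totalDegree hm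

lemma exists_polyFun_eq_comp_affine (p : MvPolynomial (Fin d) ℝ) (x : Space d) (h : ℝ) :
    ∃ q : MvPolynomial (Fin d) ℝ, q.totalDegree ≤ p.totalDegree ∧
      polyFun q = fun y => polyFun p (x + h • y) := by
  refine ⟨MvPolynomial.aeval
    (fun i => MvPolynomial.C (x i) + MvPolynomial.C h * MvPolynomial.X i) p,
    totalDegree_aeval_le (fun i => ?_) p, funext fun y => ?_⟩
  · refine (MvPolynomial.totalDegree_add _ _).trans (max_le (by simp) ?_)
    exact (MvPolynomial.totalDegree_mul _ _).trans (by simp)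
  · rw [polyFun_apply, polyFun_apply, MvPolynomial.aeval_def, MvPolynomial.eval_eval₂]
    simp only [MvPolynomial.eval, MvPolynomial.algebraMap_eq]
    congr 1
    · ext a
      simp
    · funext i
      simp

lemma exists_norm_le_of_injective {V F G : Type*} [AddCommGroup V] [Module ℝ V]
    [FiniteDimensional ℝ V] [NormedAddCommGroup F] [NormedSpace ℝ F] [NormedAddCommGroup G]
    [NormedSpace ℝ G] (A : V →ₗ[ℝ] F) (hA : Function.Injective A) (B : V →ₗ[ℝ] G) :
    ∃ C : ℝ, 0 ≤ C ∧ ∀ v, ‖B v‖ ≤ C * ‖A v‖ := by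
  let e := LinearEquiv.ofInjective A hA
  have : FiniteDimensional ℝ (LinearMap.range A) := e.finiteDimensional
  let L : LinearMap.range A →L[ℝ] G := (B ∘ₗ e.symm.toLinearMap).toContinuousLinearMap
  have hL : ∀ v, L (e v) = B v := fun v => by simp [L]
  exact ⟨‖L‖, L.opNorm_nonneg, fun v => hL v ▸ L.le_opNorm (e v)⟩

lemma memLp_polyFun (p : MvPolynomial (Fin d) ℝ) {s : Set (Space d)} (hs : IsCompact s) :
    MemLp (polyFun p) 2 (volume.restrict s) := by
  have : IsFiniteMeasure (volume.restrict s) := ⟨by simpa using hs.measure_lt_top⟩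
  obtain ⟨M, hM⟩ := hs.exists_bound_of_continuousOn (contDiff_polyFun p).continuous.continuousOn
  exact MemLp.of_bound (contDiff_polyFun p).continuous.aestronglyMeasurable M
    ((ae_restrict_mem hs.measurableSet).mono hM)

/-- Restriction of polynomials to a compact set, as elements of `L²`. -/
def polyToLp {s : Set (Space d)} (hs : IsCompact s) :
    MvPolynomial (Fin d) ℝ →ₗ[ℝ] Lp ℝ 2 (volume.restrict s) where
  toFun p := (memLp_polyFun p hs).toLp _
  map_add' p q := by
    rw [← MemLp.toLp_add]
    congr 1
    exact map_add polyFun p q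
  map_smul' c p := by
    rw [RingHom.id_apply, ← MemLp.toLp_const_smul]
    congr 1
    exact map_smul polyFun c p

lemma injective_polyToLp {s : Set (Space d)} (hs : IsCompact s) (hint : (interior s).Nonempty) :
    Function.Injective (polyToLp hs) := by
  rw [injective_iff_map_eq_zero]
  intro p hp
  obtain ⟨x, hx⟩ := hint
  have hae : polyFun p =ᵐ[volume.restrict s] 0 := by
    have hcoe := (memLp_polyFun p hs).coeFn_toLp
    rw [show (memLp_polyFun p hs).toLp _ = 0 from hp] at hcoe
    exact hcoe.symm.trans (Lp.coeFn_zero _ _ _)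
  have heqOn : EqOn (polyFun p) 0 (interior s) :=
    Measure.eqOn_open_of_ae_eq (ae_restrict_of_ae_restrict_of_subset interior_subset hae)
      isOpen_interior (contDiff_polyFun p).continuous.continuousOn continuousOn_const
  exact eq_zero_of_polyFun_eventuallyEq_zero
    (eventuallyEq_of_mem (isOpen_interior.mem_nhds hx) heqOn)

/-- The derivatives of polynomials, as continuous functions on a set. -/
def polyFDeriv (s : Set (Space d)) : MvPolynomial (Fin d) ℝ →ₗ[ℝ] C(s, Space d →L[ℝ] ℝ) where
  toFun p := ⟨fun x => fderiv ℝ (polyFun p) x,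
    ((contDiff_polyFun p).continuous_fderiv (by simp)).comp continuous_subtype_val⟩
  map_add' p q := by
    ext1 x
    rw [ContinuousMap.coe_mk, map_add]
    exact fderiv_add (differentiable_polyFun _ _) (differentiable_polyFun _ _)
  map_smul' c p := by
    ext1 x
    rw [ContinuousMap.coe_mk, map_smul]
    exact fderiv_const_smul (differentiable_polyFun _ _) c

lemma exists_enorm_fderiv_polyFun_le (r : ℕ) {s t : Set (Space d)} (hs : IsCompact s)
    (hint : (interior s).Nonempty) (ht : IsCompact t) :
    ∃ C : ENNReal, C ≠ ⊤ ∧ ∀ p : MvPolynomial (Fin d) ℝ, p.totalDegree ≤ r → ∀ y ∈ t,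
      ‖fderiv ℝ (polyFun p) y‖ₑ ≤ C * eLpNorm (polyFun p) 2 (volume.restrict s) := by
  have : CompactSpace t := isCompact_iff_compactSpace.1 ht
  let V := MvPolynomial.restrictTotalDegree (Fin d) ℝ r
  obtain ⟨C, hC, hle⟩ := exists_norm_le_of_injective (G := C(t, Space d →L[ℝ] ℝ))
    (polyToLp hs ∘ₗ V.subtype) ((injective_polyToLp hs hint).comp V.injective_subtype)
    (polyFDeriv t ∘ₗ V.subtype)
  refine ⟨ENNReal.ofReal C, ENNReal.ofReal_ne_top, fun p hp y hy => ?_⟩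
  have hbound : ‖fderiv ℝ (polyFun p) y‖ ≤ C * ‖polyToLp hs p‖ :=
    (ContinuousMap.norm_coe_le_norm (polyFDeriv t p) ⟨y, hy⟩).trans
      (hle ⟨p, (MvPolynomial.mem_restrictTotalDegree _ _ _).2 hp⟩)
  have hnorm : ‖polyToLp hs p‖ = (eLpNorm (polyFun p) 2 (volume.restrict s)).toReal :=
    Lp.norm_toLp _ (memLp_polyFun p hs)
  rw [← ofReal_norm, ← ENNReal.ofReal_toReal (memLp_polyFun p hs).eLpNorm_ne_top,
    ← ENNReal.ofReal_mul hC, ← hnorm]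
  exact ENNReal.ofReal_le_ofReal hbound

lemma eLpNorm_two_sq {X F : Type*} [MeasurableSpace X] [NormedAddCommGroup F] {μ : Measure X}
    (u : X → F) : eLpNorm u 2 μ ^ 2 = ∫⁻ x, ‖u x‖ₑ ^ 2 ∂μ := by
  simpa using eLpNorm_nnreal_pow_eq_lintegral (f := u) (μ := μ) (two_ne_zero (α := NNReal))

section Scaling

variable {E : Type*} [NormedAddCommGroup E] [NormedSpace ℝ E]

lemma setLIntegral_comp_add_smul_le [FiniteDimensional ℝ E] [MeasurableSpace E] [BorelSpace E]
    {μ : Measure E} [μ.IsAddHaarMeasure] {H : E → ENNReal} (hH : Measurable H) {s t : Set E}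
    (hs : MeasurableSet s) (ht : MeasurableSet t) {x : E} {h : ℝ} (hh : 0 < h)
    (hst : ∀ y ∈ t, x + h • y ∈ s) :
    ∫⁻ y in t, H (x + h • y) ∂μ ≤
      ENNReal.ofReal ((h ^ Module.finrank ℝ E)⁻¹) * ∫⁻ y in s, H y ∂μ := by
  rw [← lintegral_indicator hs, ← lintegral_comp_add_smul _ (hH.indicator hs) hh x,
    ← lintegral_indicator ht]
  refine lintegral_mono fun y => ?_
  by_cases hy : y ∈ t
  · rw [indicator_of_mem hy, indicator_of_mem (hst y hy)]
  · rw [indicator_of_notMem hy]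
    exact zero_le

lemma fderiv_comp_add_smul {F : Type*} [NormedAddCommGroup F] [NormedSpace ℝ F] (f : E → F)
    (x y : E) (h : ℝ) : fderiv ℝ (fun y => f (x + h • y)) y = h • fderiv ℝ f (x + h • y) := by
  rw [← fderiv_comp_add_left, ← fderiv_comp_smul]

end Scaling

lemma exists_enorm_fderiv_polyFun_sq_le (d r : ℕ) {σ : ℝ} (hσ : 0 < σ) :
    ∃ C : ENNReal, C ≠ ⊤ ∧ ∀ p : MvPolynomial (Fin d) ℝ, p.totalDegree ≤ r → ∀ (x : Space d)
      (h : ℝ), 0 < h → ∀ y ∈ Metric.closedBall x h, ‖fderiv ℝ (polyFun p) y‖ₑ ^ 2 ≤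
        C * ENNReal.ofReal (h⁻¹ ^ 2) * (ENNReal.ofReal ((h ^ d)⁻¹) *
          ∫⁻ z in Metric.closedBall x (σ * h), ‖polyFun p z‖ₑ ^ 2) := by
  have hint : (interior (Metric.closedBall (0 : Space d) σ)).Nonempty :=
    ⟨0, mem_interior_iff_mem_nhds.2 (Metric.closedBall_mem_nhds 0 hσ)⟩
  obtain ⟨C, hC, hle⟩ := exists_enorm_fderiv_polyFun_le r (isCompact_closedBall (0 : Space d) σ)
    hint (isCompact_closedBall (0 : Space d) 1)
  refine ⟨C ^ 2, ENNReal.pow_ne_top hC, fun p hp x h hh y hy => ?_⟩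
  obtain ⟨q, hq, hqp⟩ := exists_polyFun_eq_comp_affine p x h
  set w : Space d := h⁻¹ • (y - x) with hw
  have hwy : x + h • w = y := by rw [hw, smul_inv_smul₀ hh.ne', add_sub_cancel]
  have hw1 : w ∈ Metric.closedBall (0 : Space d) 1 := by
    rw [mem_closedBall_zero_iff, hw, norm_smul, norm_inv, Real.norm_of_nonneg hh.le,
      inv_mul_le_iff₀ hh, mul_one]
    exact mem_closedBall_iff_norm.1 hy
  have hfderiv : fderiv ℝ (polyFun p) y = h⁻¹ • fderiv ℝ (polyFun q) w := by
    rw [hqp, fderiv_comp_add_smul, hwy, inv_smul_smul₀ hh.ne']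
  have hscale : eLpNorm (polyFun q) 2 (volume.restrict (Metric.closedBall 0 σ)) ^ 2 ≤
      ENNReal.ofReal ((h ^ d)⁻¹) * ∫⁻ z in Metric.closedBall x (σ * h), ‖polyFun p z‖ₑ ^ 2 := by
    rw [eLpNorm_two_sq, hqp]
    refine (setLIntegral_comp_add_smul_le
      ((contDiff_polyFun p).continuous.enorm.measurable.pow_const 2) measurableSet_closedBall
      measurableSet_closedBall hh fun z hz => ?_).trans_eq (by rw [finrank_euclideanSpace_fin])
    rw [mem_closedBall_iff_norm, add_sub_cancel_left, norm_smul, Real.norm_of_nonneg hh.le,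
      mul_comm]
    gcongr
    exact mem_closedBall_zero_iff.1 hz
  calc ‖fderiv ℝ (polyFun p) y‖ₑ ^ 2
      = ENNReal.ofReal (h⁻¹ ^ 2) * ‖fderiv ℝ (polyFun q) w‖ₑ ^ 2 := by
        rw [hfderiv, enorm_smul, mul_pow, Real.enorm_eq_ofReal (by positivity),
          ENNReal.ofReal_pow (by positivity)]
    _ ≤ ENNReal.ofReal (h⁻¹ ^ 2) *
          (C * eLpNorm (polyFun q) 2 (volume.restrict (Metric.closedBall 0 σ))) ^ 2 := by
        gcongr
        exact hle q (hq.trans hp) w hw1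
    _ ≤ _ := by
        rw [mul_pow, mul_left_comm, ← mul_assoc]
        gcongr

lemma exists_inverse_inequality (d r : ℕ) {σ : ℝ} (hσ : 0 < σ) :
    ∃ C : ENNReal, C ≠ ⊤ ∧ ∀ p : MvPolynomial (Fin d) ℝ, p.totalDegree ≤ r → ∀ (x : Space d)
      (h : ℝ), 0 < h → ∀ s : Set (Space d), MeasurableSet s → Metric.closedBall x (σ * h) ⊆ s →
        s ⊆ Metric.closedBall x h →
        ∫⁻ y in s, ‖fderiv ℝ (polyFun p) y‖ₑ ^ 2 ≤
          C * ENNReal.ofReal (h⁻¹ ^ 2) * ∫⁻ y in s, ‖polyFun p y‖ₑ ^ 2 := by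
  obtain ⟨C, hC, hle⟩ := exists_enorm_fderiv_polyFun_sq_le d r hσ
  set V := volume (Metric.closedBall (0 : Space d) 1)
  refine ⟨C * V, ENNReal.mul_ne_top hC (isCompact_closedBall _ _).measure_ne_top, ?_⟩
  intro p hp x h hh s hs hball hsx
  set I := ∫⁻ y in s, ‖polyFun p y‖ₑ ^ 2
  have hvol : volume s ≤ ENNReal.ofReal (h ^ d) * V := by
    refine (measure_mono hsx).trans_eq ?_
    rw [Measure.addHaar_closedBall' _ _ hh.le, finrank_euclideanSpace_fin]
  have hcancel : ENNReal.ofReal ((h ^ d)⁻¹) * ENNReal.ofReal (h ^ d) = 1 := by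
    rw [← ENNReal.ofReal_mul (by positivity), inv_mul_cancel₀ (by positivity), ENNReal.ofReal_one]
  calc ∫⁻ y in s, ‖fderiv ℝ (polyFun p) y‖ₑ ^ 2
      ≤ ∫⁻ _ in s, C * ENNReal.ofReal (h⁻¹ ^ 2) * (ENNReal.ofReal ((h ^ d)⁻¹) * I) := by
        refine setLIntegral_mono' hs fun _ hy => (hle p hp x h hh _ (hsx hy)).trans ?_
        gcongr
        exact lintegral_mono_set hball
    _ = C * ENNReal.ofReal (h⁻¹ ^ 2) * (ENNReal.ofReal ((h ^ d)⁻¹) * I) * volume s :=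
        setLIntegral_const _ _
    _ ≤ C * ENNReal.ofReal (h⁻¹ ^ 2) * (ENNReal.ofReal ((h ^ d)⁻¹) * I) *
          (ENNReal.ofReal (h ^ d) * V) := by gcongr
    _ = (ENNReal.ofReal ((h ^ d)⁻¹) * ENNReal.ofReal (h ^ d)) *
          (C * V * ENNReal.ofReal (h⁻¹ ^ 2) * I) := by ring
    _ = C * V * ENNReal.ofReal (h⁻¹ ^ 2) * I := by rw [hcancel, one_mul]

/-! ### Geometry of triangulations -/

lemma norm_gradient (u : Space d → ℝ) (x : Space d) : ‖gradient u x‖ = ‖fderiv ℝ u x‖ :=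
  LinearIsometryEquiv.norm_map _ _

lemma enorm_gradient (u : Space d → ℝ) (x : Space d) : ‖gradient u x‖ₑ = ‖fderiv ℝ u x‖ₑ := by
  rw [← ofReal_norm, ← ofReal_norm, norm_gradient]

namespace Triangulation

variable {Ω : Set (Space d)} (T : Triangulation Ω)

/-- The closed simplex spanned by a vertex set. -/
abbrev hull (s : Finset (Space d)) : Set (Space d) := convexHull ℝ (s : Set (Space d))

lemma finite_cells : T.cells.Finite := T.finite.subset fun _ hs => hs.1

/-- The finite set of the elements. -/
def cellFinset : Finset (Finset (Space d)) := T.finite_cells.toFinset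

lemma mem_cellFinset {s : Finset (Space d)} : s ∈ T.cellFinset ↔ s ∈ T.cells :=
  T.finite_cells.mem_toFinset

lemma closure_eq : closure Ω = ⋃ s ∈ T.cellFinset, hull s := by
  rw [← T.space_eq]
  apply subset_antisymm
  · intro x hx
    obtain ⟨s, hs, hxs⟩ := Geometry.SimplicialComplex.mem_space_iff.1 hx
    obtain ⟨t, ht, hst, hcard⟩ := T.pure s hs
    exact mem_biUnion (T.mem_cellFinset.2 ⟨ht, hcard⟩)
      (convexHull_mono (Finset.coe_subset.2 hst) hxs)
  · exact iUnion₂_subset fun s hs =>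
      Geometry.SimplicialComplex.convexHull_subset_space (T.mem_cellFinset.1 hs).1

lemma hull_subset {s : Finset (Space d)} (hs : s ∈ T.cells) : hull s ⊆ closure Ω := by
  rw [T.closure_eq]
  exact subset_biUnion_of_mem (u := fun s : Finset (Space d) => hull s) (T.mem_cellFinset.2 hs)

lemma isCompact_hull (s : Finset (Space d)) : IsCompact (hull s) :=
  s.finite_toSet.isCompact_convexHull ℝ

lemma isClosed_hull (s : Finset (Space d)) : IsClosed (hull s) := (isCompact_hull s).isClosed

lemma volume_hull_inter {s t : Finset (Space d)} (hs : s ∈ T.cells) (ht : t ∈ T.cells)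
    (hst : s ≠ t) : volume (hull s ∩ hull t) = 0 := by
  classical
  refine measure_mono_null (T.complex.inter_subset_convexHull hs.1 ht.1) ?_
  refine measure_mono_null (convexHull_subset_affineSpan _) (Measure.addHaar_affineSubspace _ _ ?_)
  intro htop
  have hind : AffineIndependent ℝ ((↑) : ((s : Set (Space d)) ∩ t : Set (Space d)) → Space d) :=
    (T.complex.indep hs.1).mono (s := (s : Set (Space d)) ∩ t) (t := (s : Set (Space d)))
      inter_subset_left
  have hfin : ((s : Set (Space d)) ∩ t).Finite := s.finite_toSet.subset inter_subset_left
  have : Fintype ((s : Set (Space d)) ∩ t : Set (Space d)) := hfin.fintype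
  have hcard' := hind.affineSpan_eq_top_iff_card_eq_finrank_add_one.1 (by rwa [Subtype.range_coe])
  have hcard : (s ∩ t).card = d + 1 := by
    rw [finrank_euclideanSpace_fin] at hcard'
    rw [← hcard', ← Set.toFinset_card]
    congr 1
    ext x
    simp
  have hinter_left : s ∩ t = s :=
    Finset.eq_of_subset_of_card_le Finset.inter_subset_left (by rw [hcard, hs.2])
  have hinter_right : s ∩ t = t :=
    Finset.eq_of_subset_of_card_le Finset.inter_subset_right (by rw [hcard, ht.2])
  exact hst (hinter_left.symm.trans hinter_right)

lemma disjoint_interior_hull {s t : Finset (Space d)} (hs : s ∈ T.cells) (ht : t ∈ T.cells)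
    (hst : s ≠ t) : Disjoint (interior (hull s)) (interior (hull t)) := by
  rw [Set.disjoint_iff_inter_eq_empty]
  refine (isOpen_interior.inter isOpen_interior).eq_empty_of_measure_zero (μ := volume) ?_
  exact measure_mono_null (inter_subset_inter interior_subset interior_subset)
    (T.volume_hull_inter hs ht hst)

lemma interior_hull_ae_eq (s : Finset (Space d)) : interior (hull s) =ᵐ[volume] hull s :=
  interior_ae_eq_of_null_frontier ((convex_convexHull ℝ _).addHaar_frontier volume)

lemma iUnion_interior_ae_eq (hΩ : volume (frontier Ω) = 0) :
    (⋃ s ∈ T.cellFinset, interior (hull s)) =ᵐ[volume] Ω := by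
  refine EventuallyEq.trans ?_ (closure_ae_eq_of_null_frontier hΩ)
  rw [T.closure_eq]
  exact Filter.EventuallyEq.countable_bUnion T.cellFinset.countable_toSet
    fun s _ => interior_hull_ae_eq s

lemma lintegral_eq_sum (hΩ : volume (frontier Ω) = 0) (F : Space d → ENNReal) :
    ∫⁻ x in Ω, F x = ∑ s ∈ T.cellFinset, ∫⁻ x in interior (hull s), F x := by
  rw [← setLIntegral_congr (T.iUnion_interior_ae_eq hΩ), lintegral_biUnion_finset]
  · intro s hs t ht hst
    exact T.disjoint_interior_hull (T.mem_cellFinset.1 hs) (T.mem_cellFinset.1 ht) hst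
  · exact fun s _ => isOpen_interior.measurableSet

lemma ae_exists_mem_interior (hΩ : volume (frontier Ω) = 0) :
    ∀ᵐ x ∂(volume.restrict Ω), ∃ s ∈ T.cells, x ∈ interior (hull s) := by
  rw [← Measure.restrict_congr_set (T.iUnion_interior_ae_eq hΩ)]
  filter_upwards [ae_restrict_mem (Finset.measurableSet_biUnion _
    fun s _ => isOpen_interior.measurableSet)] with x hx
  simp only [mem_iUnion, exists_prop] at hx
  obtain ⟨s, hs, hxs⟩ := hx
  exact ⟨s, T.mem_cellFinset.1 hs, hxs⟩

lemma diam_hull_le {s : Finset (Space d)} (hs : s ∈ T.cells) : Metric.diam (hull s) ≤ T.meshSize :=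
  le_csSup (T.finite_cells.image _).bddAbove (mem_image_of_mem _ hs)

lemma norm_sub_le {s : Finset (Space d)} (hs : s ∈ T.cells) {x y : Space d} (hx : x ∈ hull s)
    (hy : y ∈ hull s) : ‖x - y‖ ≤ T.meshSize := by
  rw [← dist_eq_norm]
  exact (Metric.dist_le_diam_of_mem (isCompact_hull s).isBounded hx hy).trans (T.diam_hull_le hs)

lemma meshSize_pos (hd : 1 ≤ d) {s : Finset (Space d)} (hs : s ∈ T.cells) : 0 < T.meshSize := by
  obtain ⟨x, hx, y, hy, hxy⟩ := Finset.one_lt_card.1 (show 1 < s.card by rw [hs.2]; omega)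
  exact (norm_pos_iff.2 (sub_ne_zero.2 hxy)).trans_le
    (T.norm_sub_le hs (subset_convexHull ℝ _ hx) (subset_convexHull ℝ _ hy))

lemma volume_closedBall_eq (x : Space d) {r : ℝ} (hr : 0 ≤ r) :
    volume (Metric.closedBall x r) =
      ENNReal.ofReal (r ^ d) * volume (Metric.ball (0 : Space d) 1) := by
  rw [Measure.addHaar_closedBall _ _ hr, finrank_euclideanSpace_fin]

lemma volume_unitBall_ne_zero : volume (Metric.ball (0 : Space d) 1) ≠ 0 :=
  (Metric.measure_ball_pos volume _ one_pos).ne'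

lemma volume_unitBall_ne_top : volume (Metric.ball (0 : Space d) 1) ≠ ⊤ :=
  Metric.isBounded_ball.measure_lt_top.ne

lemma card_le_of_pairwiseDisjoint_ball {ι : Type*} {S : Finset ι} {c : ι → Space d} {ρ R : ℝ}
    (hρ : 0 < ρ) (hR : 0 ≤ R) {x : Space d}
    (hdisj : (S : Set ι).PairwiseDisjoint fun i => Metric.ball (c i) ρ)
    (hx : ∀ i ∈ S, x ∈ Metric.closedBall (c i) R) :
    (S.card : ENNReal) ≤ ENNReal.ofReal (((R + ρ) / ρ) ^ d) := by
  set B := volume (Metric.ball (0 : Space d) 1)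
  have hball : ∀ i, volume (Metric.ball (c i) ρ) = ENNReal.ofReal (ρ ^ d) * B := fun i => by
    rw [Measure.addHaar_ball_of_pos _ _ hρ, finrank_euclideanSpace_fin]
  have hsub : ⋃ i ∈ S, Metric.ball (c i) ρ ⊆ Metric.closedBall x (R + ρ) := by
    refine iUnion₂_subset fun i hi y hy => ?_
    have hxi : dist (c i) x ≤ R := (dist_comm _ _).trans_le (Metric.mem_closedBall.1 (hx i hi))
    have hyi : dist y (c i) < ρ := hy
    exact (dist_triangle y (c i) x).trans (by linarith)
  have hvol : (S.card : ENNReal) * ENNReal.ofReal (ρ ^ d) * B ≤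
      ENNReal.ofReal ((R + ρ) ^ d) * B :=
    calc (S.card : ENNReal) * ENNReal.ofReal (ρ ^ d) * B
        = ∑ i ∈ S, volume (Metric.ball (c i) ρ) := by
          rw [Finset.sum_congr rfl fun i _ => hball i, Finset.sum_const, nsmul_eq_mul, mul_assoc]
      _ = volume (⋃ i ∈ S, Metric.ball (c i) ρ) :=
          (measure_biUnion_finset hdisj fun _ _ => measurableSet_ball).symm
      _ ≤ volume (Metric.closedBall x (R + ρ)) := measure_mono hsub
      _ = ENNReal.ofReal ((R + ρ) ^ d) * B := volume_closedBall_eq x (by positivity)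
  rw [ENNReal.mul_le_mul_iff_left volume_unitBall_ne_zero volume_unitBall_ne_top] at hvol
  have hρd : 0 < ρ ^ d := by positivity
  rwa [div_pow, ENNReal.ofReal_div_of_pos hρd,
    ENNReal.le_div_iff_mul_le (Or.inl (by simpa using hρd)) (Or.inl ENNReal.ofReal_ne_top)]

lemma sum_indicator_ball_le {c : Finset (Space d) → Space d} {σ R h : ℝ} (hσ : 0 < σ) (hR : 0 ≤ R)
    (hh : 0 < h) (hc : ∀ s ∈ T.cells, Metric.closedBall (c s) (σ * h) ⊆ hull s) (x : Space d) :
    ∑ s ∈ T.cellFinset, (Metric.closedBall (c s) (R * h)).indicator (1 : Space d → ENNReal) x ≤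
      ENNReal.ofReal (((R + σ) / σ) ^ d) := by
  classical
  set S := T.cellFinset.filter fun s => x ∈ Metric.closedBall (c s) (R * h) with hS
  have hball : ∀ s ∈ S, Metric.ball (c s) (σ * h) ⊆ interior (hull s) := fun s hs =>
    interior_maximal (Metric.ball_subset_closedBall.trans
      (hc s (T.mem_cellFinset.1 (Finset.mem_filter.1 hs).1))) Metric.isOpen_ball
  have hdisj : (S : Set (Finset (Space d))).PairwiseDisjoint fun s => Metric.ball (c s) (σ * h) :=
    fun s hs t ht hst => (T.disjoint_interior_hull (T.mem_cellFinset.1 (Finset.mem_filter.1 hs).1)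
      (T.mem_cellFinset.1 (Finset.mem_filter.1 ht).1) hst).mono (hball s hs) (hball t ht)
  calc ∑ s ∈ T.cellFinset, (Metric.closedBall (c s) (R * h)).indicator (1 : Space d → ENNReal) x
      = S.card := by
        rw [hS, Finset.card_filter]
        push_cast
        exact Finset.sum_congr rfl fun s _ => indicator_apply _ _ _
    _ ≤ ENNReal.ofReal (((R * h + σ * h) / (σ * h)) ^ d) :=
        card_le_of_pairwiseDisjoint_ball (by positivity) (by positivity) hdisj
          fun s hs => (Finset.mem_filter.1 hs).2
    _ = ENNReal.ofReal (((R + σ) / σ) ^ d) := by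
        rw [← add_mul, mul_div_mul_right _ _ hh.ne']

lemma sum_lintegral_ball_le {c : Finset (Space d) → Space d} {σ R h : ℝ} (hσ : 0 < σ) (hR : 0 ≤ R)
    (hh : 0 < h) (hc : ∀ s ∈ T.cells, Metric.closedBall (c s) (σ * h) ⊆ hull s)
    {F : Space d → ENNReal} (hF : AEMeasurable F (volume.restrict Ω)) :
    ∑ s ∈ T.cellFinset, ∫⁻ x in Metric.closedBall (c s) (R * h) ∩ Ω, F x ≤
      ENNReal.ofReal (((R + σ) / σ) ^ d) * ∫⁻ x in Ω, F x := by
  have hindicator : ∀ s, ∫⁻ x in Metric.closedBall (c s) (R * h) ∩ Ω, F x =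
      ∫⁻ x in Ω, (Metric.closedBall (c s) (R * h)).indicator (1 : Space d → ENNReal) x * F x := by
    intro s
    rw [← Measure.restrict_restrict measurableSet_closedBall,
      ← lintegral_indicator measurableSet_closedBall]
    congr 1
    funext x
    by_cases hx : x ∈ Metric.closedBall (c s) (R * h) <;> simp [hx]
  simp_rw [hindicator]
  have hmeas : ∀ s ∈ T.cellFinset, AEMeasurable (fun x =>
      (Metric.closedBall (c s) (R * h)).indicator (1 : Space d → ENNReal) x * F x)
      (volume.restrict Ω) := fun s _ =>
    (measurable_one.indicator measurableSet_closedBall).aemeasurable.mul hF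
  rw [← lintegral_finsetSum' _ hmeas, ← lintegral_const_mul' _ _ ENNReal.ofReal_ne_top]
  refine lintegral_mono fun x => ?_
  simp only [← Finset.sum_mul]
  gcongr
  exact T.sum_indicator_ball_le hσ hR hh hc x

/-! ### Finite element functions -/

variable {T} {r : ℕ} {v w : Space d → ℝ}

lemma W.exists_poly (hv : v ∈ T.W r) {s : Finset (Space d)} (hs : s ∈ T.cells) :
    ∃ p : MvPolynomial (Fin d) ℝ, p.totalDegree ≤ r ∧ EqOn v (polyFun p) (hull s) := hv.2 s hs

lemma W.sub_mem (hv : v ∈ T.W r) (hw : w ∈ T.W r) : (fun x => v x - w x) ∈ T.W r := by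
  refine ⟨hv.1.sub hw.1, fun s hs => ?_⟩
  obtain ⟨p, hp, hvp⟩ := hv.2 s hs
  obtain ⟨q, hq, hwq⟩ := hw.2 s hs
  exact ⟨p - q, (MvPolynomial.totalDegree_sub _ _).trans (max_le hp hq), fun x hx => by
    simp [hvp x hx, hwq x hx]⟩

lemma W.zero_mem : (fun _ => 0) ∈ T.W r :=
  ⟨continuousOn_const, fun _ _ => ⟨0, by simp, fun x _ => by simp⟩⟩

lemma W₀.zero_mem : (fun _ => 0) ∈ T.W₀ r := ⟨W.zero_mem, fun _ _ => rfl⟩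

lemma W.memLp (hΩ : IsOpen Ω) (hb : Bornology.IsBounded Ω) (hv : v ∈ T.W r) (p : ENNReal) :
    MemLp v p (volume.restrict Ω) := by
  have hK : IsCompact (closure Ω) := hb.isCompact_closure
  obtain ⟨M, hM⟩ := hK.exists_bound_of_continuousOn hv.1
  have : IsFiniteMeasure (volume.restrict Ω) := ⟨by simpa using hb.measure_lt_top⟩
  exact MemLp.of_bound ((hv.1.mono subset_closure).aestronglyMeasurable hΩ.measurableSet) M
    ((ae_restrict_mem hΩ.measurableSet).mono fun x hx => hM x (subset_closure hx))

lemma eventuallyEq_of_eqOn {s : Set (Space d)} {x : Space d} {p : Space d → ℝ}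
    (h : EqOn v p s) (hx : x ∈ interior s) : v =ᶠ[𝓝 x] p :=
  (eventually_mem_nhds_iff.2 (mem_interior_iff_mem_nhds.1 hx)).mono fun _ hy =>
    h (mem_of_mem_nhds hy)

lemma W.ae_differentiableAt (hΩ : volume (frontier Ω) = 0) (hv : v ∈ T.W r) :
    ∀ᵐ x ∂(volume.restrict Ω), DifferentiableAt ℝ v x := by
  filter_upwards [T.ae_exists_mem_interior hΩ] with x hx
  obtain ⟨s, hs, hxs⟩ := hx
  obtain ⟨p, -, hp⟩ := W.exists_poly hv hs
  exact ((differentiable_polyFun p) x).congr_of_eventuallyEq (eventuallyEq_of_eqOn hp hxs)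

lemma W.exists_norm_gradient_le (hv : v ∈ T.W r) :
    ∃ M : ℝ, ∀ s ∈ T.cells, ∀ x ∈ interior (hull s), ‖gradient v x‖ ≤ M := by
  have hcell : ∀ s ∈ T.cells, ∃ M : ℝ, ∀ x ∈ interior (hull s), ‖gradient v x‖ ≤ M := by
    intro s hs
    obtain ⟨p, -, hp⟩ := W.exists_poly hv hs
    obtain ⟨M, hM⟩ := (isCompact_hull s).exists_bound_of_continuousOn
      ((contDiff_polyFun p).continuous_fderiv (by simp)).continuousOn
    refine ⟨M, fun x hx => ?_⟩
    rw [norm_gradient, (eventuallyEq_of_eqOn hp hx).fderiv_eq]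
    exact hM x (interior_subset hx)
  choose! M hM using hcell
  obtain ⟨B, hB⟩ := (T.finite_cells.image M).bddAbove
  exact ⟨B, fun s hs x hx => (hM s hs x hx).trans (hB (mem_image_of_mem M hs))⟩

lemma measurable_gradient (u : Space d → ℝ) : Measurable (gradient u) :=
  (InnerProductSpace.toDual ℝ (Space d)).symm.continuous.measurable.comp (measurable_fderiv ℝ u)

lemma W.memLp_gradient (hΩ : volume (frontier Ω) = 0) (hb : Bornology.IsBounded Ω)
    (hv : v ∈ T.W r) (p : ENNReal) : MemLp (gradient v) p (volume.restrict Ω) := by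
  have : IsFiniteMeasure (volume.restrict Ω) := ⟨by simpa using hb.measure_lt_top⟩
  obtain ⟨M, hM⟩ := W.exists_norm_gradient_le hv
  refine MemLp.of_bound (measurable_gradient v).aestronglyMeasurable M ?_
  filter_upwards [T.ae_exists_mem_interior hΩ] with x hx
  obtain ⟨s, hs, hxs⟩ := hx
  exact hM s hs x hxs

/-! ### Interpolation by piecewise affine functions -/

lemma exists_affine_interpolant {s : Finset (Space d)} (hs : s ∈ T.cells) (m : Space d → ℝ) :
    ∃ A : Space d →ᵃ[ℝ] ℝ, ∀ z ∈ s, A z = m z := by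
  have hind := T.complex.indep hs.1
  have htop : affineSpan ℝ (range ((↑) : s → Space d)) = ⊤ :=
    hind.affineSpan_eq_top_iff_card_eq_finrank_add_one.2 (by simp [hs.2])
  let b : AffineBasis s ℝ (Space d) := ⟨(↑), hind, htop⟩
  let L : (s → ℝ) →ₗ[ℝ] ℝ := ∑ i : s, m i • LinearMap.proj i
  refine ⟨L.toAffineMap.comp b.coords, fun z hz => ?_⟩
  have hcoord : ∀ i : s, b.coord i z = if i = ⟨z, hz⟩ then 1 else 0 := fun i =>
    b.coord_apply i ⟨z, hz⟩
  simp [L, hcoord]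

lemma exists_poly_of_affine (A : Space d →ᵃ[ℝ] ℝ) :
    ∃ p : MvPolynomial (Fin d) ℝ, p.totalDegree ≤ 1 ∧ polyFun p = A := by
  refine ⟨MvPolynomial.C (A 0) + ∑ i, MvPolynomial.C (A.linear (EuclideanSpace.single i 1)) *
    MvPolynomial.X i, ?_, funext fun x => ?_⟩
  · refine (MvPolynomial.totalDegree_add _ _).trans (max_le (by simp) ?_)
    refine MvPolynomial.totalDegree_finsetSum_le fun i _ => ?_
    exact (MvPolynomial.totalDegree_mul _ _).trans (by simp)
  · have hdecomp : A x = A.linear x + A 0 := congrFun (AffineMap.decomp A) x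
    have hbasis : x = ∑ i, x i • (EuclideanSpace.single i (1 : ℝ) : Space d) := by
      ext j
      simp [Pi.single_apply]
    rw [hdecomp]
    conv_rhs => rw [hbasis, map_sum]
    simp [polyFun_apply, mul_comm, add_comm]

lemma affineMap_eqOn_inter_hull {s t : Finset (Space d)} (hs : s ∈ T.cells) (ht : t ∈ T.cells)
    {A B : Space d →ᵃ[ℝ] ℝ} {m : Space d → ℝ} (hA : ∀ z ∈ s, A z = m z) (hB : ∀ z ∈ t, B z = m z) :
    EqOn A B (hull s ∩ hull t) := by
  have hconv : Convex ℝ {x | A x = B x} := by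
    have hpre : {x | A x = B x} = (A - B) ⁻¹' {0} := by
      ext x
      simp [sub_eq_zero]
    rw [hpre]
    exact (convex_singleton _).affine_preimage _
  exact fun x hx => convexHull_min (fun z hz => (hA z hz.1).trans (hB z hz.2).symm) hconv
    (T.complex.inter_subset_convexHull hs.1 ht.1 hx)

lemma continuousOn_closure_of_hull
    (hv : ∀ s ∈ T.cells, ContinuousOn v (hull s)) : ContinuousOn v (closure Ω) := by
  have hlf : LocallyFinite fun s : T.cellFinset => hull (s : Finset (Space d)) :=
    locallyFinite_of_finite _
  have hcont := hlf.continuousOn_iUnion (g := v) (fun s => isClosed_hull _)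
    fun s => hv s (T.mem_cellFinset.1 s.2)
  rwa [iUnion_subtype, ← T.closure_eq] at hcont

lemma exists_interpolant (hr : 1 ≤ r) (m : Space d → ℝ) :
    ∃ v ∈ T.W r, ∀ s ∈ T.cells, ∃ A : Space d →ᵃ[ℝ] ℝ, (∀ z ∈ s, A z = m z) ∧
      EqOn v A (hull s) := by
  classical
  have hex : ∀ s ∈ T.cells, ∃ A : Space d →ᵃ[ℝ] ℝ, ∀ z ∈ s, A z = m z := fun s hs =>
    exists_affine_interpolant hs m
  choose! A hA using hex
  set v : Space d → ℝ := fun x =>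
    if h : ∃ s ∈ T.cells, x ∈ hull s then A h.choose x else 0 with hv
  have hvA : ∀ s ∈ T.cells, EqOn v (A s) (hull s) := by
    intro s hs x hx
    have hex : ∃ s ∈ T.cells, x ∈ hull s := ⟨s, hs, hx⟩
    obtain ⟨hcell, hmem⟩ := hex.choose_spec
    simp only [hv, dif_pos hex]
    exact affineMap_eqOn_inter_hull hcell hs (hA _ hcell) (hA s hs) ⟨hmem, hx⟩
  refine ⟨v, ⟨continuousOn_closure_of_hull (T := T) fun s hs => ?_, fun s hs => ?_⟩,
    fun s hs => ⟨A s, hA s hs, hvA s hs⟩⟩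
  · exact (AffineMap.continuous_of_finiteDimensional (A s)).continuousOn.congr (hvA s hs)
  · obtain ⟨p, hp, hpA⟩ := exists_poly_of_affine (A s)
    exact ⟨p, hp.trans hr, fun x hx => (hvA s hs hx).trans (congrFun hpA x).symm⟩

end Triangulation

/-! ### Stability of the projection in `H¹` -/

lemma enorm_add_sq_le {F : Type*} [NormedAddCommGroup F] (a b : F) :
    ‖a + b‖ₑ ^ 2 ≤ 2 * ‖a‖ₑ ^ 2 + 2 * ‖b‖ₑ ^ 2 := by
  have h : ‖a + b‖₊ ^ 2 ≤ 2 * ‖a‖₊ ^ 2 + 2 * ‖b‖₊ ^ 2 := by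
    rw [← mul_add]
    exact (pow_le_pow_left' (nnnorm_add_le a b) 2).trans add_sq_le
  simp only [enorm_eq_nnnorm]
  exact_mod_cast h

lemma lintegral_enorm_sq_eq {X : Type*} [MeasurableSpace X] {μ : Measure X} {u : X → ℝ}
    (hu : MemLp u 2 μ) : ∫⁻ x, ‖u x‖ₑ ^ 2 ∂μ = ENNReal.ofReal (∫ x, u x ^ 2 ∂μ) := by
  rw [ofReal_integral_eq_lintegral_ofReal hu.integrable_sq
    (Eventually.of_forall fun x => sq_nonneg _)]
  refine lintegral_congr fun x => ?_
  rw [← ofReal_norm, ← ENNReal.ofReal_pow (norm_nonneg _), Real.norm_eq_abs, sq_abs]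

namespace IsL2Projection

variable {Ω : Set (Space d)} {V : Set (Space d → ℝ)} {u v w : Space d → ℝ}

lemma integral_sub_mul_eq_zero (h : IsL2Projection Ω V u v) (hw : w ∈ V)
    (hu : MemLp u 2 (volume.restrict Ω)) (hv : MemLp v 2 (volume.restrict Ω))
    (hwL : MemLp w 2 (volume.restrict Ω)) : ∫ x in Ω, (u x - v x) * w x = 0 := by
  have huw : Integrable (fun x => u x * w x) (volume.restrict Ω) := hu.integrable_mul hwL
  have hvw : Integrable (fun x => v x * w x) (volume.restrict Ω) := hv.integrable_mul hwL
  simp_rw [sub_mul]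
  rw [integral_sub huw hvw, h.2 w hw, sub_self]

lemma pythagoras (h : IsL2Projection Ω V u v) (hvw : (fun x => v x - w x) ∈ V)
    (hu : MemLp u 2 (volume.restrict Ω)) (hv : MemLp v 2 (volume.restrict Ω))
    (hw : MemLp w 2 (volume.restrict Ω)) :
    ∫⁻ x in Ω, ‖u x - w x‖ₑ ^ 2 =
      (∫⁻ x in Ω, ‖u x - v x‖ₑ ^ 2) + ∫⁻ x in Ω, ‖v x - w x‖ₑ ^ 2 := by
  have huv : MemLp (fun x => u x - v x) 2 (volume.restrict Ω) := hu.sub hv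
  have hvw' : MemLp (fun x => v x - w x) 2 (volume.restrict Ω) := hv.sub hw
  have huw : MemLp (fun x => u x - w x) 2 (volume.restrict Ω) := hu.sub hw
  have hsum : Integrable (fun x => (u x - v x) ^ 2 + (v x - w x) ^ 2) (volume.restrict Ω) :=
    huv.integrable_sq.add hvw'.integrable_sq
  have hcross : Integrable (fun x => (u x - v x) * (v x - w x)) (volume.restrict Ω) :=
    huv.integrable_mul hvw'
  rw [lintegral_enorm_sq_eq huv, lintegral_enorm_sq_eq hvw', lintegral_enorm_sq_eq huw,
    ← ENNReal.ofReal_add (integral_nonneg fun x => sq_nonneg _)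
      (integral_nonneg fun x => sq_nonneg _)]
  congr 1
  calc ∫ x in Ω, (u x - w x) ^ 2
      = ∫ x in Ω, ((u x - v x) ^ 2 + (v x - w x) ^ 2) + 2 * ((u x - v x) * (v x - w x)) :=
        integral_congr_ae (Eventually.of_forall fun x => by ring)
    _ = (∫ x in Ω, (u x - v x) ^ 2) + ∫ x in Ω, (v x - w x) ^ 2 := by
        rw [integral_add hsum (hcross.const_mul 2),
          integral_const_mul, h.integral_sub_mul_eq_zero hvw hu hv hvw', mul_zero, add_zero,
          integral_add huv.integrable_sq hvw'.integrable_sq]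

end IsL2Projection

lemma enorm_sub_affineMap_sq_le {s : Finset (Space d)} (A : Space d →ᵃ[ℝ] ℝ) (a : ℝ) {x : Space d}
    (hx : x ∈ convexHull ℝ (s : Set (Space d))) : ‖a - A x‖ₑ ^ 2 ≤ ∑ z ∈ s, ‖a - A z‖ₑ ^ 2 := by
  have hconv : ConvexOn ℝ univ fun y : Space d => ‖a - A y‖ := by
    simpa [Function.comp_def] using
      (convexOn_univ_norm (E := ℝ)).comp_affineMap (AffineMap.const ℝ (Space d) a - A)
  obtain ⟨z, hz : z ∈ s, hle⟩ :=
    hconv.exists_ge_of_mem_convexHull (subset_univ (s : Set (Space d))) hx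
  calc ‖a - A x‖ₑ ^ 2 ≤ ‖a - A z‖ₑ ^ 2 := by
        rw [← ofReal_norm, ← ofReal_norm]
        gcongr
    _ ≤ ∑ z ∈ s, ‖a - A z‖ₑ ^ 2 :=
        Finset.single_le_sum (f := fun z => ‖a - A z‖ₑ ^ 2) (fun _ _ => zero_le) hz

/-- The constant in the Poincaré inequality on a patch whose ball has its center at distance at most
`k h` from the simplex. -/
def patchConst (d : ℕ) (k : ℝ) : ENNReal :=
  ENNReal.ofReal ((2 * (k + 1)) ^ 2 * 2 ^ d * (k + 1) ^ d)

lemma lintegral_sub_average_ball_le {Ω S : Set (Space d)} {z b : Space d} {k h : ℝ} (hk : 0 ≤ k)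
    (hh : 0 < h) (hΩ : MeasurableSet Ω) (hS : Convex ℝ S) (hSΩ : S ⊆ closure Ω) (hz : z ∈ S)
    (hSz : ∀ x ∈ S, ‖x - z‖ ≤ h) (hbz : ‖b - z‖ ≤ k * h) (hsees : SeesBall Ω z b h)
    {u : Space d → ℝ} {G : Space d → Space d} (hu : MemLp u 2 (volume.restrict Ω))
    (hG : IsWeakGradient Ω u G) :
    ∫⁻ x in interior S, ‖u x - ⨍ y in Metric.ball b h, u y‖ₑ ^ 2 ≤
      patchConst d k * ENNReal.ofReal (h ^ 2) *
        ∫⁻ x in Metric.closedBall z ((k + 1) * h) ∩ Ω, ‖G x‖ₑ ^ 2 := by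
  set D := patch S b h
  set A := volume (Metric.ball b h) with hA
  set I := ∫⁻ x in Metric.closedBall z ((k + 1) * h) ∩ Ω, ‖G x‖ₑ ^ 2
  have hA0 : A ≠ 0 := (Metric.measure_ball_pos volume _ hh).ne'
  have hA1 : A ≠ ⊤ := Metric.isBounded_ball.measure_lt_top.ne
  have hDΩ : D ⊆ Ω := patch_subset hSΩ hSz hsees
  have hDz : D ⊆ Metric.closedBall z ((k + 1) * h) := fun p hp =>
    mem_closedBall_iff_norm.2 (norm_sub_le_of_mem_patch hk hh.le hSz hbz hp)
  have hdiam : Metric.ediam D ≤ ENNReal.ofReal (2 * (k + 1) * h) := by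
    refine Metric.ediam_le_of_forall_dist_le fun x hx y hy => ?_
    linarith [dist_triangle_right x y z, Metric.mem_closedBall.1 (hDz hx),
      Metric.mem_closedBall.1 (hDz hy)]
  have hvol : volume D ≤ ENNReal.ofReal ((k + 1) ^ d) * A := by
    refine (measure_mono hDz).trans_eq ?_
    rw [hA, Measure.addHaar_ball_of_pos _ _ hh, finrank_euclideanSpace_fin,
      Triangulation.volume_closedBall_eq z (by positivity), mul_pow,
      ENNReal.ofReal_mul (by positivity), mul_assoc]
  calc ∫⁻ x in interior S, ‖u x - ⨍ y in Metric.ball b h, u y‖ₑ ^ 2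
      ≤ ∫⁻ x in D, ‖u x - ⨍ y in Metric.ball b h, u y‖ₑ ^ 2 :=
        lintegral_mono_set (interior_subset_patch hh)
    _ ≤ A⁻¹ * (Metric.ediam D ^ 2 * (2 ^ d * volume D * ∫⁻ x in D, ‖G x‖ₑ ^ 2)) :=
        lintegral_sub_average_le isOpen_patch (convex_patch hS)
          (hu.mono_measure (Measure.restrict_mono hDΩ le_rfl)) (hG.mono hΩ hDΩ)
          (ball_subset_patch ⟨z, hz⟩) hA0 hA1
    _ ≤ A⁻¹ * (ENNReal.ofReal (2 * (k + 1) * h) ^ 2 *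
          (2 ^ d * (ENNReal.ofReal ((k + 1) ^ d) * A) * I)) := by
        gcongr
        exact lintegral_mono_set (subset_inter hDz hDΩ)
    _ = (A⁻¹ * A) * (ENNReal.ofReal (2 * (k + 1) * h) ^ 2 * 2 ^ d *
          ENNReal.ofReal ((k + 1) ^ d) * I) := by ring
    _ = patchConst d k * ENNReal.ofReal (h ^ 2) * I := by
        rw [ENNReal.inv_mul_cancel hA0 hA1, one_mul, patchConst,
          ← ENNReal.ofReal_pow (by positivity), mul_pow, ENNReal.ofReal_mul (by positivity),
          ENNReal.ofReal_mul (by positivity), ENNReal.ofReal_mul (by positivity),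
          ENNReal.ofReal_pow (by norm_num : (0 : ℝ) ≤ 2) d, ENNReal.ofReal_ofNat]
        ring

namespace Triangulation

variable {Ω : Set (Space d)}

/-- Each element is contained in a ball of radius `h` and contains the concentric ball of radius
`σ h`; the common center is `c s`. -/
def IsCenters (T : Triangulation Ω) (σ : ℝ) (c : Finset (Space d) → Space d) : Prop :=
  ∀ s ∈ T.cells, Metric.closedBall (c s) (σ * T.meshSize) ⊆ hull s ∧
    hull s ⊆ Metric.closedBall (c s) T.meshSize

/-- Each point `z` of the closure sees, in `Ω`, the ball of radius `h` about `b z`, which lies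
at distance at most `k h`. -/
def IsBallChoice (T : Triangulation Ω) (k : ℝ) (b : Space d → Space d) : Prop :=
  ∀ z ∈ closure Ω, ‖b z - z‖ ≤ k * T.meshSize ∧ SeesBall Ω z (b z) T.meshSize

variable {T : Triangulation Ω} {r : ℕ} {σ k : ℝ} {c : Finset (Space d) → Space d}
  {b : Space d → Space d} {u v : Space d → ℝ} {G : Space d → Space d}

lemma QuasiUniform.exists_isCenters (hd : 1 ≤ d) (hσ : 0 < σ) (hT : T.QuasiUniform σ) :
    ∃ c, T.IsCenters σ c := by
  choose! c hc using hT
  refine ⟨c, fun s hs => ⟨hc s hs, fun x hx => ?_⟩⟩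
  have hpos := T.meshSize_pos hd hs
  rw [mem_closedBall_iff_norm]
  exact T.norm_sub_le hs hx (hc s hs (Metric.mem_closedBall_self (by positivity)))

lemma restrict_interior_hull_le (hΩ : volume (frontier Ω) = 0) {s : Finset (Space d)}
    (hs : s ∈ T.cells) : volume.restrict (interior (hull s)) ≤ volume.restrict Ω :=
  (Measure.restrict_mono (interior_subset.trans (T.hull_subset hs)) le_rfl).trans_eq
    (Measure.restrict_congr_set (closure_ae_eq_of_null_frontier hΩ))

lemma exists_lintegral_gradient_le (d r : ℕ) {σ : ℝ} (hσ : 0 < σ) :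
    ∃ C : ENNReal, C ≠ ⊤ ∧ ∀ {Ω : Set (Space d)} {T : Triangulation Ω}, 1 ≤ d →
      ∀ c, T.IsCenters σ c → ∀ v ∈ T.W r, ∀ s ∈ T.cells, ∀ m : ℝ,
        ∫⁻ x in interior (hull s), ‖gradient v x‖ₑ ^ 2 ≤ C * ENNReal.ofReal (T.meshSize⁻¹ ^ 2) *
          ∫⁻ x in interior (hull s), ‖v x - m‖ₑ ^ 2 := by
  obtain ⟨C, hC, hinv⟩ := exists_inverse_inequality d r hσ
  refine ⟨C, hC, fun {Ω T} hd c hc v hv s hs m => ?_⟩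
  obtain ⟨p, hp, hvp⟩ := W.exists_poly hv hs
  have hdeg : (p - MvPolynomial.C m).totalDegree ≤ r :=
    (MvPolynomial.totalDegree_sub _ _).trans (max_le hp (by simp))
  have hq : polyFun (p - MvPolynomial.C m) = fun x => polyFun p x - m := by
    rw [map_sub, polyFun_C]
    rfl
  have hle := hinv (p - MvPolynomial.C m) hdeg (c s) T.meshSize (T.meshSize_pos hd hs) (hull s)
    (isClosed_hull s).measurableSet (hc s hs).1 (hc s hs).2
  rw [hq, ← setLIntegral_congr (interior_hull_ae_eq s),
    ← setLIntegral_congr (interior_hull_ae_eq s)] at hle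
  convert hle using 1
  · refine setLIntegral_congr_fun isOpen_interior.measurableSet fun x hx => ?_
    rw [enorm_gradient, (eventuallyEq_of_eqOn hvp hx).fderiv_eq, fderiv_sub_const]
  · congr 1
    refine setLIntegral_congr_fun isOpen_interior.measurableSet fun x hx => ?_
    rw [hvp (interior_subset hx)]

lemma exists_lintegral_gradient_le_sum (d r : ℕ) {σ : ℝ} (hσ : 0 < σ) :
    ∃ C : ENNReal, C ≠ ⊤ ∧ ∀ {Ω : Set (Space d)} {T : Triangulation Ω}, 1 ≤ d →
      volume (frontier Ω) = 0 → ∀ c, T.IsCenters σ c → ∀ v ∈ T.W r,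
        ∀ m : Finset (Space d) → ℝ,
        ∫⁻ x in Ω, ‖gradient v x‖ₑ ^ 2 ≤ C * ENNReal.ofReal (T.meshSize⁻¹ ^ 2) *
          ∑ s ∈ T.cellFinset, ∫⁻ x in interior (hull s), ‖v x - m s‖ₑ ^ 2 := by
  obtain ⟨C, hC, hinv⟩ := exists_lintegral_gradient_le d r hσ
  refine ⟨C, hC, fun {Ω T} hd hΩ c hc v hv m => ?_⟩
  rw [T.lintegral_eq_sum hΩ, Finset.mul_sum]
  exact Finset.sum_le_sum fun s hs => hinv hd c hc v hv s (T.mem_cellFinset.1 hs) (m s)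

lemma W.gradient_eq_zero (hv : v ∈ T.W 0) {s : Finset (Space d)}
    (hs : s ∈ T.cells) {x : Space d} (hx : x ∈ interior (hull s)) : gradient v x = 0 := by
  obtain ⟨p, hp, hvp⟩ := W.exists_poly hv hs
  rw [MvPolynomial.totalDegree_eq_zero_iff_eq_C.1 (Nat.le_zero.1 hp), polyFun_C] at hvp
  rw [← norm_eq_zero, norm_gradient, (eventuallyEq_of_eqOn hvp hx).fderiv_eq]
  simp

lemma lintegral_sub_nodal_le (hΩ : MeasurableSet Ω) (hd : 1 ≤ d) (hk : 0 ≤ k)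
    (hc : T.IsCenters σ c) (hb : T.IsBallChoice k b) (hu : MemLp u 2 (volume.restrict Ω))
    (hG : IsWeakGradient Ω u G) {s : Finset (Space d)} (hs : s ∈ T.cells) {z : Space d}
    (hz : z ∈ s) :
    ∫⁻ x in interior (hull s), ‖u x - ⨍ y in Metric.ball (b z) T.meshSize, u y‖ₑ ^ 2 ≤
      patchConst d k * ENNReal.ofReal (T.meshSize ^ 2) *
        ∫⁻ x in Metric.closedBall (c s) ((k + 2) * T.meshSize) ∩ Ω, ‖G x‖ₑ ^ 2 := by
  have hzs : z ∈ hull s := subset_convexHull ℝ _ hz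
  obtain ⟨hbz, hsees⟩ := hb z (T.hull_subset hs hzs)
  refine (lintegral_sub_average_ball_le hk (T.meshSize_pos hd hs) hΩ (convex_convexHull ℝ _)
    (T.hull_subset hs) hzs (fun x hx => T.norm_sub_le hs hx hzs) hbz hsees hu hG).trans ?_
  gcongr
  refine Metric.closedBall_subset_closedBall' ?_
  linarith [Metric.mem_closedBall.1 ((hc s hs).2 hzs)]

lemma sum_lintegral_sub_nodal_le (hΩ : MeasurableSet Ω) (hd : 1 ≤ d) (hk : 0 ≤ k) (hσ : 0 < σ)
    (hh : 0 < T.meshSize) (hc : T.IsCenters σ c) (hb : T.IsBallChoice k b)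
    (hu : MemLp u 2 (volume.restrict Ω)) (hG : IsWeakGradient Ω u G)
    {z : Finset (Space d) → Space d} (hz : ∀ s ∈ T.cells, z s ∈ s) :
    ∑ s ∈ T.cellFinset,
        ∫⁻ x in interior (hull s), ‖u x - ⨍ y in Metric.ball (b (z s)) T.meshSize, u y‖ₑ ^ 2 ≤
      patchConst d k * ENNReal.ofReal (((k + 2 + σ) / σ) ^ d) * ENNReal.ofReal (T.meshSize ^ 2) *
        ∫⁻ x in Ω, ‖G x‖ₑ ^ 2 := by
  have hoverlap := T.sum_lintegral_ball_le (R := k + 2) hσ (by positivity) hh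
    (fun s hs => (hc s hs).1) (hG.1.1.enorm.pow_const 2)
  calc _ ≤ ∑ s ∈ T.cellFinset, patchConst d k * ENNReal.ofReal (T.meshSize ^ 2) *
          ∫⁻ x in Metric.closedBall (c s) ((k + 2) * T.meshSize) ∩ Ω, ‖G x‖ₑ ^ 2 :=
        Finset.sum_le_sum fun s hs => lintegral_sub_nodal_le hΩ hd hk hc hb hu hG
          (T.mem_cellFinset.1 hs) (hz s (T.mem_cellFinset.1 hs))
    _ ≤ patchConst d k * ENNReal.ofReal (T.meshSize ^ 2) *
          (ENNReal.ofReal (((k + 2 + σ) / σ) ^ d) * ∫⁻ x in Ω, ‖G x‖ₑ ^ 2) := by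
        rw [← Finset.mul_sum]
        gcongr
    _ = _ := by ring

lemma exists_lintegral_sub_affine_le (hΩ : volume (frontier Ω) = 0)
    (hu : MemLp u 2 (volume.restrict Ω)) {s : Finset (Space d)} (hs : s ∈ T.cells)
    {A : Space d →ᵃ[ℝ] ℝ} (hvA : EqOn v A (hull s)) :
    ∃ z ∈ s, ∫⁻ x in interior (hull s), ‖u x - v x‖ₑ ^ 2 ≤
      (d + 1) * ∫⁻ x in interior (hull s), ‖u x - A z‖ₑ ^ 2 := by
  set J : Space d → ENNReal := fun z => ∫⁻ x in interior (hull s), ‖u x - A z‖ₑ ^ 2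
  obtain ⟨z, hz, hmax⟩ :=
    s.exists_max_image J (Geometry.SimplicialComplex.nonempty_of_mem_faces hs.1)
  have huJ := hu.1.mono_measure (restrict_interior_hull_le hΩ hs)
  refine ⟨z, hz, ?_⟩
  calc ∫⁻ x in interior (hull s), ‖u x - v x‖ₑ ^ 2
      ≤ ∫⁻ x in interior (hull s), ∑ z ∈ s, ‖u x - A z‖ₑ ^ 2 := by
        refine setLIntegral_mono' isOpen_interior.measurableSet fun x hx => ?_
        rw [hvA (interior_subset hx)]
        exact enorm_sub_affineMap_sq_le A (u x) (interior_subset hx)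
    _ = ∑ z ∈ s, J z := lintegral_finsetSum' _ fun z _ =>
        (huJ.sub aestronglyMeasurable_const).enorm.pow_const 2
    _ ≤ s.card • J z := Finset.sum_le_card_nsmul _ _ _ hmax
    _ = (d + 1) * J z := by
        rw [hs.2, nsmul_eq_mul]
        push_cast
        rfl

/-- The constant in the error estimate for the quasi-interpolant. -/
def interpConst (d : ℕ) (σ k : ℝ) : ENNReal :=
  patchConst d k * ENNReal.ofReal (((k + 2 + σ) / σ) ^ d)

-- The nodal values of the quasi-interpolant `w` are the means of `u` over the balls seen from the
-- nodes, and `m s` is its value at a suitable vertex of `s`.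
lemma exists_quasiInterpolant (hΩ : MeasurableSet Ω) (hΩ0 : volume (frontier Ω) = 0) (hd : 1 ≤ d)
    (hr : 1 ≤ r) (hk : 0 ≤ k) (hσ : 0 < σ) (hh : 0 < T.meshSize) (hc : T.IsCenters σ c)
    (hb : T.IsBallChoice k b) (hu : MemLp u 2 (volume.restrict Ω)) (hG : IsWeakGradient Ω u G) :
    ∃ w ∈ T.W r, ∃ m : Finset (Space d) → ℝ,
      ∑ s ∈ T.cellFinset, ∫⁻ x in interior (hull s), ‖u x - m s‖ₑ ^ 2 ≤
          interpConst d σ k * ENNReal.ofReal (T.meshSize ^ 2) * ∫⁻ x in Ω, ‖G x‖ₑ ^ 2 ∧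
        ∫⁻ x in Ω, ‖u x - w x‖ₑ ^ 2 ≤ (d + 1) *
          (interpConst d σ k * ENNReal.ofReal (T.meshSize ^ 2) * ∫⁻ x in Ω, ‖G x‖ₑ ^ 2) := by
  set mean : Space d → ℝ := fun z => ⨍ y in Metric.ball (b z) T.meshSize, u y
  obtain ⟨w, hwW, hw⟩ := exists_interpolant (T := T) hr mean
  have hvertex : ∀ s ∈ T.cells, ∃ z ∈ s, ∫⁻ x in interior (hull s), ‖u x - w x‖ₑ ^ 2 ≤
      (d + 1) * ∫⁻ x in interior (hull s), ‖u x - mean z‖ₑ ^ 2 := by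
    intro s hs
    obtain ⟨A, hA, hwA⟩ := hw s hs
    obtain ⟨z, hz, hle⟩ := exists_lintegral_sub_affine_le hΩ0 hu hs hwA
    exact ⟨z, hz, by rwa [hA z hz] at hle⟩
  choose! z hz hle using hvertex
  have hsum := sum_lintegral_sub_nodal_le hΩ hd hk hσ hh hc hb hu hG hz
  refine ⟨w, hwW, fun s => mean (z s), hsum, ?_⟩
  calc ∫⁻ x in Ω, ‖u x - w x‖ₑ ^ 2
      ≤ ∑ s ∈ T.cellFinset, (d + 1) * ∫⁻ x in interior (hull s), ‖u x - mean (z s)‖ₑ ^ 2 :=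
        (T.lintegral_eq_sum hΩ0 _).trans_le
          (Finset.sum_le_sum fun s hs => hle s (T.mem_cellFinset.1 hs))
    _ ≤ _ := by
        rw [← Finset.mul_sum]
        gcongr
        exact hsum

lemma sum_lintegral_sub_le (hΩ : volume (frontier Ω) = 0) (hu : MemLp u 2 (volume.restrict Ω))
    (hv : MemLp v 2 (volume.restrict Ω)) (m : Finset (Space d) → ℝ) :
    ∑ s ∈ T.cellFinset, ∫⁻ x in interior (hull s), ‖v x - m s‖ₑ ^ 2 ≤
      2 * (∫⁻ x in Ω, ‖u x - v x‖ₑ ^ 2) +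
        2 * ∑ s ∈ T.cellFinset, ∫⁻ x in interior (hull s), ‖u x - m s‖ₑ ^ 2 := by
  rw [T.lintegral_eq_sum hΩ, Finset.mul_sum, Finset.mul_sum, ← Finset.sum_add_distrib]
  refine Finset.sum_le_sum fun s hs => ?_
  have hmeas : AEStronglyMeasurable (fun x => u x - v x) (volume.restrict (interior (hull s))) :=
    (hu.sub hv).1.mono_measure (restrict_interior_hull_le hΩ (T.mem_cellFinset.1 hs))
  rw [← lintegral_const_mul' _ _ (by norm_num), ← lintegral_const_mul' _ _ (by norm_num),
    ← lintegral_add_left' ((hmeas.enorm.pow_const 2).const_mul 2)]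
  refine lintegral_mono fun x => ?_
  simpa [enorm_sub_rev (v x) (u x)] using enorm_add_sq_le (v x - u x) (u x - m s)

lemma lintegral_gradient_le_of_isBallChoice {C : ENNReal} (hΩ : IsOpen Ω)
    (hΩb : Bornology.IsBounded Ω) (hΩ0 : volume (frontier Ω) = 0) (hd : 1 ≤ d) (hr : 1 ≤ r)
    (hk : 0 ≤ k) (hσ : 0 < σ) (hh : 0 < T.meshSize) (hc : T.IsCenters σ c)
    (hb : T.IsBallChoice k b) (hu : MemLp u 2 (volume.restrict Ω)) (hG : IsWeakGradient Ω u G)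
    (hv : IsL2Projection Ω (T.W r) u v)
    (hinv : ∀ m : Finset (Space d) → ℝ, ∫⁻ x in Ω, ‖gradient v x‖ₑ ^ 2 ≤
      C * ENNReal.ofReal (T.meshSize⁻¹ ^ 2) *
        ∑ s ∈ T.cellFinset, ∫⁻ x in interior (hull s), ‖v x - m s‖ₑ ^ 2) :
    ∫⁻ x in Ω, ‖gradient v x‖ₑ ^ 2 ≤
      C * interpConst d σ k * (2 * (d + 2)) * ∫⁻ x in Ω, ‖G x‖ₑ ^ 2 := by
  have hvL : MemLp v 2 (volume.restrict Ω) := W.memLp hΩ hΩb hv.1 2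
  obtain ⟨w, hw, m, hm, hwu⟩ :=
    exists_quasiInterpolant hΩ.measurableSet hΩ0 hd hr hk hσ hh hc hb hu hG
  set E := interpConst d σ k * ENNReal.ofReal (T.meshSize ^ 2) * ∫⁻ x in Ω, ‖G x‖ₑ ^ 2 with hE
  have hvu : ∫⁻ x in Ω, ‖u x - v x‖ₑ ^ 2 ≤ (d + 1) * E := by
    refine le_trans ?_ hwu
    rw [hv.pythagoras (W.sub_mem hv.1 hw) hu hvL (W.memLp hΩ hΩb hw 2)]
    exact le_self_add
  have hcancel : ENNReal.ofReal (T.meshSize⁻¹ ^ 2) * ENNReal.ofReal (T.meshSize ^ 2) = 1 := by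
    rw [← ENNReal.ofReal_mul (by positivity), ← mul_pow, inv_mul_cancel₀ hh.ne', one_pow,
      ENNReal.ofReal_one]
  calc ∫⁻ x in Ω, ‖gradient v x‖ₑ ^ 2
      ≤ C * ENNReal.ofReal (T.meshSize⁻¹ ^ 2) *
          ∑ s ∈ T.cellFinset, ∫⁻ x in interior (hull s), ‖v x - m s‖ₑ ^ 2 := hinv m
    _ ≤ C * ENNReal.ofReal (T.meshSize⁻¹ ^ 2) * (2 * ((d + 1) * E) + 2 * E) := by
        gcongr
        refine (sum_lintegral_sub_le hΩ0 hu hvL m).trans ?_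
        gcongr
    _ = (ENNReal.ofReal (T.meshSize⁻¹ ^ 2) * ENNReal.ofReal (T.meshSize ^ 2)) *
          (C * interpConst d σ k * (2 * (d + 2)) * ∫⁻ x in Ω, ‖G x‖ₑ ^ 2) := by
        rw [hE]
        ring
    _ = _ := by rw [hcancel, one_mul]

lemma lintegral_gradient_le_of_lt_meshSize {C : ENNReal} (hΩ : IsOpen Ω)
    (hΩb : Bornology.IsBounded Ω) (hΩ0 : volume (frontier Ω) = 0) {h₀ : ℝ} (hh₀ : 0 < h₀)
    (hh : h₀ < T.meshSize) (hu : MemLp u 2 (volume.restrict Ω))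
    (hv : IsL2Projection Ω (T.W r) u v)
    (hinv : ∀ m : Finset (Space d) → ℝ, ∫⁻ x in Ω, ‖gradient v x‖ₑ ^ 2 ≤
      C * ENNReal.ofReal (T.meshSize⁻¹ ^ 2) *
        ∑ s ∈ T.cellFinset, ∫⁻ x in interior (hull s), ‖v x - m s‖ₑ ^ 2) :
    ∫⁻ x in Ω, ‖gradient v x‖ₑ ^ 2 ≤
      C * ENNReal.ofReal (h₀⁻¹ ^ 2) * ∫⁻ x in Ω, ‖u x‖ₑ ^ 2 := by
  have hvu : ∫⁻ x in Ω, ‖v x‖ₑ ^ 2 ≤ ∫⁻ x in Ω, ‖u x‖ₑ ^ 2 := by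
    have hpyth := hv.pythagoras (W.sub_mem hv.1 W.zero_mem) hu (W.memLp hΩ hΩb hv.1 2)
      MemLp.zero'
    simp only [sub_zero] at hpyth
    rw [hpyth]
    exact le_add_self
  have hinv₀ : (0 : ℝ) ≤ T.meshSize⁻¹ := inv_nonneg.2 (hh₀.trans hh).le
  calc ∫⁻ x in Ω, ‖gradient v x‖ₑ ^ 2
      ≤ C * ENNReal.ofReal (T.meshSize⁻¹ ^ 2) * ∫⁻ x in Ω, ‖v x‖ₑ ^ 2 := by
        simpa [← T.lintegral_eq_sum hΩ0] using hinv fun _ => 0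
    _ ≤ C * ENNReal.ofReal (h₀⁻¹ ^ 2) * ∫⁻ x in Ω, ‖u x‖ₑ ^ 2 := by gcongr

theorem exists_projection_stable (hd : 1 ≤ d) (hΩ : IsOpen Ω) (hb : Bornology.IsBounded Ω)
    (hL : HasLipschitzBoundary Ω) (r : ℕ) {σ : ℝ} (hσ : 0 < σ) :
    ∃ C : ENNReal, C ≠ ⊤ ∧ ∀ T : Triangulation Ω, T.QuasiUniform σ → ∀ (u v : Space d → ℝ)
      (G : Space d → Space d), MemLp u 2 (volume.restrict Ω) → IsWeakGradient Ω u G →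
        IsL2Projection Ω (T.W r) u v →
          ∫⁻ x in Ω, ‖gradient v x‖ₑ ^ 2 ≤
            C * ((∫⁻ x in Ω, ‖u x‖ₑ ^ 2) + ∫⁻ x in Ω, ‖G x‖ₑ ^ 2) := by
  have hΩ0 := volume_frontier_eq_zero hΩ hb hL
  obtain ⟨h₀, hh₀, k, hk, hsees⟩ := exists_seesBall hΩ hb hL
  obtain ⟨C, hC, hinv⟩ := exists_lintegral_gradient_le_sum d r hσ
  refine ⟨C * ENNReal.ofReal (h₀⁻¹ ^ 2) + C * interpConst d σ k * (2 * (d + 2)), ?_, ?_⟩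
  · unfold interpConst patchConst
    finiteness
  intro T hT u v G hu hG hv
  obtain ⟨c, hc⟩ := hT.exists_isCenters hd hσ
  rcases T.cellFinset.eq_empty_or_nonempty with hempty | ⟨s, hs⟩
  · rw [T.lintegral_eq_sum hΩ0, hempty]
    simp
  have hh : 0 < T.meshSize := T.meshSize_pos hd (T.mem_cellFinset.1 hs)
  rcases Nat.eq_zero_or_pos r with rfl | hr
  · refine (lintegral_eq_zero_of_ae_eq_zero ?_).trans_le zero_le
    filter_upwards [T.ae_exists_mem_interior hΩ0] with x ⟨s, hs, hx⟩
    simp [W.gradient_eq_zero hv.1 hs hx]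
  rcases le_or_gt T.meshSize h₀ with hle | hlt
  · choose! b hbT using fun z hz => hsees z hz T.meshSize hh hle
    refine (lintegral_gradient_le_of_isBallChoice hΩ hb hΩ0 hd hr (zero_le_one.trans hk) hσ hh hc
      hbT hu hG hv (hinv hd hΩ0 c hc v hv.1)).trans ?_
    exact mul_le_mul' le_add_self le_add_self
  · exact (lintegral_gradient_le_of_lt_meshSize hΩ hb hΩ0 hh₀ hlt hu hv
      (hinv hd hΩ0 c hc v hv.1)).trans (mul_le_mul' le_self_add le_self_add)

end Triangulation

/-! ### The Sobolev inequality for finite element functions -/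

section LipschitzCover

lemma volume_image_le_of_cover {f : ℝ → ℝ} {L : NNReal} {ι : Type*} (F : Finset ι) (A : ι → Set ℝ)
    (hA : ∀ i ∈ F, MeasurableSet (A i)) (hL : ∀ i ∈ F, LipschitzOnWith L f (A i)) :
    ∀ S ⊆ ⋃ i ∈ F, A i, volume (f '' S) ≤ L * volume S := by
  classical
  induction F using Finset.induction_on with
  | empty =>
    intro S hS
    obtain rfl : S = ∅ := by simpa using hS
    simp
  | insert i F _ ih =>
    intro S hS
    have hinter : volume (f '' (S ∩ A i)) ≤ L * volume (S ∩ A i) := by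
      simpa only [hausdorffMeasure_real, ENNReal.rpow_one] using
        ((hL i (Finset.mem_insert_self i F)).mono (inter_subset_right (s := S))
          ).hausdorffMeasure_image_le (d := 1) zero_le_one
    have hdiff : volume (f '' (S \ A i)) ≤ L * volume (S \ A i) := by
      refine ih (fun j hj => hA j (Finset.mem_insert_of_mem hj))
        (fun j hj => hL j (Finset.mem_insert_of_mem hj)) _ fun x hx => ?_
      have hxS := hS hx.1
      rw [Finset.set_biUnion_insert] at hxS
      exact hxS.resolve_left hx.2
    calc volume (f '' S) = volume (f '' (S ∩ A i) ∪ f '' (S \ A i)) := by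
          rw [← image_union, inter_union_sdiff]
      _ ≤ volume (f '' (S ∩ A i)) + volume (f '' (S \ A i)) := measure_union_le _ _
      _ ≤ L * volume (S ∩ A i) + L * volume (S \ A i) := add_le_add hinter hdiff
      _ = L * volume S := by
          rw [← mul_add, measure_inter_add_sdiff S (hA i (Finset.mem_insert_self i F))]

-- By connectedness, the image of `[0, 1]` contains the interval between `f 0` and `f 1`.
lemma abs_sub_le_of_cover {f : ℝ → ℝ} (hf : Continuous f) {L : NNReal} {ι : Type*} (F : Finset ι)
    (A : ι → Set ℝ) (hA : ∀ i ∈ F, MeasurableSet (A i)) (hL : ∀ i ∈ F, LipschitzOnWith L f (A i))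
    (hcov : Icc (0 : ℝ) 1 ⊆ ⋃ i ∈ F, A i) : |f 1 - f 0| ≤ L := by
  have hsub : uIcc (f 0) (f 1) ⊆ f '' Icc 0 1 := by
    simpa only [uIcc_of_le zero_le_one] using
      intermediate_value_uIcc (a := (0 : ℝ)) (b := 1) hf.continuousOn
  have hvol := (measure_mono (μ := volume) hsub).trans
    (volume_image_le_of_cover F A hA hL _ hcov)
  rw [Real.volume_interval, Real.volume_Icc, sub_zero, ENNReal.ofReal_one, mul_one,
    ← ENNReal.ofReal_coe_nnreal] at hvol
  exact (ENNReal.ofReal_le_ofReal_iff L.2).1 hvol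

lemma lipschitzWith_of_closed_cover {E : Type*} [NormedAddCommGroup E] [NormedSpace ℝ E]
    {f : E → ℝ} (hf : Continuous f) {L : NNReal} {𝒜 : Set (Set E)} (hfin : 𝒜.Finite)
    (hclosed : ∀ A ∈ 𝒜, IsClosed A) (hL : ∀ A ∈ 𝒜, LipschitzOnWith L f A)
    (hcov : ⋃₀ 𝒜 = univ) : LipschitzWith L f := by
  refine LipschitzWith.of_dist_le_mul fun y x => ?_
  set γ : ℝ → E := fun t => x + t • (y - x)
  have hγ : LipschitzWith ‖y - x‖₊ γ := LipschitzWith.of_dist_le_mul fun s t => by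
    rw [dist_add_left, dist_eq_norm, ← sub_smul, norm_smul, Real.dist_eq, Real.norm_eq_abs,
      mul_comm, coe_nnnorm]
  have hseg := abs_sub_le_of_cover (f := f ∘ γ) (hf.comp hγ.continuous) (L := L * ‖y - x‖₊)
    hfin.toFinset (fun A => γ ⁻¹' A)
    (fun A hA => ((hclosed A (hfin.mem_toFinset.1 hA)).preimage hγ.continuous).measurableSet)
    (fun A hA => (hL A (hfin.mem_toFinset.1 hA)).comp hγ.lipschitzOnWith fun _ ht => ht)
    (fun t _ => by simpa using mem_sUnion.1 (hcov ▸ mem_univ (γ t)))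
  simpa [γ, Real.dist_eq, dist_eq_norm] using hseg

end LipschitzCover

section Mollification

variable {g : Space d → ℝ} {n : ℕ} {x y : Space d}

lemma integrable_mollifier_mul (hg : Continuous g) (n : ℕ) (x : Space d) :
    Integrable fun z => (mollifier d n).normed volume z * g (x - z) :=
  ((ContDiffBump.continuous_normed _).mul (hg.comp (by fun_prop))).integrable_of_hasCompactSupport
    (ContDiffBump.hasCompactSupport_normed _).mul_right

lemma mollify_sub_mollify_sub (hg : Continuous g) (c : ℝ) :
    mollify n g y - mollify n g x - c =
      ∫ z, (mollifier d n).normed volume z * (g (y - z) - g (x - z) - c) := by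
  have hsub : Integrable fun z => (mollifier d n).normed volume z * g (y - z) -
      (mollifier d n).normed volume z * g (x - z) :=
    (integrable_mollifier_mul hg n y).sub (integrable_mollifier_mul hg n x)
  simp_rw [mul_sub]
  rw [integral_sub hsub ((ContDiffBump.integrable_normed _).mul_const _),
    integral_sub (integrable_mollifier_mul hg n y) (integrable_mollifier_mul hg n x),
    integral_mul_const, ContDiffBump.integral_normed, one_mul, mollify_apply, mollify_apply]

lemma abs_mollify_sub_le (hg : Continuous g) {c ε : ℝ}
    (h : ∀ z, ‖z‖ < (mollifier d n).rOut → |g (y - z) - g (x - z) - c| ≤ ε) :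
    |mollify n g y - mollify n g x - c| ≤ ε := by
  set ψ := (mollifier d n).normed (volume : Measure (Space d)) with hψ
  rw [mollify_sub_mollify_sub hg, ← Real.norm_eq_abs]
  calc ‖∫ z, ψ z * (g (y - z) - g (x - z) - c)‖ ≤ ∫ z, ψ z * ε := by
        refine norm_integral_le_of_norm_le ((ContDiffBump.integrable_normed _).mul_const _)
          (Eventually.of_forall fun z => ?_)
        rw [norm_mul, Real.norm_of_nonneg (ContDiffBump.nonneg_normed _ _), Real.norm_eq_abs]
        by_cases hz : ‖z‖ < (mollifier d n).rOut
        · exact mul_le_mul_of_nonneg_left (h z hz) (ContDiffBump.nonneg_normed _ _)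
        · have hψz : ψ z = 0 := by
            rw [← Function.notMem_support, hψ, ContDiffBump.support_normed_eq]
            simpa using hz
          rw [← hψ, hψz, zero_mul, zero_mul]
    _ = ε := by rw [integral_mul_const, ContDiffBump.integral_normed, one_mul]

lemma norm_fderiv_mollify_sub_le (hg : Continuous g) (A : Space d →L[ℝ] ℝ) {ε : ℝ} (hε : 0 ≤ ε)
    (h : ∀ᶠ y in 𝓝 x, ∀ z,
      ‖z‖ < (mollifier d n).rOut → |g (y - z) - g (x - z) - A (y - x)| ≤ ε * ‖y - x‖) :
    ‖fderiv ℝ (mollify n g) x - A‖ ≤ ε := by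
  have hd : HasFDerivAt (mollify n g) (fderiv ℝ (mollify n g) x) x :=
    ((contDiff_mollify n hg.locallyIntegrable).differentiable one_ne_zero x).hasFDerivAt
  refine (hd.sub A.hasFDerivAt).le_of_lip' hε ?_
  filter_upwards [h] with y hy
  rw [Pi.sub_apply, Pi.sub_apply, sub_sub_sub_comm, ← map_sub, Real.norm_eq_abs]
  exact abs_mollify_sub_le hg hy

lemma tendsto_fderiv_mollify (hg : Continuous g) {A : Space d →L[ℝ] ℝ}
    (hA : HasStrictFDerivAt g A x) :
    Tendsto (fun n => fderiv ℝ (mollify n g) x) atTop (𝓝 A) := by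
  rw [Metric.tendsto_atTop']
  intro ε hε
  obtain ⟨ρ, hρ, hball⟩ := Metric.eventually_nhds_iff_ball.1 (hA.isLittleO.def (half_pos hε))
  obtain ⟨N, hN⟩ :=
    eventually_atTop.1 (tendsto_mollifier_rOut (d := d).eventually_lt_const (half_pos hρ))
  refine ⟨N, fun n hn => ?_⟩
  rw [dist_eq_norm]
  refine (norm_fderiv_mollify_sub_le hg A (half_pos hε).le ?_).trans_lt (half_lt_self hε)
  filter_upwards [Metric.ball_mem_nhds x (half_pos hρ)] with y hy z hz
  have hzρ : ‖z‖ < ρ / 2 := hz.trans (hN n hn.le)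
  have hyz : y - z ∈ Metric.ball x ρ := by
    rw [mem_ball_iff_norm] at hy ⊢
    calc ‖y - z - x‖ = ‖(y - x) - z‖ := by rw [sub_right_comm]
      _ ≤ ‖y - x‖ + ‖z‖ := norm_sub_le _ _
      _ < ρ := by linarith
  have hxz : x - z ∈ Metric.ball x ρ := by
    rw [mem_ball_iff_norm, sub_sub_cancel_left, norm_neg]
    linarith
  have hmem : (y - z, x - z) ∈ Metric.ball (x, x) ρ := by
    rw [← ball_prod_same]
    exact ⟨hyz, hxz⟩
  simpa using hball _ hmem

lemma norm_fderiv_mollify_le {L : NNReal} (hg : LipschitzWith L g) (n : ℕ) (x : Space d) :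
    ‖fderiv ℝ (mollify n g) x‖ ≤ L := by
  simpa using norm_fderiv_mollify_sub_le hg.continuous 0 (n := n) (x := x) L.2
    (Eventually.of_forall fun y z _ => by
      simpa [Real.dist_eq, dist_eq_norm] using hg.dist_le_mul (y - z) (x - z))

lemma mollifier_rOut_le_one (n : ℕ) : (mollifier d n).rOut ≤ 1 :=
  div_le_one_of_le₀ (by linarith [n.cast_nonneg (α := ℝ)]) (by positivity)

lemma support_mollify_subset {R : ℝ} (hg : Function.support g ⊆ Metric.closedBall 0 R) (n : ℕ) :
    Function.support (mollify n g) ⊆ Metric.closedBall 0 (R + 1) := by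
  intro x hx
  by_contra hxR
  refine hx ?_
  rw [mollify_apply]
  refine integral_eq_zero_of_ae (Eventually.of_forall fun z => ?_)
  simp only [Pi.zero_apply, mul_eq_zero]
  by_contra! h
  have hz : z ∈ Function.support ((mollifier d n).normed (volume : Measure (Space d))) := h.1
  rw [ContDiffBump.support_normed_eq, mem_ball_zero_iff] at hz
  apply hxR
  rw [mem_closedBall_zero_iff]
  calc ‖x‖ = ‖(x - z) + z‖ := by rw [sub_add_cancel]
    _ ≤ ‖x - z‖ + ‖z‖ := norm_add_le _ _
    _ ≤ R + 1 := add_le_add (mem_closedBall_zero_iff.1 (hg h.2))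
        (hz.le.trans (mollifier_rOut_le_one n))

lemma fderiv_mollify_eq_zero {R : ℝ} (hg : Function.support g ⊆ Metric.closedBall 0 R)
    (hx : x ∉ Metric.closedBall 0 (R + 1)) : fderiv ℝ (mollify n g) x = 0 :=
  image_eq_zero_of_notMem_tsupport fun h => hx (closure_minimal (support_mollify_subset hg n)
    Metric.isClosed_closedBall (tsupport_fderiv_subset ℝ h))

lemma tendsto_eLpNorm_fderiv_mollify {p : NNReal} (hp : 0 < p) {L : NNReal}
    (hg : LipschitzWith L g) {R : ℝ} (hsupp : Function.support g ⊆ Metric.closedBall 0 R)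
    (hstrict : ∀ᵐ x, HasStrictFDerivAt g (fderiv ℝ g x) x) :
    Tendsto (fun n => eLpNorm (fderiv ℝ (mollify n g)) p volume) atTop
      (𝓝 (eLpNorm (fderiv ℝ g) p volume)) := by
  simp_rw [eLpNorm_nnreal_eq_lintegral hp.ne']
  refine (ENNReal.continuous_rpow_const.tendsto _).comp ?_
  refine tendsto_lintegral_of_dominated_convergence
    ((Metric.closedBall 0 (R + 1)).indicator fun _ => (L : ENNReal) ^ (p : ℝ)) ?_ ?_ ?_ ?_
  · exact fun n => (((contDiff_mollify n hg.continuous.locallyIntegrable).continuous_fderiv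
      one_ne_zero).enorm.measurable).pow_const _
  · refine fun n => Eventually.of_forall fun x => ?_
    by_cases hx : x ∈ Metric.closedBall 0 (R + 1)
    · rw [indicator_of_mem hx]
      exact ENNReal.rpow_le_rpow (enorm_le_coe.2 (norm_fderiv_mollify_le hg n x)) p.2
    · have hzero : ‖fderiv ℝ (mollify n g) x‖ₑ = 0 := by
        rw [← ofReal_norm, fderiv_mollify_eq_zero hsupp hx, norm_zero, ENNReal.ofReal_zero]
      simp [hzero, hp]
  · rw [lintegral_indicator measurableSet_closedBall, setLIntegral_const]
    exact ENNReal.mul_ne_top (ENNReal.rpow_ne_top_of_nonneg p.2 ENNReal.coe_ne_top)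
      Metric.isBounded_closedBall.measure_lt_top.ne
  · filter_upwards [hstrict] with x hx
    exact ((ENNReal.continuous_rpow_const.comp continuous_enorm).tendsto _).comp
      (tendsto_fderiv_mollify hg.continuous hx)

end Mollification

-- Strict differentiability almost everywhere makes the gradients of the mollified functions
-- converge, so the inequality passes from smooth functions to the limit.
theorem exists_sobolev_lipschitz (d : ℕ) {p q : NNReal} (hp : 1 ≤ p) (hpd : p < d)
    (hpq : (p : ℝ)⁻¹ - (d : ℝ)⁻¹ ≤ (q : ℝ)⁻¹) (R : ℝ) :
    ∃ C : NNReal, ∀ (g : Space d → ℝ) (L : NNReal), LipschitzWith L g →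
      Function.support g ⊆ Metric.closedBall 0 R →
      (∀ᵐ x, HasStrictFDerivAt g (fderiv ℝ g x) x) →
      eLpNorm g q volume ≤ C * eLpNorm (fderiv ℝ g) p volume := by
  set C := eLpNormLESNormFDerivOfLeConst ℝ (volume : Measure (Space d))
    (Metric.closedBall 0 (R + 1)) p q
  refine ⟨C, fun g L hg hsupp hstrict => ?_⟩
  have hsmooth : ∀ n, ContDiff ℝ 1 (mollify n g) :=
    fun n => contDiff_mollify n hg.continuous.locallyIntegrable
  have hsobolev : ∀ n,
      eLpNorm (mollify n g) q volume ≤ C * eLpNorm (fderiv ℝ (mollify n g)) p volume :=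
    fun n => eLpNorm_le_eLpNorm_fderiv_of_le volume (hsmooth n) (support_mollify_subset hsupp n)
      hp (by simpa using hpd) (by simpa using hpq) Metric.isBounded_closedBall
  calc eLpNorm g q volume ≤ liminf (fun n => eLpNorm (mollify n g) q volume) atTop :=
        Lp.eLpNorm_lim_le_liminf_eLpNorm (fun n => (hsmooth n).continuous.aestronglyMeasurable) g
          (Eventually.of_forall fun x => ContDiffBump.convolution_tendsto_right_of_continuous
            tendsto_mollifier_rOut hg.continuous x)
    _ ≤ liminf (fun n => C * eLpNorm (fderiv ℝ (mollify n g)) p volume) atTop :=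
        liminf_le_liminf (Eventually.of_forall hsobolev)
    _ = C * eLpNorm (fderiv ℝ g) p volume :=
        (ENNReal.Tendsto.const_mul (tendsto_eLpNorm_fderiv_mollify (zero_lt_one.trans_le hp) hg
          hsupp hstrict) (Or.inr ENNReal.coe_ne_top)).liminf_eq

lemma indicator_eventuallyEq_zero {X M : Type*} [TopologicalSpace X] [Zero M] {s : Set X} {x : X}
    (f : X → M) (hx : x ∉ closure s) : s.indicator f =ᶠ[𝓝 x] 0 := by
  filter_upwards [isClosed_closure.isOpen_compl.mem_nhds hx] with y hy
  exact indicator_of_notMem (fun h => hy (subset_closure h)) _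

lemma ae_mem_or_notMem_closure {Ω : Set (Space d)} (hΩ : IsOpen Ω)
    (hΩ0 : volume (frontier Ω) = 0) : ∀ᵐ x, x ∈ Ω ∨ x ∉ closure Ω := by
  filter_upwards [measure_eq_zero_iff_ae_notMem.1 hΩ0] with x hx
  rw [hΩ.frontier_eq] at hx
  exact or_iff_not_imp_left.2 fun hxΩ hxc => hx ⟨hxc, hxΩ⟩

namespace Triangulation

variable {Ω : Set (Space d)} {T : Triangulation Ω} {r : ℕ} {v : Space d → ℝ}

lemma W.exists_lipschitzOnWith_hull (hv : v ∈ T.W r) {s : Finset (Space d)} (hs : s ∈ T.cells) :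
    ∃ L : NNReal, LipschitzOnWith L v (hull s) := by
  obtain ⟨p, -, hp⟩ := W.exists_poly hv hs
  obtain ⟨M, hM⟩ := (isCompact_hull s).exists_bound_of_continuousOn
    ((contDiff_polyFun p).continuous_fderiv (by simp)).continuousOn
  have hlip : LipschitzOnWith M.toNNReal (polyFun p) (hull s) :=
    Convex.lipschitzOnWith_of_nnnorm_fderiv_le (fun x _ => differentiable_polyFun p x)
      (fun x hx => by
        rw [← NNReal.coe_le_coe, coe_nnnorm]
        exact (hM x hx).trans (Real.le_coe_toNNReal M)) (convex_convexHull ℝ _)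
  refine ⟨M.toNNReal, fun x hx y hy => ?_⟩
  rw [hp hx, hp hy]
  exact hlip hx hy

lemma W.exists_lipschitzOnWith (hv : v ∈ T.W r) :
    ∃ L : NNReal, ∀ s ∈ T.cells, LipschitzOnWith L v (hull s) := by
  choose! M hM using fun s (hs : s ∈ T.cells) => W.exists_lipschitzOnWith_hull hv hs
  exact ⟨T.cellFinset.sup M, fun s hs =>
    (hM s hs).weaken (Finset.le_sup (T.mem_cellFinset.2 hs))⟩

lemma W₀.indicator_eqOn (hΩ : IsOpen Ω) (hv : v ∈ T.W₀ r) :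
    EqOn (Ω.indicator v) v (closure Ω) := by
  intro x hx
  by_cases hxΩ : x ∈ Ω
  · exact indicator_of_mem hxΩ v
  · rw [indicator_of_notMem hxΩ, hv.2 x (by rw [hΩ.frontier_eq]; exact ⟨hx, hxΩ⟩)]

lemma W₀.exists_lipschitzWith (hΩ : IsOpen Ω) (hv : v ∈ T.W₀ r) :
    ∃ L : NNReal, LipschitzWith L (Ω.indicator v) := by
  obtain ⟨L, hL⟩ := W.exists_lipschitzOnWith hv.1
  refine ⟨L, lipschitzWith_of_closed_cover (continuous_indicator hv.2 hv.1.1)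
    ((T.finite_cells.image fun s => hull s).insert Ωᶜ) ?_ ?_ ?_⟩
  · rintro _ (rfl | ⟨s, -, rfl⟩)
    exacts [hΩ.isClosed_compl, isClosed_hull s]
  · rintro _ (rfl | ⟨s, hs, rfl⟩)
    · intro x hx y hy
      simp [indicator_of_notMem hx, indicator_of_notMem hy]
    · intro x hx y hy
      rw [W₀.indicator_eqOn hΩ hv (T.hull_subset hs hx),
        W₀.indicator_eqOn hΩ hv (T.hull_subset hs hy)]
      exact hL s hs hx hy
  · have hcells : ⋃ s ∈ T.cells, hull s = closure Ω := by
      simp only [T.closure_eq, T.mem_cellFinset]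
    rw [sUnion_insert, sUnion_image, hcells]
    exact eq_univ_of_univ_subset ((compl_union_self Ω).ge.trans
      (union_subset_union_right _ subset_closure))

lemma W₀.ae_hasStrictFDerivAt (hΩ : IsOpen Ω) (hΩ0 : volume (frontier Ω) = 0)
    (hv : v ∈ T.W₀ r) :
    ∀ᵐ x, HasStrictFDerivAt (Ω.indicator v) (fderiv ℝ (Ω.indicator v) x) x := by
  filter_upwards [ae_mem_or_notMem_closure hΩ hΩ0,
    (ae_restrict_iff' hΩ.measurableSet).1 (T.ae_exists_mem_interior hΩ0)] with x hx hcell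
  suffices hC : ContDiffAt ℝ 1 (Ω.indicator v) x from hC.hasStrictFDerivAt one_ne_zero
  rcases hx with hx | hx
  · obtain ⟨s, hs, hxs⟩ := hcell hx
    obtain ⟨p, -, hp⟩ := W.exists_poly hv.1 hs
    have heq : EqOn (Ω.indicator v) (polyFun p) (hull s) :=
      ((W₀.indicator_eqOn hΩ hv).mono (T.hull_subset hs)).trans hp
    exact ((contDiff_polyFun p).contDiffAt.of_le (by simp)).congr_of_eventuallyEq
      (eventuallyEq_of_eqOn heq hxs)
  · exact contDiffAt_const.congr_of_eventuallyEq (indicator_eventuallyEq_zero v hx)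

end Triangulation

lemma eLpNorm_fderiv_indicator {Ω : Set (Space d)} (hΩ : IsOpen Ω)
    (hΩ0 : volume (frontier Ω) = 0) (v : Space d → ℝ) (p : ENNReal) :
    eLpNorm (fderiv ℝ (Ω.indicator v)) p volume = eLpNorm (gradient v) p (volume.restrict Ω) := by
  rw [← eLpNorm_indicator_eq_eLpNorm_restrict hΩ.measurableSet]
  refine eLpNorm_congr_norm_ae ?_
  filter_upwards [ae_mem_or_notMem_closure hΩ hΩ0] with x hx
  rcases hx with hx | hx
  · have heq : Ω.indicator v =ᶠ[𝓝 x] v :=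
      eventuallyEq_of_mem (hΩ.mem_nhds hx) fun _ hy => indicator_of_mem hy v
    rw [indicator_of_mem hx, norm_gradient, heq.fderiv_eq]
  · rw [indicator_of_notMem (fun h => hx (subset_closure h)),
      (indicator_eventuallyEq_zero v hx).fderiv_eq]
    simp

theorem Triangulation.exists_sobolev_W₀ {Ω : Set (Space d)} (hΩ : IsOpen Ω)
    (hb : Bornology.IsBounded Ω) (hΩ0 : volume (frontier Ω) = 0) {p q : NNReal} (hp : 1 ≤ p)
    (hpd : p < d) (hpq : (p : ℝ)⁻¹ - (d : ℝ)⁻¹ ≤ (q : ℝ)⁻¹) :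
    ∃ C : NNReal, ∀ (T : Triangulation Ω) (r : ℕ), ∀ v ∈ T.W₀ r,
      eLpNorm v q (volume.restrict Ω) ≤ C * eLpNorm (gradient v) p (volume.restrict Ω) := by
  obtain ⟨R, hR⟩ := hb.subset_closedBall 0
  obtain ⟨C, hC⟩ := exists_sobolev_lipschitz d hp hpd hpq R
  refine ⟨C, fun T r v hv => ?_⟩
  obtain ⟨L, hL⟩ := W₀.exists_lipschitzWith hΩ hv
  rw [← eLpNorm_indicator_eq_eLpNorm_restrict hΩ.measurableSet, ← eLpNorm_fderiv_indicator hΩ hΩ0]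
  exact hC _ L hL (support_indicator_subset.trans hR) (W₀.ae_hasStrictFDerivAt hΩ hΩ0 hv)

/-! ### Nodal representation of the finite element functions -/

lemma exists_finset_determining (d r : ℕ) (A : Set (Space d)) :
    ∃ S : Finset (Space d), (∀ x ∈ S, x ∈ A) ∧ ∀ p : MvPolynomial (Fin d) ℝ, p.totalDegree ≤ r →
      (∀ x ∈ S, polyFun p x = 0) → ∀ x ∈ A, polyFun p x = 0 := by
  classical
  let ev (x : Space d) : MvPolynomial.restrictTotalDegree (Fin d) ℝ r →ₗ[ℝ] ℝ :=
    LinearMap.proj x ∘ₗ polyFun.toLinearMap ∘ₗ Submodule.subtype _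
  -- By finite dimensionality the common kernel is that of finitely many evaluations.
  obtain ⟨S, hS⟩ := Finset.exists_inf_le fun x : A => LinearMap.ker (ev x)
  refine ⟨S.map (Function.Embedding.subtype _), fun x hx => ?_, fun p hp h x hx => ?_⟩
  · obtain ⟨y, -, rfl⟩ := Finset.mem_map.1 hx
    exact y.2
  · have hker : (⟨p, (MvPolynomial.mem_restrictTotalDegree _ _ _).2 hp⟩ :
        MvPolynomial.restrictTotalDegree (Fin d) ℝ r) ∈
          S.inf fun x : A => LinearMap.ker (ev x) := by
      rw [Submodule.mem_finsetInf]
      exact fun y hy => h y (Finset.mem_map.2 ⟨y, hy, rfl⟩)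
    exact hS ⟨x, hx⟩ hker

lemma exists_eq_sum_of_determining {X K : Type*} [Field K] (V : Submodule K (X → K))
    (S : Finset X) (hS : ∀ v ∈ V, (∀ y ∈ S, v y = 0) → v = 0) :
    ∃ e : X → X → K, (∀ y, e y ∈ V) ∧ ∀ v ∈ V, v = ∑ y ∈ S, v y • e y := by
  classical
  let R : V →ₗ[K] (S → K) := LinearMap.funLeft K K Subtype.val ∘ₗ V.subtype
  have hR : LinearMap.ker R = ⊥ := LinearMap.ker_eq_bot'.2 fun v hv =>
    Subtype.ext (hS v v.2 fun y hy => congrFun hv ⟨y, hy⟩)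
  obtain ⟨g, hg⟩ := R.exists_leftInverse_of_injective hR
  refine ⟨fun y => g fun z => (Pi.single y 1 : X → K) z, fun y => (g _).2, fun v hv => ?_⟩
  have hRv : R ⟨v, hv⟩ = ∑ y ∈ S, v y • fun z : S => (Pi.single y 1 : X → K) z := by
    ext z
    simp [R, LinearMap.funLeft_apply, Pi.single_apply]
  have hgR := congrArg Subtype.val (LinearMap.congr_fun hg ⟨v, hv⟩)
  rw [LinearMap.comp_apply, hRv, map_sum] at hgR
  simpa using hgR.symm

namespace Triangulation

variable {Ω : Set (Space d)} {T : Triangulation Ω} {r : ℕ} {v w : Space d → ℝ}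

lemma W.congr (hv : v ∈ T.W r) (h : EqOn w v (closure Ω)) : w ∈ T.W r :=
  ⟨hv.1.congr h, fun s hs => by
    obtain ⟨p, hp, hpv⟩ := hv.2 s hs
    exact ⟨p, hp, fun x hx => (h (T.hull_subset hs hx)).trans (hpv x hx)⟩⟩

lemma W₀.congr (hv : v ∈ T.W₀ r) (h : EqOn w v (closure Ω)) : w ∈ T.W₀ r :=
  ⟨W.congr hv.1 h, fun x hx => (h (frontier_subset_closure hx)).trans (hv.2 x hx)⟩

lemma W.smul_mem (c : ℝ) (hv : v ∈ T.W r) : (fun x => c * v x) ∈ T.W r :=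
  ⟨continuousOn_const.mul hv.1, fun s hs => by
    obtain ⟨p, hp, hpv⟩ := hv.2 s hs
    refine ⟨c • p, (MvPolynomial.totalDegree_smul_le c p).trans hp, fun x hx => ?_⟩
    simp only [hpv x hx, MvPolynomial.smul_eval]⟩

lemma W.add_mem (hv : v ∈ T.W r) (hw : w ∈ T.W r) : (fun x => v x + w x) ∈ T.W r := by
  simpa using W.sub_mem hv (W.smul_mem (-1) hw)

variable (T r) in
/-- The finite element functions that vanish on the boundary, extended by zero outside the closure
of `Ω`, where the values of a member of `T.W₀ r` are arbitrary. -/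
def zeroExtended : Submodule ℝ (Space d → ℝ) where
  carrier := {v | v ∈ T.W₀ r ∧ ∀ x ∉ closure Ω, v x = 0}
  add_mem' := fun ha hb => ⟨⟨W.add_mem ha.1.1 hb.1.1, fun x hx => by
    simp [ha.1.2 x hx, hb.1.2 x hx]⟩, fun x hx => by simp [ha.2 x hx, hb.2 x hx]⟩
  zero_mem' := ⟨W₀.zero_mem, fun _ _ => rfl⟩
  smul_mem' := fun c _ ha => ⟨⟨W.smul_mem c ha.1.1, fun x hx => by simp [ha.1.2 x hx]⟩,
    fun x hx => by simp [ha.2 x hx]⟩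

lemma indicator_closure_mem_zeroExtended (hv : v ∈ T.W₀ r) :
    (closure Ω).indicator v ∈ zeroExtended T r :=
  ⟨W₀.congr hv fun _ hx => indicator_of_mem hx v, fun _ hx => indicator_of_notMem hx v⟩

variable (T r) in
/-- A nodal representation of the finite element functions that vanish on the boundary: every
such function is a combination of the shape functions `e y`, the coefficients being its values at
the nodes `y ∈ S`. -/
structure IsNodal (S : Finset (Space d)) (e : Space d → Space d → ℝ) : Prop where
  mem_closure : ∀ y ∈ S, y ∈ closure Ω
  mem : ∀ y, e y ∈ T.W₀ r
  eq_sum : ∀ v ∈ T.W₀ r, ∀ x ∈ closure Ω, v x = ∑ y ∈ S, v y * e y x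

variable (T r) in
theorem exists_isNodal : ∃ S e, T.IsNodal r S e := by
  classical
  choose N hNsub hN using fun s : Finset (Space d) => exists_finset_determining d r (hull s)
  set S := T.cellFinset.biUnion N
  have hsub : ∀ y ∈ S, y ∈ closure Ω := fun y hy => by
    obtain ⟨s, hs, hys⟩ := Finset.mem_biUnion.1 hy
    exact T.hull_subset (T.mem_cellFinset.1 hs) (hNsub s y hys)
  have hdet : ∀ v ∈ zeroExtended T r, (∀ y ∈ S, v y = 0) → v = 0 := by
    intro v hv hvS
    ext x
    by_cases hx : x ∈ closure Ω
    · rw [T.closure_eq, mem_iUnion₂] at hx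
      obtain ⟨s, hs, hxs⟩ := hx
      obtain ⟨p, hp, hpv⟩ := W.exists_poly hv.1.1 (T.mem_cellFinset.1 hs)
      rw [hpv hxs]
      refine hN s p hp (fun y hy => ?_) x hxs
      rw [← hpv (hNsub s y hy)]
      exact hvS y (Finset.mem_biUnion.2 ⟨s, hs, hy⟩)
    · exact hv.2 x hx
  obtain ⟨e, he, hrep⟩ := exists_eq_sum_of_determining _ S hdet
  refine ⟨S, e, hsub, fun y => (he y).1, fun v hv x hx => ?_⟩
  have hvx := congrFun (hrep _ (indicator_closure_mem_zeroExtended hv)) x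
  rw [indicator_of_mem hx, Finset.sum_apply] at hvx
  rw [hvx]
  exact Finset.sum_congr rfl fun y hy => by
    rw [indicator_of_mem (hsub y hy), Pi.smul_apply, smul_eq_mul]

end Triangulation

/-! ### The time derivative of the energy -/

lemma integral_sum_mul_sum {α ι : Type*} [MeasurableSpace α] {μ : Measure α} (S : Finset ι)
    {e : ι → α → ℝ} (hint : ∀ y ∈ S, ∀ z ∈ S, Integrable (fun x => e y x * e z x) μ)
    (b c : ι → ℝ) :
    ∫ x, (∑ y ∈ S, b y * e y x) * (∑ z ∈ S, c z * e z x) ∂μ =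
      ∑ y ∈ S, ∑ z ∈ S, b y * c z * ∫ x, e y x * e z x ∂μ := by
  have hexpand : ∀ x, (∑ y ∈ S, b y * e y x) * (∑ z ∈ S, c z * e z x) =
      ∑ y ∈ S, ∑ z ∈ S, b y * c z * (e y x * e z x) := fun x => by
    rw [Finset.sum_mul_sum]
    exact Finset.sum_congr rfl fun y _ => Finset.sum_congr rfl fun z _ => mul_mul_mul_comm _ _ _ _
  simp_rw [hexpand]
  rw [integral_finsetSum _ fun y hy => integrable_finsetSum _ fun z hz =>
    (hint y hy z hz).const_mul _]
  refine Finset.sum_congr rfl fun y hy => ?_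
  rw [integral_finsetSum _ fun z hz => (hint y hy z hz).const_mul _]
  exact Finset.sum_congr rfl fun z _ => integral_const_mul _ _

lemma hasDerivAt_sum_mul_mul {ι : Type*} (S : Finset ι) {M : ι → ι → ℝ}
    (hM : ∀ y z, M y z = M z y) {c : ι → ℝ → ℝ} {c' : ι → ℝ} {t : ℝ}
    (hc : ∀ y ∈ S, HasDerivAt (c y) (c' y) t) :
    HasDerivAt (fun s => ∑ y ∈ S, ∑ z ∈ S, c y s * c z s * M y z)
      (2 * ∑ y ∈ S, ∑ z ∈ S, c' y * c z t * M y z) t := by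
  have hsum : HasDerivAt (fun s => ∑ y ∈ S, ∑ z ∈ S, c y s * c z s * M y z)
      (∑ y ∈ S, ∑ z ∈ S, (c' y * c z t + c y t * c' z) * M y z) t :=
    HasDerivAt.fun_sum fun y hy => HasDerivAt.fun_sum fun z hz =>
      ((hc y hy).mul (hc z hz)).mul_const _
  convert hsum using 1
  simp only [add_mul, Finset.sum_add_distrib, two_mul]
  congr 1
  rw [Finset.sum_comm]
  exact Finset.sum_congr rfl fun y _ => Finset.sum_congr rfl fun z _ => by
    rw [hM z y, mul_comm (c' z)]

namespace Triangulation.IsNodal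

variable {Ω : Set (Space d)} {T : Triangulation Ω} {r : ℕ} {S : Finset (Space d)}
  {e : Space d → Space d → ℝ} {u : ℝ → Space d → ℝ}

lemma setIntegral_mul (he : T.IsNodal r S e) (hΩ : IsOpen Ω) (hb : Bornology.IsBounded Ω)
    {v w : Space d → ℝ} {b c : Space d → ℝ} (hv : ∀ x ∈ closure Ω, v x = ∑ y ∈ S, b y * e y x)
    (hw : ∀ x ∈ closure Ω, w x = ∑ y ∈ S, c y * e y x) :
    ∫ x in Ω, v x * w x = ∑ y ∈ S, ∑ z ∈ S, b y * c z * ∫ x in Ω, e y x * e z x := by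
  rw [← integral_sum_mul_sum S fun y _ z _ =>
    (W.memLp hΩ hb (he.mem y).1 2).integrable_mul (W.memLp hΩ hb (he.mem z).1 2)]
  refine setIntegral_congr_fun hΩ.measurableSet fun x hx => ?_
  simp only [hv x (subset_closure hx), hw x (subset_closure hx)]

lemma setIntegral_sq (he : T.IsNodal r S e) (hΩ : IsOpen Ω) (hb : Bornology.IsBounded Ω)
    {v : Space d → ℝ} (hv : v ∈ T.W₀ r) :
    ∫ x in Ω, v x ^ 2 = ∑ y ∈ S, ∑ z ∈ S, v y * v z * ∫ x in Ω, e y x * e z x := by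
  simp only [sq]
  exact he.setIntegral_mul hΩ hb (he.eq_sum v hv) (he.eq_sum v hv)

lemma deriv_eq_sum (he : T.IsNodal r S e) {t : ℝ} (hmem : ∀ᶠ s in 𝓝 t, u s ∈ T.W₀ r)
    (hdiff : ∀ x ∈ closure Ω, DifferentiableAt ℝ (fun s => u s x) t) :
    ∀ x ∈ closure Ω, deriv (fun s => u s x) t = ∑ y ∈ S, deriv (fun s => u s y) t * e y x := by
  intro x hx
  have hsum : (fun s => u s x) =ᶠ[𝓝 t] fun s => ∑ y ∈ S, u s y * e y x :=
    hmem.mono fun s hs => he.eq_sum _ hs x hx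
  rw [hsum.deriv_eq]
  exact (HasDerivAt.fun_sum fun y hy =>
    (hdiff y (he.mem_closure y hy)).hasDerivAt.mul_const _).deriv

end Triangulation.IsNodal

section Energy

variable {Ω : Set (Space d)} {T : Triangulation Ω} {r : ℕ} {u : ℝ → Space d → ℝ}

lemma continuousWithinAt_energy (hΩ : IsOpen Ω) (hb : Bornology.IsBounded Ω) {I : Set ℝ} {t : ℝ}
    (ht : t ∈ I) (hmem : ∀ s ∈ I, u s ∈ T.W₀ r)
    (hcont : ∀ x ∈ closure Ω, ContinuousWithinAt (fun s => u s x) I t) :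
    ContinuousWithinAt (fun s => ∫ x in Ω, u s x ^ 2) I t := by
  obtain ⟨S, e, he⟩ := T.exists_isNodal r
  have hsum : ContinuousWithinAt
      (fun s => ∑ y ∈ S, ∑ z ∈ S, u s y * u s z * ∫ x in Ω, e y x * e z x) I t :=
    tendsto_finsetSum _ fun y hy => tendsto_finsetSum _ fun z hz =>
      ((hcont y (he.mem_closure y hy)).mul (hcont z (he.mem_closure z hz))).mul
        continuousWithinAt_const
  exact hsum.congr (fun s hs => he.setIntegral_sq hΩ hb (hmem s hs))
    (he.setIntegral_sq hΩ hb (hmem t ht))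

lemma hasDerivAt_energy (hΩ : IsOpen Ω) (hb : Bornology.IsBounded Ω) {t : ℝ}
    (hmem : ∀ᶠ s in 𝓝 t, u s ∈ T.W₀ r)
    (hdiff : ∀ x ∈ closure Ω, DifferentiableAt ℝ (fun s => u s x) t) :
    HasDerivAt (fun s => ∫ x in Ω, u s x ^ 2)
      (2 * ∫ x in Ω, deriv (fun s => u s x) t * u t x) t := by
  obtain ⟨S, e, he⟩ := T.exists_isNodal r
  rw [he.setIntegral_mul hΩ hb (he.deriv_eq_sum hmem hdiff) (he.eq_sum _ hmem.self_of_nhds)]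
  refine (hasDerivAt_sum_mul_mul S (fun y z => by simp only [mul_comm]) fun y hy =>
    (hdiff y (he.mem_closure y hy)).hasDerivAt).congr_of_eventuallyEq ?_
  exact hmem.mono fun s hs => he.setIntegral_sq hΩ hb hs

end Energy

/-! ### Coercivity of the flux -/

lemma norm_rpow_le_two_mul {F : Type*} [SeminormedAddCommGroup F] {p : ℝ} (hp : 1 ≤ p)
    (hp2 : p ≤ 2) (U V : F) : ‖V‖ ^ p ≤ 2 * (‖U‖ ^ p + ‖U - V‖ ^ p) := by
  have hconvex : (‖U‖ + ‖U - V‖) ^ p ≤ 2 ^ (p - 1) * (‖U‖ ^ p + ‖U - V‖ ^ p) := by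
    exact_mod_cast NNReal.rpow_add_le_mul_rpow_add_rpow ‖U‖₊ ‖U - V‖₊ hp
  have htwo : (2 : ℝ) ^ (p - 1) ≤ 2 := by
    simpa only [Real.rpow_one] using
      Real.rpow_le_rpow_of_exponent_le one_le_two (show p - 1 ≤ 1 by linarith)
  calc ‖V‖ ^ p = ‖U - (U - V)‖ ^ p := by rw [sub_sub_cancel]
    _ ≤ (‖U‖ + ‖U - V‖) ^ p :=
        Real.rpow_le_rpow (norm_nonneg _) (norm_sub_le _ _) (by linarith)
    _ ≤ 2 ^ (p - 1) * (‖U‖ ^ p + ‖U - V‖ ^ p) := hconvex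
    _ ≤ _ := mul_le_mul_of_nonneg_right htwo (by positivity)

lemma integrable_norm_rpow_of_memLp_two {X F : Type*} [MeasurableSpace X] {μ : Measure X}
    [IsFiniteMeasure μ] [NormedAddCommGroup F] {p : ℝ} (hp : 0 < p) (hp2 : p ≤ 2) {V : X → F}
    (hV : MemLp V 2 μ) : Integrable (fun x => ‖V x‖ ^ p) μ := by
  have hp2' : ENNReal.ofReal p ≤ 2 := ENNReal.ofReal_le_of_le_toReal (by simpa using hp2)
  simpa only [ENNReal.toReal_ofReal hp.le] using (hV.mono_exponent hp2').integrable_norm_rpow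
    (by simpa using hp) ENNReal.ofReal_ne_top

namespace GenPoly

variable (P : GenPoly) {E : Type*} [NormedAddCommGroup E]

variable (E) in
lemma exists_norm_rpow_β_le :
    ∃ D : ℝ, 0 < D ∧ ∀ δ, 0 < δ → δ ≤ 1 → ∀ U V : E,
      δ ^ P.a * ‖V‖ ^ P.β ≤
        4 * δ ^ 2 + 2 * D * (P.K ‖U‖ * ‖U‖ ^ 2) + 2 * ‖U - V‖ ^ 2 := by
  obtain ⟨D, hD, hK⟩ := P.exists_rpow_β_le_K_mul_sq
  refine ⟨D, hD, fun δ hδ hδ1 U V => ?_⟩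
  have hδβ : δ ^ P.a * δ ^ P.β = δ ^ 2 := by
    rw [← Real.rpow_add hδ, GenPoly.β, add_sub_cancel, Real.rpow_two]
  have hδa : δ ^ P.a * δ ^ (-P.a) = 1 := by
    rw [← Real.rpow_add hδ, add_neg_cancel, Real.rpow_zero]
  calc δ ^ P.a * ‖V‖ ^ P.β
      ≤ δ ^ P.a * (2 * (‖U‖ ^ P.β + ‖U - V‖ ^ P.β)) := by
        gcongr
        exact norm_rpow_le_two_mul P.one_lt_β.le P.β_lt_two.le U V
    _ ≤ δ ^ P.a * (2 * ((δ ^ P.β + D * δ ^ (-P.a) * (P.K ‖U‖ * ‖U‖ ^ 2)) +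
          (δ ^ P.β + δ ^ (-P.a) * ‖U - V‖ ^ 2))) := by
        gcongr
        exacts [hK δ hδ hδ1 _ (norm_nonneg U), P.rpow_β_le hδ (norm_nonneg _)]
    _ = 4 * (δ ^ P.a * δ ^ P.β) +
          (δ ^ P.a * δ ^ (-P.a)) * (2 * D * (P.K ‖U‖ * ‖U‖ ^ 2) + 2 * ‖U - V‖ ^ 2) := by ring
    _ = _ := by rw [hδβ, hδa]; ring

variable [InnerProductSpace ℝ E]

lemma K_mul_norm_sq_le (U V : E) :
    P.K ‖U‖ * ‖U‖ ^ 2 ≤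
      2 * inner ℝ (P.K ‖U‖ • U) V + 1 / P.coeff 0 * ‖U - V‖ ^ 2 := by
  have hpolar : ‖U‖ ^ 2 ≤ 2 * inner ℝ U V + ‖U - V‖ ^ 2 := by
    rw [norm_sub_sq_real]
    linarith [sq_nonneg ‖V‖]
  calc P.K ‖U‖ * ‖U‖ ^ 2 ≤ P.K ‖U‖ * (2 * inner ℝ U V + ‖U - V‖ ^ 2) :=
        mul_le_mul_of_nonneg_left hpolar (P.K_nonneg (norm_nonneg U))
    _ = 2 * inner ℝ (P.K ‖U‖ • U) V + P.K ‖U‖ * ‖U - V‖ ^ 2 := by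
        rw [real_inner_smul_left]; ring
    _ ≤ _ := by gcongr; exact P.K_le (norm_nonneg U)

variable (E) in
lemma exists_flux_inner_ge :
    ∃ c C : ℝ, 0 < c ∧ 0 < C ∧ ∀ δ, 0 < δ → δ ≤ 1 → ∀ U V : E,
      c * δ ^ P.a * ‖V‖ ^ P.β - C * δ ^ 2 - C * ‖U - V‖ ^ 2 ≤ inner ℝ (P.K ‖U‖ • U) V := by
  obtain ⟨D, hD, hpow⟩ := P.exists_norm_rpow_β_le E
  have ha0 := P.coeff_zero_pos
  refine ⟨1 / (4 * D), 1 / D + 1 / P.coeff 0, by positivity, by positivity,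
    fun δ hδ hδ1 U V => ?_⟩
  have hscaled : 1 / (4 * D) * δ ^ P.a * ‖V‖ ^ P.β ≤
      1 / D * δ ^ 2 + P.K ‖U‖ * ‖U‖ ^ 2 / 2 + 1 / D * ‖U - V‖ ^ 2 / 2 := by
    calc 1 / (4 * D) * δ ^ P.a * ‖V‖ ^ P.β = 1 / (4 * D) * (δ ^ P.a * ‖V‖ ^ P.β) := mul_assoc _ _ _
      _ ≤ 1 / (4 * D) * (4 * δ ^ 2 + 2 * D * (P.K ‖U‖ * ‖U‖ ^ 2) + 2 * ‖U - V‖ ^ 2) := by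
          gcongr
          exact hpow δ hδ hδ1 U V
      _ = _ := by field_simp; ring
  have hδ0 : 0 ≤ 1 / P.coeff 0 * δ ^ 2 := by positivity
  have hD0 : 0 ≤ 1 / D * ‖U - V‖ ^ 2 := by positivity
  have ha0' : 0 ≤ 1 / P.coeff 0 * ‖U - V‖ ^ 2 := by positivity
  linarith [P.K_mul_norm_sq_le U V]

section Integral

variable [MeasurableSpace E] [BorelSpace E] [SecondCountableTopology E] {X : Type*}
  [MeasurableSpace X] {μ : Measure X} {U V : X → E}

lemma integrable_flux_inner (hUm : Measurable U) (hU : MemLp U 2 μ) (hV : MemLp V 2 μ) :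
    Integrable (fun x => inner ℝ (P.K ‖U x‖ • U x) (V x)) μ := by
  have hbound : Integrable (fun x => 1 / P.coeff 0 * (‖U x‖ * ‖V x‖)) μ :=
    (hU.norm.integrable_mul hV.norm).const_mul _
  refine hbound.mono' (((P.measurable_K_norm hUm).smul hUm).aestronglyMeasurable.inner hV.1)
    (Eventually.of_forall fun x => (norm_inner_le_norm _ _).trans ?_)
  rw [norm_smul, Real.norm_of_nonneg (P.K_nonneg (norm_nonneg _)), mul_assoc]
  exact mul_le_mul_of_nonneg_right (P.K_le (norm_nonneg _)) (by positivity)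

variable (E μ) in
lemma exists_integral_flux_inner_ge [IsFiniteMeasure μ] :
    ∃ c C : ℝ, 0 < c ∧ 0 < C ∧ ∀ δ, 0 < δ → δ ≤ 1 → ∀ U V : X → E, Measurable U →
      MemLp U 2 μ → MemLp V 2 μ →
        c * δ ^ P.a * ∫ x, ‖V x‖ ^ P.β ∂μ - C * δ ^ 2 - C * ∫ x, ‖U x - V x‖ ^ 2 ∂μ ≤
          ∫ x, inner ℝ (P.K ‖U x‖ • U x) (V x) ∂μ := by
  obtain ⟨c, C, hc, hC, hflux⟩ := P.exists_flux_inner_ge E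
  refine ⟨c, C * (μ.real univ + 1), hc, by positivity, fun δ hδ hδ1 U V hUm hU hV => ?_⟩
  have hpow : Integrable (fun x => c * δ ^ P.a * ‖V x‖ ^ P.β) μ :=
    (integrable_norm_rpow_of_memLp_two P.β_pos P.β_lt_two.le hV).const_mul _
  have hpowδ : Integrable (fun x => c * δ ^ P.a * ‖V x‖ ^ P.β - C * δ ^ 2) μ :=
    hpow.sub (integrable_const _)
  have hsq : Integrable (fun x => C * ‖U x - V x‖ ^ 2) μ :=
    (hU.sub hV).norm.integrable_sq.const_mul _
  have hmono : ∫ x, (c * δ ^ P.a * ‖V x‖ ^ P.β - C * δ ^ 2 - C * ‖U x - V x‖ ^ 2) ∂μ ≤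
      ∫ x, inner ℝ (P.K ‖U x‖ • U x) (V x) ∂μ :=
    integral_mono (hpowδ.sub hsq) (P.integrable_flux_inner hUm hU hV)
      fun x => hflux δ hδ hδ1 (U x) (V x)
  rw [integral_sub hpowδ hsq, integral_sub hpow (integrable_const _),
    integral_const, integral_const_mul, integral_const_mul, smul_eq_mul] at hmono
  have hδ0 : 0 ≤ C * δ ^ 2 := by positivity
  have hsq0 : 0 ≤ C * μ.real univ * ∫ x, ‖U x - V x‖ ^ 2 ∂μ := by positivity
  linarith

end Integral

end GenPoly

/-! ### The energy inequality of the semidiscrete problem -/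

variable {Ω : Set (Space d)}

section L2Norm

variable {F : Type*} [NormedAddCommGroup F]

lemma l2Norm_nonneg (u : Space d → F) : 0 ≤ l2Norm Ω u := ENNReal.toReal_nonneg

lemma l2Norm_sq_eq_toReal (u : Space d → F) :
    l2Norm Ω u ^ 2 = (∫⁻ x in Ω, ‖u x‖ₑ ^ 2).toReal := by
  rw [l2Norm, ← ENNReal.toReal_pow, eLpNorm_two_sq]

lemma l2Norm_sq {u : Space d → F} (hu : MemLp u 2 (volume.restrict Ω)) :
    l2Norm Ω u ^ 2 = ∫ x in Ω, ‖u x‖ ^ 2 := by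
  rw [l2Norm_sq_eq_toReal, ← ENNReal.toReal_ofReal (integral_nonneg fun x => sq_nonneg ‖u x‖),
    ← lintegral_enorm_sq_eq hu.norm]
  simp only [enorm_norm]

lemma lintegral_enorm_sq_ne_top {u : Space d → F} (hu : MemLp u 2 (volume.restrict Ω)) :
    ∫⁻ x in Ω, ‖u x‖ₑ ^ 2 ≠ ⊤ :=
  eLpNorm_two_sq (μ := volume.restrict Ω) u ▸ ENNReal.pow_ne_top hu.2.ne

end L2Norm

lemma setIntegral_mul_le_l2Norm {u v : Space d → ℝ} (hu : MemLp u 2 (volume.restrict Ω))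
    (hv : MemLp v 2 (volume.restrict Ω)) : ∫ x in Ω, u x * v x ≤ l2Norm Ω u * l2Norm Ω v := by
  have hinner : ∫ x in Ω, u x * v x = inner ℝ (hv.toLp v) (hu.toLp u) := by
    rw [L2.inner_def]
    refine integral_congr_ae ?_
    filter_upwards [hu.coeFn_toLp, hv.coeFn_toLp] with x hux hvx
    rw [hux, hvx, RCLike.inner_apply, conj_trivial]
  calc ∫ x in Ω, u x * v x ≤ ‖hv.toLp v‖ * ‖hu.toLp u‖ := hinner ▸ real_inner_le_norm _ _
    _ = _ := by rw [Lp.norm_toLp, Lp.norm_toLp, mul_comm, l2Norm, l2Norm]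

lemma GenPoly.DegreeCondition.inv_β_sub_inv_le {P : GenPoly} (hP : P.DegreeCondition d)
    (hd : 0 < d) : P.β⁻¹ - (d : ℝ)⁻¹ ≤ 2⁻¹ := by
  have : (0 : ℝ) < d := by exact_mod_cast hd
  have hP' : P.a * (d + 2) ≤ 4 := (le_div_iff₀ (by positivity)).1 hP
  have hinv : P.β⁻¹ ≤ (d + 2) / (2 * d) := by
    rw [inv_le_comm₀ P.β_pos (by positivity), inv_div, div_le_iff₀ (by positivity), GenPoly.β]
    linarith
  have hsplit : ((d : ℝ) + 2) / (2 * d) = 2⁻¹ + (d : ℝ)⁻¹ := by field_simp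
  linarith

namespace Triangulation

variable {T : Triangulation Ω} {r : ℕ}

lemma W.gradient_sub_ae (hΩ0 : volume (frontier Ω) = 0) {u v : Space d → ℝ} (hu : u ∈ T.W r)
    (hv : v ∈ T.W r) : ∀ᵐ x ∂(volume.restrict Ω),
      gradient (fun x => u x - v x) x = gradient u x - gradient v x := by
  filter_upwards [W.ae_differentiableAt hΩ0 hu, W.ae_differentiableAt hΩ0 hv] with x hux hvx
  simp only [gradient]
  rw [fderiv_fun_sub hux hvx, map_sub]

lemma exists_l2Norm_rpow_le (hd : 2 ≤ d) (hΩ : IsOpen Ω) (hb : Bornology.IsBounded Ω)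
    (hΩ0 : volume (frontier Ω) = 0) (P : GenPoly) (hP : P.DegreeCondition d) :
    ∃ C : ℝ, 0 < C ∧ ∀ (T : Triangulation Ω) (r : ℕ), ∀ v ∈ T.W₀ r,
      l2Norm Ω v ^ P.β ≤ C * ∫ x in Ω, ‖gradient v x‖ ^ P.β := by
  have hd' : (2 : ℝ) ≤ d := by exact_mod_cast hd
  lift P.β to NNReal using P.β_pos.le with p hp
  have hp0 : 0 < (p : ℝ) := hp ▸ P.β_pos
  obtain ⟨C, hC⟩ := exists_sobolev_W₀ (p := p) (q := 2) hΩ hb hΩ0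
    (by exact_mod_cast hp ▸ P.one_lt_β.le)
    (by rw [← NNReal.coe_lt_coe, hp]; exact P.β_lt_two.trans_le hd')
    (by rw [hp]; exact hP.inv_β_sub_inv_le (by lia))
  refine ⟨(C + 1) ^ (p : ℝ), by positivity, fun T r v hv => ?_⟩
  have hsobolev := hC T r v hv
  rw [(W.memLp_gradient hΩ0 hb hv.1 p).eLpNorm_eq_integral_rpow_norm
    (by exact_mod_cast hp0.ne') ENNReal.coe_ne_top, ENNReal.coe_toReal] at hsobolev
  set I := ∫ x in Ω, ‖gradient v x‖ ^ (p : ℝ)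
  have hI0 : 0 ≤ I := integral_nonneg fun x => by positivity
  have hnorm : l2Norm Ω v ≤ C * I ^ (p : ℝ)⁻¹ := by
    have hreal := ENNReal.toReal_mono (by finiteness) hsobolev
    rwa [ENNReal.toReal_mul, ENNReal.coe_toReal, ENNReal.toReal_ofReal (by positivity)] at hreal
  calc l2Norm Ω v ^ (p : ℝ) ≤ ((C + 1) * I ^ (p : ℝ)⁻¹) ^ (p : ℝ) := by
        refine Real.rpow_le_rpow (l2Norm_nonneg v) (hnorm.trans ?_) hp0.le
        gcongr
        linarith
    _ = (C + 1) ^ (p : ℝ) * I := by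
        rw [Real.mul_rpow (by positivity) (by positivity), Real.rpow_inv_rpow hI0 hp0.ne']

lemma exists_setIntegral_flux_ge (hd : 2 ≤ d) (hΩ : IsOpen Ω) (hb : Bornology.IsBounded Ω)
    (hΩ0 : volume (frontier Ω) = 0) (P : GenPoly) (hP : P.DegreeCondition d) :
    ∃ c C : ℝ, 0 < c ∧ 0 < C ∧ ∀ (T : Triangulation Ω) (r : ℕ), ∀ u ∈ T.W r, ∀ v ∈ T.W₀ r,
      ∀ δ, 0 < δ → δ ≤ 1 →
        c * δ ^ P.a * l2Norm Ω v ^ P.β - C * δ ^ 2 -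
            C * l2Norm Ω (gradient fun x => u x - v x) ^ 2 ≤
          ∫ x in Ω, inner ℝ (P.K ‖gradient u x‖ • gradient u x) (gradient v x) := by
  have : IsFiniteMeasure (volume.restrict Ω) := ⟨by simpa using hb.measure_lt_top⟩
  obtain ⟨c, C, hc, hC, hflux⟩ := P.exists_integral_flux_inner_ge (Space d) (volume.restrict Ω)
  obtain ⟨D, hD, hsobolev⟩ := exists_l2Norm_rpow_le hd hΩ hb hΩ0 P hP
  refine ⟨c / D, C, by positivity, hC, fun T r u hu v hv δ hδ hδ1 => ?_⟩
  have hgrad : l2Norm Ω (gradient fun x => u x - v x) ^ 2 =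
      ∫ x in Ω, ‖gradient u x - gradient v x‖ ^ 2 := by
    rw [l2Norm_sq (W.memLp_gradient hΩ0 hb (W.sub_mem hu hv.1) 2)]
    refine integral_congr_ae ?_
    filter_upwards [W.gradient_sub_ae hΩ0 hu hv.1] with x hx
    rw [hx]
  have hlower : c / D * δ ^ P.a * l2Norm Ω v ^ P.β ≤
      c * δ ^ P.a * ∫ x in Ω, ‖gradient v x‖ ^ P.β := by
    calc c / D * δ ^ P.a * l2Norm Ω v ^ P.β
        ≤ c / D * δ ^ P.a * (D * ∫ x in Ω, ‖gradient v x‖ ^ P.β) :=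
          mul_le_mul_of_nonneg_left (hsobolev T r v hv) (by positivity)
      _ = _ := by field_simp
  rw [hgrad]
  linarith [hflux δ hδ hδ1 _ _ (measurable_gradient u) (W.memLp_gradient hΩ0 hb hu 2)
    (W.memLp_gradient hΩ0 hb hv.1 2)]

lemma exists_l2Norm_gradient_proj_le (hd : 2 ≤ d) (hΩ : IsOpen Ω) (hb : Bornology.IsBounded Ω)
    (hL : HasLipschitzBoundary Ω) (r : ℕ) {σ : ℝ} (hσ : 0 < σ) :
    ∃ C : ℝ, 0 ≤ C ∧ ∀ T : Triangulation Ω, T.QuasiUniform σ → ∀ u v : Space d → ℝ,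
      MemH1 Ω u → IsL2Projection Ω (T.W r) u v →
        l2Norm Ω (gradient v) ^ 2 ≤ C * h1Norm Ω u ^ 2 := by
  obtain ⟨C, hC, hstable⟩ := exists_projection_stable (by lia) hΩ hb hL r hσ
  refine ⟨C.toReal, ENNReal.toReal_nonneg, fun T hT u v hu hv => ?_⟩
  have hG : IsWeakGradient Ω u (weakGradient Ω u) := Classical.epsilon_spec hu.2
  have hu2 := lintegral_enorm_sq_ne_top hu.1
  have hG2 := lintegral_enorm_sq_ne_top hG.1
  rw [h1Norm, Real.sq_sqrt (by positivity), l2Norm_sq_eq_toReal, l2Norm_sq_eq_toReal,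
    l2Norm_sq_eq_toReal, ← ENNReal.toReal_add hu2 hG2, ← ENNReal.toReal_mul]
  exact ENNReal.toReal_mono (ENNReal.mul_ne_top hC (ENNReal.add_ne_top.2 ⟨hu2, hG2⟩))
    (hstable T hT u v _ hu.1 hG hv)

end Triangulation

namespace IsSemidiscreteSolution

variable {P : GenPoly} {T : Triangulation Ω} {r : ℕ} {ρt0 : Space d → ℝ}
  {f φ ρ ρt : ℝ → Space d → ℝ}

lemma memLp (h : IsSemidiscreteSolution P T r ρt0 f φ ρ ρt) (hΩ : IsOpen Ω)
    (hb : Bornology.IsBounded Ω) {t : ℝ} (ht : 0 ≤ t) : MemLp (ρt t) 2 (volume.restrict Ω) :=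
  Triangulation.W.memLp hΩ hb (h.mem t ht).1 2

lemma mem_W (h : IsSemidiscreteSolution P T r ρt0 f φ ρ ρt) {t : ℝ} (ht : 0 ≤ t) :
    ρ t ∈ T.W r := by
  simpa only [sub_add_cancel] using Triangulation.W.add_mem (h.proj t ht).1 (h.mem t ht).1

lemma l2Norm_sq (h : IsSemidiscreteSolution P T r ρt0 f φ ρ ρt) (hΩ : IsOpen Ω)
    (hb : Bornology.IsBounded Ω) {t : ℝ} (ht : 0 ≤ t) :
    l2Norm Ω (ρt t) ^ 2 = ∫ x in Ω, ρt t x ^ 2 := by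
  rw [Forchheimer.l2Norm_sq (h.memLp hΩ hb ht)]
  simp only [Real.norm_eq_abs, sq_abs]

lemma l2Norm_init_le (h : IsSemidiscreteSolution P T r ρt0 f φ ρ ρt) (hΩ : IsOpen Ω)
    (hb : Bornology.IsBounded Ω) (h0 : MemLp ρt0 2 (volume.restrict Ω)) :
    l2Norm Ω (ρt 0) ≤ l2Norm Ω ρt0 := by
  have hpythagoras := h.init.pythagoras (w := fun _ => 0) (by simpa using h.init.1) h0
    (h.memLp hΩ hb le_rfl) MemLp.zero
  simp only [sub_zero] at hpythagoras
  refine (pow_le_pow_iff_left₀ (l2Norm_nonneg _) (l2Norm_nonneg _) two_ne_zero).1 ?_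
  rw [l2Norm_sq_eq_toReal, l2Norm_sq_eq_toReal]
  exact ENNReal.toReal_mono (lintegral_enorm_sq_ne_top h0) (hpythagoras ▸ le_add_self)

lemma continuousWithinAt_l2Norm_sq (h : IsSemidiscreteSolution P T r ρt0 f φ ρ ρt)
    (hΩ : IsOpen Ω) (hb : Bornology.IsBounded Ω) :
    ContinuousWithinAt (fun t => l2Norm Ω (ρt t) ^ 2) (Ici 0) 0 :=
  (continuousWithinAt_energy hΩ hb self_mem_Ici h.mem h.cont_zero).congr
    (fun _ ht => h.l2Norm_sq hΩ hb ht) (h.l2Norm_sq hΩ hb le_rfl)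

lemma hasDerivAt_l2Norm_sq (h : IsSemidiscreteSolution P T r ρt0 f φ ρ ρt) (hΩ : IsOpen Ω)
    (hb : Bornology.IsBounded Ω) {t : ℝ} (ht : 0 < t) :
    HasDerivAt (fun s => l2Norm Ω (ρt s) ^ 2)
      (2 * ((∫ x in Ω, f t x * ρt t x) -
        ∫ x in Ω, inner ℝ (P.K ‖gradient (ρ t) x‖ • gradient (ρ t) x) (gradient (ρt t) x))) t := by
  have hpos : ∀ᶠ s in 𝓝 t, 0 ≤ s := (lt_mem_nhds ht).mono fun _ => le_of_lt
  rw [← h.eqn t ht _ (h.mem t ht.le), add_sub_cancel_right]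
  exact (hasDerivAt_energy hΩ hb (hpos.mono h.mem) (h.diff t ht)).congr_of_eventuallyEq
    (hpos.mono fun s hs => h.l2Norm_sq hΩ hb hs)

end IsSemidiscreteSolution

theorem exists_energyInequality (hd : 2 ≤ d) (hΩ : IsOpen Ω) (hb : Bornology.IsBounded Ω)
    (hL : HasLipschitzBoundary Ω) (P : GenPoly) (hP : P.DegreeCondition d) (r : ℕ) {σ : ℝ}
    (hσ : 0 < σ) :
    ∃ c C : ℝ, 0 < c ∧ 0 < C ∧ ∀ T : Triangulation Ω, T.QuasiUniform σ →
      ∀ (ρt0 : Space d → ℝ) (f φ ρ ρt : ℝ → Space d → ℝ),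
        (∀ t, 0 ≤ t → MemLp (f t) 2 (volume.restrict Ω)) → (∀ t, 0 ≤ t → MemH1 Ω (φ t)) →
        IsSemidiscreteSolution P T r ρt0 f φ ρ ρt →
          EnergyInequality P.β c C (fun t => l2Norm Ω (ρt t) ^ 2) (fun t => l2Norm Ω (f t))
            (fun t => h1Norm Ω (φ t)) := by
  obtain ⟨c, C, hc, hC, hflux⟩ := Triangulation.exists_setIntegral_flux_ge hd hΩ hb
    (volume_frontier_eq_zero hΩ hb hL) P hP
  obtain ⟨D, hD, hstable⟩ := Triangulation.exists_l2Norm_gradient_proj_le hd hΩ hb hL r hσ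
  refine ⟨2 * c, 2 * C * (D + 1), by positivity, by positivity, fun T hT ρt0 f φ ρ ρt hf hφ h =>
    { nonneg := fun t _ => sq_nonneg _
      source_nonneg := fun t => l2Norm_nonneg _
      continuousWithinAt_zero := h.continuousWithinAt_l2Norm_sq hΩ hb
      differentiableAt := fun t ht => (h.hasDerivAt_l2Norm_sq hΩ hb ht).differentiableAt
      deriv_le := fun t ht δ hδ hδ1 => ?_ }⟩
  have hcoercive := hflux T r _ (h.mem_W ht.le) _ (h.mem t ht.le) δ hδ hδ1
  have hproj := mul_le_mul_of_nonneg_left (hstable T hT _ _ (hφ t ht.le) (h.proj t ht.le)) hC.le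
  have hsource := setIntegral_mul_le_l2Norm (hf t ht.le) (h.memLp hΩ hb ht.le)
  have hpow : (l2Norm Ω (ρt t) ^ 2) ^ (P.β / 2) = l2Norm Ω (ρt t) ^ P.β := by
    rw [← Real.rpow_two, ← Real.rpow_mul (l2Norm_nonneg _), mul_div_cancel₀ _ two_ne_zero]
  rw [(h.hasDerivAt_l2Norm_sq hΩ hb ht).deriv, hpow, Real.sqrt_sq (l2Norm_nonneg _), P.two_sub_β]
  have hδ0 : 0 ≤ C * D * δ ^ 2 := by positivity
  have hφ0 : 0 ≤ C * h1Norm Ω (φ t) ^ 2 := by positivity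
  linarith

lemma dataSize_nonneg (P : GenPoly) (f φ : ℝ → Space d → ℝ) (t : ℝ) : 0 ≤ dataSize P Ω f φ t :=
  add_nonneg (Real.rpow_nonneg (l2Norm_nonneg _) _) (sq_nonneg _)

lemma IsSemidiscreteSolution.l2Norm_le_mul {P : GenPoly} {T : Triangulation Ω} {r : ℕ}
    {ρt0 : Space d → ℝ} {f φ ρ ρt : ℝ → Space d → ℝ}
    (h : IsSemidiscreteSolution P T r ρt0 f φ ρ ρt) (hΩ : IsOpen Ω) (hb : Bornology.IsBounded Ω)
    (h0 : MemLp ρt0 2 (volume.restrict Ω)) {c C : ℝ} (hc : 0 < c) (hC : 0 < C)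
    (hy : EnergyInequality P.β c C (fun t => l2Norm Ω (ρt t) ^ 2) (fun t => l2Norm Ω (f t))
      fun t => h1Norm Ω (φ t)) {Env : ℝ → ℝ} (hEnv : IsEnvelope (Ici 0) (dataSize P Ω f φ) Env)
    {M : ℝ} (hM : 1 ≤ M) (hAM : EnergyInequality.threshold P.β P.lam c C ^ (1 / P.β) ≤ M) {t : ℝ}
    (ht : 0 < t) : l2Norm Ω (ρt t) ≤ M * (1 + l2Norm Ω ρt0 + Env t ^ (1 / P.β)) := by
  have hsqrt := hy.sqrt_le P.holderConjugate hc hC ht fun s hs =>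
    (hEnv.2.2 s hs.1).trans (hEnv.2.1 hs.1 ht.le hs.2)
  simp only [Real.sqrt_sq (l2Norm_nonneg _)] at hsqrt
  have hEnv0 : 0 ≤ Env t := (dataSize_nonneg P f φ t).trans (hEnv.2.2 t ht.le)
  calc l2Norm Ω (ρt t)
      ≤ 1 * l2Norm Ω ρt0 +
          EnergyInequality.threshold P.β P.lam c C ^ (1 / P.β) * (1 + Env t ^ (1 / P.β)) := by
        linarith [h.l2Norm_init_le hΩ hb h0]
    _ ≤ M * l2Norm Ω ρt0 + M * (1 + Env t ^ (1 / P.β)) := by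
        gcongr
        exact l2Norm_nonneg _
    _ = M * (1 + l2Norm Ω ρt0 + Env t ^ (1 / P.β)) := by ring

/-! ### Upper limits -/

lemma eventually_le_of_limsupTop_lt {u : ℝ → ℝ} {m : ℝ} (h : limsupTop u < ENNReal.ofReal m) :
    ∀ᶠ t in atTop, u t ≤ m := by
  filter_upwards [eventually_lt_of_limsup_lt h (by isBoundedDefault)] with t ht
  exact (ENNReal.ofReal_lt_ofReal_iff'.1 ht).1.le

lemma tendsto_of_limsupTop_eq_zero {u : ℝ → ℝ} (hu : ∀ t, 0 ≤ u t) (h : limsupTop u = 0) :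
    Tendsto u atTop (𝓝 0) := by
  refine tendsto_order.2 ⟨fun m hm => Eventually.of_forall fun t => hm.trans_le (hu t),
    fun m hm => ?_⟩
  have hlt : limsupTop u < ENNReal.ofReal (m / 2) := h ▸ ENNReal.ofReal_pos.2 (half_pos hm)
  exact (eventually_le_of_limsupTop_lt hlt).mono fun t ht => ht.trans_lt (half_lt_self hm)

lemma limsupTop_eq_zero {u : ℝ → ℝ} (h : Tendsto u atTop (𝓝 0)) : limsupTop u = 0 := by
  simpa only [limsupTop, ENNReal.ofReal_zero] using (ENNReal.tendsto_ofReal h).limsup_eq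

lemma limsupTop_le_mul_rpow {u v : ℝ → ℝ} {C q : ℝ} (hC : 0 < C) (hq : 0 < q)
    (h : ∀ G, 0 ≤ G → (∀ᶠ t in atTop, v t ≤ G) → ∀ᶠ t in atTop, u t ≤ C * (1 + G) ^ q) :
    limsupTop u ≤ ENNReal.ofReal C * (1 + limsupTop v) ^ q := by
  rcases eq_or_ne (limsupTop v) ⊤ with htop | htop
  · rw [htop, add_top, ENNReal.top_rpow_of_pos hq, ENNReal.mul_top (ENNReal.ofReal_pos.2 hC).ne']
    exact le_top
  lift limsupTop v to NNReal using htop with L hL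
  have hbound : ∀ᶠ G in 𝓝[>] (L : ℝ), limsupTop u ≤ ENNReal.ofReal (C * (1 + G) ^ q) := by
    filter_upwards [self_mem_nhdsWithin] with G hG
    have hG0 : 0 < G := L.2.trans_lt hG
    have hlt : limsupTop v < ENNReal.ofReal G := by
      rwa [← hL, ← ENNReal.ofReal_coe_nnreal, ENNReal.ofReal_lt_ofReal_iff hG0]
    exact limsup_le_of_le (by isBoundedDefault)
      ((h G hG0.le (eventually_le_of_limsupTop_lt hlt)).mono fun t =>
        ENNReal.ofReal_le_ofReal)
  have hlim : Tendsto (fun G => ENNReal.ofReal (C * (1 + G) ^ q)) (𝓝[>] (L : ℝ))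
      (𝓝 (ENNReal.ofReal (C * (1 + L) ^ q))) := by
    have hcont : Continuous fun G : ℝ => C * (1 + G) ^ q :=
      continuous_const.mul ((Real.continuous_rpow_const hq.le).comp (continuous_const_add 1))
    exact ((ENNReal.continuous_ofReal.comp hcont).tendsto _).mono_left nhdsWithin_le_nhds
  refine (ge_of_tendsto hlim hbound).trans_eq ?_
  rw [ENNReal.ofReal_mul hC.le, ← ENNReal.ofReal_rpow_of_pos (by positivity),
    ENNReal.ofReal_add zero_le_one L.coe_nonneg, ENNReal.ofReal_one, ENNReal.ofReal_coe_nnreal]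

end Forchheimer

end

open Forchheimer

theorem theorem4p1 (d : ℕ) (hd : 2 ≤ d) (Ω : Set (Space d)) (hΩo : IsOpen Ω)
    (hΩb : Bornology.IsBounded Ω) (hΩL : HasLipschitzBoundary Ω)
    (P : GenPoly) (hP : P.DegreeCondition d) (r : ℕ) (σ : ℝ) (hσ : 0 < σ) :
    ∃ C : ℝ, 0 < C ∧ ∀ T : Triangulation Ω, T.QuasiUniform σ →
      ∀ (ρt0 : Space d → ℝ) (f φ ρh ρth : ℝ → Space d → ℝ),
        MemLp ρt0 2 (volume.restrict Ω) →
        (∀ t, 0 ≤ t → MemLp (f t) 2 (volume.restrict Ω)) →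
        (∀ t, 0 ≤ t → MemH1 Ω (φ t)) →
        IsSemidiscreteSolution P T r ρt0 f φ ρh ρth →
          (∀ Env : ℝ → ℝ, IsEnvelope (Ici 0) (dataSize P Ω f φ) Env → ∀ t, 0 < t →
            l2Norm Ω (ρth t) ≤ C * (1 + l2Norm Ω ρt0 + Env t ^ (1 / P.β))) ∧
          limsupTop (fun t => l2Norm Ω (ρth t) ^ 2) ≤
            ENNReal.ofReal C * (1 + limsupTop (dataSize P Ω f φ)) ^ (2 / P.β) ∧
          (limsupTop (fun t => l2Norm Ω (f t)) = 0 →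
            limsupTop (fun t => h1Norm Ω (φ t)) = 0 →
              limsupTop (fun t => l2Norm Ω (ρth t) ^ 2) = 0) := by
  obtain ⟨c, C, hc, hC, henergy⟩ := exists_energyInequality hd hΩo hΩb hΩL P hP r hσ
  have hβ := P.holderConjugate
  have h2β : 0 < 2 / P.β := div_pos two_pos P.β_pos
  set A := EnergyInequality.threshold P.β P.lam c C
  have hA : 0 < A := EnergyInequality.threshold_pos hc hC
  refine ⟨max 1 (max (A ^ (1 / P.β)) (A ^ (2 / P.β))), by positivity,
    fun T hT ρt0 f φ ρh ρth h0 hf hφ h => ?_⟩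
  have hy := henergy T hT ρt0 f φ ρh ρth hf hφ h
  refine ⟨fun Env hEnv t ht => ?_, ?_, fun hf0 hφ0 => ?_⟩
  · exact h.l2Norm_le_mul hΩo hΩb h0 hc hC hy hEnv (le_max_left _ _)
      (le_max_of_le_right (le_max_left _ _)) ht
  · refine (limsupTop_le_mul_rpow (v := dataSize P Ω f φ) (by positivity) h2β
      fun G hG hdata => hy.eventually_le hβ hc hC hG hdata).trans ?_
    gcongr
    exact le_max_of_le_right (le_max_right _ _)
  · exact limsupTop_eq_zero (hy.tendsto_zero hβ hc hC
      (tendsto_of_limsupTop_eq_zero (fun t => l2Norm_nonneg _) hf0)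
      (tendsto_of_limsupTop_eq_zero (fun t => Real.sqrt_nonneg _) hφ0))
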